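/- Let $\chi=(\chi_{ij})$ be an integral $n\times N$ matrix of rank $n$ such that $c\chi=(1,\dots,1)$ for some $c\in\mathbb Z^n$, and let $L=\{a\in\mathbb Z^N\mid \chi a=0\}$. The torus $T=(\mathbb C^\times)^n$ acts on $V^*=\mathbb C^N$, with coordinates $\xi=(\xi_j)$, by $t\cdot\xi=(t^{\chi_j}\xi_j)_j$, $t^{\chi_j}=\prod_i t_i^{\chi_{ij}}$; let $z=(z_j)$ be the dual coordinates on $V=\mathbb C^N$, so that $\mathbb C^{2N}=\{(z,\xi)\}$ is both $T^*V$ and $T^*V^*$ (with $(z,\xi)$ in the latter being the covector $\sum_j z_j\,d\xi_j$ at $\xi$). Let $\mathbf i=(1,\dots,1)\in V^*$, write $O_T(p)$ for the $T$-orbit of $p$, and let closures be taken in the Zariski topology. Put $$\bar\theta_i=\sum_j\chi_{ij}z_j\xi_j,\qquad b_a(\xi)=\prod_{a_j>0}\xi_j^{a_j}-\prod_{a_j<0}\xi_j^{|a_j|},\qquad A=\mathbb C[z,\xi]/(\bar\theta_i,\ b_a \mid 1\le i\le n,\ a\in L).$$ **Lemma.** The closure $\overline{O_T(\mathbf i)}$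 is a disjoint union of finitely many $T$-orbits $O_T(p_1),\dots,O_T(p_r)$, and $$\operatorname{Supp}A=\coprod_{k=1}^r T^*_{O_T(p_k)}V^*$$ is the disjoint union of their conormal bundles in $T^*V^*$. Moreover, for $\lambda\in\mathbb C^n$ let $M_\lambda=D/I_\lambda$, where $D=\mathbb C[z_j,\partial_{z_j}]$ is the Weyl algebra of $V$ and $I_\lambda$ is the left ideal generated by $\sum_j\chi_{ij}z_j\partial_{z_j}-\lambda_i$ $(1\le i\le n)$ and $b_a(\partial_z)$ $(a\in L)$. Let $\operatorname{ch}M_\lambda\subset T^*V=\mathbb C^{2N}$ be its characteristic variety, i.e. the zero set of the annihilator of $\operatorname{gr}^F M_\lambda$ in $\operatorname{gr}D=\mathbb C[z,\xi]$ for a good filtration $F$ of $M_\lambda$ with respect to the order filtration of $D$ (the statement is asserted for every good filtration). Then every irreducible component of $\operatorname{ch}M_\lambda$ is the closure of the conormal bundle $T^*_{O_T(p_k)}V^*$ of one of these orbits, and it has dimension $N$. -/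

import Mathlib

noncomputable section

open MvPolynomial

/-! ### Complex affine space with its Zariski topology -/

/-- The affine space `ℂ^σ`, carrying the Zariski topology. -/
def ZarAffine (σ : Type*) : Type _ := σ → ℂ

/-- The point of the spectrum (the maximal ideal of functions vanishing at `x`)
that corresponds to `x`. -/
def ZarAffine.toSpec {σ : Type*} (x : ZarAffine σ) : PrimeSpectrum (MvPolynomial σ ℂ) :=
  MvPolynomial.pointToPoint (k := ℂ) (σ := σ) (K := ℂ) x

/-- The closed sets are the sets of common zeros of polynomials. -/
instance (σ : Type*) : TopologicalSpace (ZarAffine σ) :=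
  TopologicalSpace.induced ZarAffine.toSpec inferInstance

/-- `Z` is an irreducible component of the subset `Y`. -/
def IsIrredComponentOf {X : Type*} [TopologicalSpace X] (Z Y : Set X) : Prop :=
  Maximal (fun S : Set X => IsIrreducible S ∧ S ⊆ Y) Z

/-- The support in `ℂ^σ` of a module over the polynomial ring: the points at whose maximal ideal
the localization is nonzero. -/
def affineSupport {σ : Type*} (M : Type*) [AddCommGroup M] [Module (MvPolynomial σ ℂ) M] :
    Set (ZarAffine σ) :=
  {x | x.toSpec ∈ Module.support (MvPolynomial σ ℂ) M}

/-! ### The Weyl algebra, its order filtration and its symbols -/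

/-- Coordinates on `ℂ^N × ℂ^N`: `Sum.inl j` stands for `z_j`, `Sum.inr j` stands for `ξ_j`. -/
abbrev PhaseIdx (N : ℕ) : Type := Fin N ⊕ Fin N

/-- The Weyl algebra of `ℂ^N`: the differential operators with polynomial coefficients,
acting on the polynomials in `z`. -/
def weylSubalgebra (N : ℕ) : Subalgebra ℂ (Module.End ℂ (MvPolynomial (Fin N) ℂ)) :=
  Algebra.adjoin ℂ
    (Set.range (fun j : Fin N => LinearMap.mulLeft ℂ (X j : MvPolynomial (Fin N) ℂ)) ∪
      Set.range (fun j : Fin N =>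
        (pderiv j : Derivation ℂ (MvPolynomial (Fin N) ℂ) (MvPolynomial (Fin N) ℂ)).toLinearMap))

/-- The Weyl algebra of `ℂ^N`, as a type. -/
def Weyl (N : ℕ) : Type := weylSubalgebra N

instance (N : ℕ) : Ring (Weyl N) := inferInstanceAs (Ring (weylSubalgebra N))

instance (N : ℕ) : Algebra ℂ (Weyl N) := inferInstanceAs (Algebra ℂ (weylSubalgebra N))

namespace Weyl

variable {N : ℕ}

/-- Multiplication by `z_j`. -/
def z (j : Fin N) : Weyl N :=
  ⟨LinearMap.mulLeft ℂ (X j), Algebra.subset_adjoin (Or.inl ⟨j, rfl⟩)⟩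

/-- The partial derivative `∂/∂z_j`. -/
def d (j : Fin N) : Weyl N :=
  ⟨(pderiv j : Derivation ℂ (MvPolynomial (Fin N) ℂ) (MvPolynomial (Fin N) ℂ)).toLinearMap,
    Algebra.subset_adjoin (Or.inr ⟨j, rfl⟩)⟩

/-- The operator `∑ c_{β,α} z^β ∂^α` with total symbol `∑ c_{β,α} z^β ξ^α`. -/
def op : MvPolynomial (PhaseIdx N) ℂ →ₗ[ℂ] Weyl N :=
  (MvPolynomial.basisMonomials (PhaseIdx N) ℂ).constr ℂ fun s =>
    (List.ofFn fun j => z j ^ s (Sum.inl j)).prod * (List.ofFn fun j => d j ^ s (Sum.inr j)).prod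

/-- The weight that defines the degree in the variables `ξ`. -/
def xiWeight : PhaseIdx N → ℕ := Sum.elim (fun _ => 0) (fun _ => 1)

/-- The operators of order at most `l`, i.e. `F_l D`. -/
def orderLE (N l : ℕ) : Set (Weyl N) :=
  op '' {p | weightedTotalDegree xiWeight p ≤ l}

variable {M : Type*} [AddCommGroup M] [Module (Weyl N) M]

/-- The additive subgroup `F_l D · S` generated by the products `P x`, `P ∈ F_l D`, `x ∈ S`.
It is the `ℂ[z]`-submodule generated by them, because `F_l D` is stable under left
multiplication by `ℂ[z]`. -/
def orderMul (l : ℕ) (S : Set M) : AddSubgroup M :=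
  AddSubgroup.closure {y | ∃ P ∈ orderLE N l, ∃ x ∈ S, y = P • x}

/-- Good filtrations of a left module over the Weyl algebra: increasing filtrations by finitely
generated `ℂ[z]`-submodules (note that `F_0 D = ℂ[z]`, so `mul_le` with `l = 0` says that every
`F m` is one). -/
structure IsGoodFiltration (F : ℤ → AddSubgroup M) : Prop where
  mono : Monotone F
  fg : ∀ m, ∃ S : Finset M, F m = orderMul (N := N) 0 (S : Set M)
  eventually_bot : ∃ m₀, ∀ m ≤ m₀, F m = ⊥
  exhaustive : ∀ x, ∃ m, x ∈ F m
  mul_le : ∀ (l : ℕ) (m : ℤ), orderMul (N := N) l (F m : Set M) ≤ F (m + l)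
  good : ∃ m₀, ∀ m ≥ m₀, ∀ l : ℕ, orderMul (N := N) l (F m : Set M) = F (m + l)

/-- `f ∈ ℂ[z, ξ] = gr D` annihilates the graded module `gr^F M = ⨁ F_m M / F_{m-1} M`.
The component `f_l` of degree `l` in `ξ` is the symbol of the operator `op f_l` of order `l`; it
sends the class of `x ∈ F_m M` to the class of `op f_l • x` in `F_{m+l} M / F_{m+l-1} M`. -/
def AnnihilatesGr (F : ℤ → AddSubgroup M) (f : MvPolynomial (PhaseIdx N) ℂ) : Prop :=
  ∀ (l : ℕ) (m : ℤ), ∀ x ∈ F m,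
    op (weightedHomogeneousComponent xiWeight l f) • x ∈ F (m + l - 1)

/-- The characteristic variety in `T^*ℂ^N = ℂ^N × ℂ^N`, computed from the filtration `F`: the zeros
of the annihilator of `gr^F M`. -/
def charVariety (F : ℤ → AddSubgroup M) : Set (ZarAffine (PhaseIdx N)) :=
  {x | ∀ f : MvPolynomial (PhaseIdx N) ℂ, AnnihilatesGr F f → eval (σ := PhaseIdx N) x f = 0}

end Weyl

/-! ### Torus orbits and conormal bundles -/

/-- The orbit of `p` under the torus `(ℂˣ)^n`, where `t` acts on the coordinate `ξ_j` through the
character `t ↦ ∏ t_i ^ χ_ij`. -/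
def torusOrbit {n N : ℕ} (χ : Matrix (Fin n) (Fin N) ℤ) (p : ZarAffine (Fin N)) :
    Set (ZarAffine (Fin N)) :=
  {ξ | ∃ t : Fin n → ℂˣ, ∀ j, ξ j = (∏ i, (t i : ℂ) ^ χ i j) * p j}

/-- The reference point all of whose coordinates are `1`. -/
def onePoint (N : ℕ) : ZarAffine (Fin N) := fun _ => 1

/-- The set of torus orbits of the points in the Zariski closure of the orbit of the
reference point. -/
def orbitsInClosure {n N : ℕ} (χ : Matrix (Fin n) (Fin N) ℤ) : Set (Set (ZarAffine (Fin N))) :=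
  torusOrbit χ '' closure (torusOrbit χ (onePoint N))

/-- The Zariski tangent space at `x` of a (locally closed) subset `S` of affine space. -/
def zarTangent {N : ℕ} (S : Set (ZarAffine (Fin N))) (x : ZarAffine (Fin N)) :
    Set (Fin N → ℂ) :=
  {v | ∀ f : MvPolynomial (Fin N) ℂ, (∀ y ∈ S, eval (σ := Fin N) y f = 0) →
    ∑ j, eval (σ := Fin N) x (pderiv j f) * v j = 0}

/-- The conormal bundle of `S` in the cotangent bundle of the `ξ`-space; a point of
`ℂ^N × ℂ^N` is read as the covector `∑ z_j dξ_j` at the point `ξ`. -/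
def conormalBundle {N : ℕ} (S : Set (ZarAffine (Fin N))) : Set (ZarAffine (PhaseIdx N)) :=
  {x | (fun j => x (Sum.inr j)) ∈ S ∧
    ∀ v ∈ zarTangent S (fun j => x (Sum.inr j)), ∑ j, x (Sum.inl j) * v j = 0}

/-! ### The hypergeometric system -/

/-- The polynomial `∑_j χ_ij z_j ξ_j`. -/
def thetaBar {n N : ℕ} (χ : Matrix (Fin n) (Fin N) ℤ) (i : Fin n) :
    MvPolynomial (PhaseIdx N) ℂ :=
  ∑ j, C (χ i j : ℂ) * X (Sum.inl j) * X (Sum.inr j)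

/-- The binomial `∏_{a_j > 0} ξ_j ^ a_j - ∏_{a_j < 0} ξ_j ^ |a_j|`. -/
def xiBox {N : ℕ} (a : Fin N → ℤ) : MvPolynomial (PhaseIdx N) ℂ :=
  ∏ j, X (Sum.inr j) ^ (a j).toNat - ∏ j, X (Sum.inr j) ^ (-a j).toNat

/-- The ideal generated by the `thetaBar χ i` and by the binomials for `a ∈ L = ker χ`. -/
def symbolIdeal {n N : ℕ} (χ : Matrix (Fin n) (Fin N) ℤ) : Ideal (MvPolynomial (PhaseIdx N) ℂ) :=
  Ideal.span (Set.range (thetaBar χ) ∪ xiBox '' {a | χ.mulVec a = 0})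

/-- The ring `A = ℂ[z, ξ] / (θ̄_i, ξ-binomials)`. -/
abbrev SymbolRing {n N : ℕ} (χ : Matrix (Fin n) (Fin N) ℤ) : Type :=
  MvPolynomial (PhaseIdx N) ℂ ⧸ symbolIdeal χ

/-- The left ideal of the Weyl algebra generated by `∑_j χ_ij z_j ∂_j - lam_i` and by
`∏_{a_j > 0} ∂_j ^ a_j - ∏_{a_j < 0} ∂_j ^ |a_j|` for `a ∈ L = ker χ`. -/
def hyperIdeal {n N : ℕ} (χ : Matrix (Fin n) (Fin N) ℤ) (lam : Fin n → ℂ) :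
    Ideal (Weyl N) :=
  Ideal.span
    (Set.range (fun i => Weyl.op (thetaBar χ i) - algebraMap ℂ (Weyl N) (lam i)) ∪
      (fun a => Weyl.op (xiBox a)) '' {a | χ.mulVec a = 0})

/-- The generalized hypergeometric module `M_lam`. -/
abbrev HyperModule {n N : ℕ} (χ : Matrix (Fin n) (Fin N) ℤ) (lam : Fin n → ℂ) : Type :=
  Weyl N ⧸ hyperIdeal χ lam

end

/-! The orbit closure. On the common zeros of the binomials `b_a` a monomial depends only on its
torus weight, and by independence of characters every polynomial vanishing on the orbit of `(1, …,
1)` splits by weight; so the closure is exactly this zero set (`closure_torusOrbit_onePoint`). Two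
of its points with the same vanishing coordinates differ by a torus element, because `ℂˣ` is
divisible and homomorphisms into it extend (`mem_torusOrbit_of_mem_toricSet`). Hence an orbit is
determined by a subset of the coordinates, and there are finitely many.

The support of `A`. The tangent space of an orbit at `ξ` is spanned by the vectors `(χ_ij ξ_j)_j`,
so over an orbit the equations `θ̄_i = 0` are the conormal condition (`mem_conormalBundle_iff`).

The upper bound for the characteristic variety. The condition `cχ = (1, …, 1)` makes the binomials
homogeneous in `ξ`, so the generators of `I_λ` have the symbols `θ̄_i` and `b_a`. Commutators lower
the order; therefore, for every good filtration, powers of these symbols kill the symbol module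
(`mem_radical_annihilator`). So the characteristic variety lies in the finite union of conormal
bundles, and a component `Z` is the closure of its part over a single orbit.

The lower bound. It remains to see that `Z` fills the conormal bundle; a trace argument on the Rees
module does this. Let `J` be the set of nonzero coordinates on the orbit and `J₀ ⊆ J` a maximal set
of independent columns of `χ`. On the conormal bundle every function is algebraic over the `N`
functions `ξ_j` (`j ∈ J₀`) and `z_j` (`j ∉ J₀`), one from each conjugate pair. If they were
dependent on `Z`, a transcendence basis chosen among them would miss an index `j0`, and both
`z_{j0}` and `∂_{j0}` would commute with the basis. After inverting the nonzero polynomials in the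
basis, the part of the symbol module that belongs to `Z` is a finite-dimensional space. The relation
`[∂, z] = t`, read modulo `t²`, writes the identity of that space as a sum of two commutators, so
its dimension is zero in characteristic zero, a contradiction
(`algebraicIndependent_of_mem_minimalPrimes`). Hence `Z` has dimension `N`, and its prime equals
that of the conormal bundle, since nested primes with a common transcendence basis coincide
(`eq_of_le_of_algebraicIndependent`). -/

noncomputable section

open MvPolynomial

/-! ### A trace obstruction to a Heisenberg relation -/

/-- For a short exact sequence `0 → W → W → G → 0` with first map `t`, an operator commuting with
`t` and a linear section `σ`, the deviation of `σ` from being equivariant is divisible by `t`. -/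
theorem exists_deviation {K W G : Type*} [Field K] [AddCommGroup W] [Module K W]
    [AddCommGroup G] [Module K G] {t x : Module.End K W} {π : W →ₗ[K] G} {x0 : Module.End K G}
    (ht : Function.Injective t) (hex : LinearMap.ker π = LinearMap.range t)
    (hx : ∀ w, π (x w) = x0 (π w)) {σ : G →ₗ[K] W} (hσ : ∀ g, π (σ g) = g) :
    ∃ ψ : G →ₗ[K] W, ∀ g, x (σ g) = σ (x0 g) + t (ψ g) := by
  have hmem : ∀ g, (x ∘ₗ σ - σ ∘ₗ x0) g ∈ LinearMap.range t := fun g => by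
    rw [← hex]; simp [hx, hσ]
  refine ⟨(LinearEquiv.ofInjective t ht).symm.toLinearMap ∘ₗ
    LinearMap.codRestrict _ (x ∘ₗ σ - σ ∘ₗ x0) hmem, fun g => ?_⟩
  have h := LinearEquiv.apply_symm_apply (LinearEquiv.ofInjective t ht)
    (LinearMap.codRestrict _ (x ∘ₗ σ - σ ∘ₗ x0) hmem g)
  have h' := congrArg Subtype.val h
  simp only [LinearEquiv.ofInjective_apply, LinearMap.codRestrict_apply, LinearMap.sub_apply,
    LinearMap.comp_apply] at h'
  simp only [LinearMap.comp_apply, LinearEquiv.coe_coe]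
  rw [h']; abel

/-- Let `[x, y] = t` on `W` with `t` central and injective. Then a finite rank idempotent of
`W / t W` that commutes with `x` and `y` vanishes. -/
theorem idempotent_eq_zero_of_heisenberg {K W G : Type*} [Field K] [CharZero K]
    [AddCommGroup W] [Module K W] [AddCommGroup G] [Module K G]
    {t x y : Module.End K W} {π : W →ₗ[K] G} {x0 y0 e : Module.End K G}
    (ht : Function.Injective t) (hπ : Function.Surjective π)
    (hex : LinearMap.ker π = LinearMap.range t)
    (hxt : ∀ w, x (t w) = t (x w)) (hyt : ∀ w, y (t w) = t (y w))
    (hxy : ∀ w, x (y w) = y (x w) + t w)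
    (hx : ∀ w, π (x w) = x0 (π w)) (hy : ∀ w, π (y w) = y0 (π w))
    (he : ∀ g, e (e g) = e g) (hex0 : ∀ g, e (x0 g) = x0 (e g))
    (hey0 : ∀ g, e (y0 g) = y0 (e g)) [FiniteDimensional K (LinearMap.range e)] : e = 0 := by
  obtain ⟨σ, hσ'⟩ := π.exists_rightInverse_of_surjective (LinearMap.range_eq_top.2 hπ)
  have hσ : ∀ g, π (σ g) = g := fun g => LinearMap.congr_fun hσ' g
  obtain ⟨ψx, hψx⟩ := exists_deviation ht hex hx hσ
  obtain ⟨ψy, hψy⟩ := exists_deviation ht hex hy hσ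
  have hπt : ∀ w, π (t w) = 0 := fun w => by
    rw [← LinearMap.mem_ker, hex]; exact ⟨w, rfl⟩
  have hcomm0 : ∀ g, x0 (y0 g) = y0 (x0 g) := fun g => by
    have h := congrArg π (hxy (σ g))
    simpa [hx, hy, hσ, hπt] using h
  -- The relation `[x, y] = t` at `σ g`, taken modulo `t²`: the terms free of `t` cancel because
  -- `x0` and `y0` commute, and injectivity removes one factor `t`. It exhibits the identity of `G`
  -- as a sum of two commutators.
  have key : ∀ g, π (ψx (y0 g)) + x0 (π (ψy g)) = π (ψy (x0 g)) + y0 (π (ψx g)) + g := fun g => by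
    have h := hxy (σ g)
    rw [hψy, hψx, map_add, map_add, hψx, hψy, hxt, hyt, hcomm0, add_assoc, add_assoc, add_assoc,
      ← map_add, ← map_add, add_left_cancel_iff, ← map_add] at h
    have h2 := congrArg π (ht h)
    simp only [map_add, hx, hy, hσ] at h2
    rw [h2]; abel
  set U := LinearMap.range e
  have hU : ∀ u : U, e u = u := by
    rintro ⟨_, g, rfl⟩; exact he g
  let i : U →ₗ[K] G := U.subtype
  let q : G →ₗ[K] U := e.rangeRestrict
  have hq : ∀ g, (q g : G) = e g := fun g => rfl
  -- Compression to the range of `e`. Only `x0` and `y0` commute with `e`, but every product in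
  -- `key` has one of them as a factor, so the commutators survive the compression.
  let cx : Module.End K U := q ∘ₗ x0 ∘ₗ i
  let cy : Module.End K U := q ∘ₗ y0 ∘ₗ i
  let fx : Module.End K U := q ∘ₗ (π ∘ₗ ψx) ∘ₗ i
  let fy : Module.End K U := q ∘ₗ (π ∘ₗ ψy) ∘ₗ i
  have hcx : ∀ u : U, ((cx u : U) : G) = x0 u := fun u => by
    change e (x0 u) = _; rw [hex0, hU]
  have hcy : ∀ u : U, ((cy u : U) : G) = y0 u := fun u => by
    change e (y0 u) = _; rw [hey0, hU]
  have hfx : ∀ u : U, ((fx u : U) : G) = e (π (ψx u)) := fun u => rfl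
  have hfy : ∀ u : U, ((fy u : U) : G) = e (π (ψy u)) := fun u => rfl
  have hid : fx * cy + cx * fy = fy * cx + cy * fx + 1 := by
    ext u
    have h := congrArg e (key u)
    simp only [LinearMap.add_apply, Module.End.mul_apply, Module.End.one_apply,
      Submodule.coe_add, hfx, hfy, hcx, hcy]
    simp only [map_add, hex0, hey0, hU] at h
    exact h
  -- Commutators have trace zero, so the trace of the identity, which is the dimension of `U`,
  -- vanishes in `K`.
  have htr := congrArg (LinearMap.trace K U) hid
  simp only [map_add] at htr
  rw [LinearMap.trace_mul_comm K fx cy, LinearMap.trace_mul_comm K cx fy, LinearMap.trace_one,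
    add_comm (LinearMap.trace K U (cy * fx))] at htr
  have h0 : (Module.finrank K U : K) = 0 := by
    simpa using htr
  have h1 : U = ⊥ := by
    rw [Nat.cast_eq_zero] at h0
    exact Submodule.finrank_eq_zero.1 h0
  exact LinearMap.range_eq_bot.1 h1

/-! ### Isolating a minimal prime of the annihilator -/

/-- A power of a minimal prime `P` over `J` multiplied by a suitable element outside `P` lies
in `J`. -/
theorem Ideal.exists_mul_pow_le_of_mem_minimalPrimes {B : Type*} [CommRing B] [IsNoetherianRing B]
    {J P : Ideal B} (hP : P ∈ J.minimalPrimes) :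
    ∃ g ∉ P, ∃ k : ℕ, ∀ p ∈ P ^ k, g * p ∈ J := by
  classical
  obtain ⟨n, hn⟩ := J.exists_radical_pow_le_of_fg J.radical.fg_of_isNoetherianRing
  have h := J.finite_minimalPrimes_of_isNoetherianRing B
  rw [← J.sInf_minimalPrimes, ← h.coe_toFinset, ← h.toFinset.inf_id_eq_sInf,
    ← Finset.insert_erase (h.mem_toFinset.mpr hP), Finset.inf_insert, id_eq] at hn
  grw [← Ideal.mul_le_inf, mul_pow] at hn
  have hPp : P.IsPrime := hP.1.1
  -- A prime that contains a finite intersection contains one of its members, and `P` contains no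
  -- other minimal prime. The multiplier is a power of an element of the intersection of the others.
  have hne : ¬ ((h.toFinset.erase P).inf id) ≤ P := by
    have (K : Ideal B) (hKI : K ≤ P) (hK : K ∈ J.minimalPrimes) : K = P :=
      le_antisymm hKI (hP.2 hK.1 hKI)
    rw [hPp.inf_le']
    rintro ⟨K, hK, hKP⟩
    rw [Finset.mem_erase, Set.Finite.mem_toFinset] at hK
    exact hK.1 (this K hKP hK.2)
  obtain ⟨g, hg, hgP⟩ := SetLike.not_le_iff_exists.1 hne
  refine ⟨g ^ n, fun hc => hgP (hPp.mem_of_pow_mem n hc), n, fun p hp => ?_⟩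
  rw [mul_comm]
  exact hn (Ideal.mul_mem_mul hp (Ideal.pow_mem_pow hg n))

/-- If the quotient by a minimal prime `P` of `J` is algebraic over `A`, there is `f ∈ B` which
modulo `J` satisfies `f² = s f` for a nonzero scalar `s ∈ A` and cuts out the component of `P`. -/
theorem exists_quasi_idempotent {A B : Type*} [CommRing A] [IsDomain A] [CommRing B]
    [IsNoetherianRing B] [Algebra A B] {J P : Ideal B} (hP : P ∈ J.minimalPrimes)
    [Algebra.IsAlgebraic A (B ⧸ P)] (hinj : Function.Injective (algebraMap A (B ⧸ P))) :
    ∃ (f : B) (s : A) (k : ℕ), s ≠ 0 ∧ f ∉ P ∧ (∀ p ∈ P ^ k, f * p ∈ J) ∧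
      f * f - algebraMap A B s * f ∈ J := by
  have hPp : P.IsPrime := hP.1.1
  obtain ⟨g, hg, k, hk⟩ := Ideal.exists_mul_pow_le_of_mem_minimalPrimes hP
  have hg0 : (Ideal.Quotient.mk P g) ≠ 0 := by rwa [Ne, Ideal.Quotient.eq_zero_iff_mem]
  obtain ⟨s, hs, ⟨u', hu'⟩⟩ := (Algebra.IsAlgebraic.isAlgebraic (R := A)
    (Ideal.Quotient.mk P g)).exists_nonzero_dvd (mem_nonZeroDivisors_of_ne_zero hg0)
  obtain ⟨u, rfl⟩ := Ideal.Quotient.mk_surjective u'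
  have h1 : algebraMap A B s - g * u ∈ P := by
    rw [← Ideal.Quotient.eq_zero_iff_mem, map_sub, map_mul, ← hu', sub_eq_zero]; rfl
  have hsP : algebraMap A B s ∉ P := fun hc => by
    refine hs (hinj ?_)
    rw [map_zero]
    change Ideal.Quotient.mk P (algebraMap A B s) = 0
    rwa [Ideal.Quotient.eq_zero_iff_mem]
  -- The congruence `g u ≡ s` modulo `P` is sharpened to `g u v ≡ s ^ (k + 1)` modulo `P ^ (k + 1)`.
  -- For `f = g u v` the product `f (f - s ^ (k + 1))` is then a multiple of `g` times an element of
  -- `P ^ k`, hence lies in `J`.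
  obtain ⟨v, hv⟩ : g * u ∣ algebraMap A B s ^ (k + 1) - (algebraMap A B s - g * u) ^ (k + 1) := by
    simpa using sub_dvd_pow_sub_pow (algebraMap A B s) (algebraMap A B s - g * u) (k + 1)
  have hf : algebraMap A B s ^ (k + 1) - g * u * v ∈ P ^ (k + 1) := by
    rw [← hv]; simpa using Ideal.pow_mem_pow h1 (k + 1)
  refine ⟨g * u * v, s ^ (k + 1), k, pow_ne_zero _ hs, fun hc => ?_, fun p hp => ?_, ?_⟩
  · exact hsP (hPp.mem_of_pow_mem _ (by
      simpa using P.add_mem (Ideal.pow_le_self k.succ_ne_zero hf) hc))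
  · rw [mul_assoc g, mul_right_comm, mul_comm]
    exact J.mul_mem_left _ (hk p hp)
  · have := J.mul_mem_left (-(u * v)) (hk _ (Ideal.pow_le_pow_right k.le_succ hf))
    rw [map_pow]
    convert this using 1
    ring

open TensorProduct in
/-- Localizing at the nonzero scalars makes a finite module that is supported on a prime
algebraic over `A` finite-dimensional. -/
theorem finite_tensor_quotient_pow {A B K : Type*} [CommRing A] [IsDomain A] [CommRing B]
    [Algebra A B] [Algebra.FiniteType A B] [Field K] [Algebra A K] [IsFractionRing A K]
    (P : Ideal B) [P.IsPrime] [Algebra.IsAlgebraic A (B ⧸ P)] (k : ℕ) :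
    Module.Finite K (K ⊗[A] (B ⧸ P ^ k)) := by
  have : FaithfulSMul A K := (faithfulSMul_iff_algebraMap_injective A K).2 (IsFractionRing.injective A K)
  have halg : Algebra.IsAlgebraic A (B ⧸ P ^ k) := ⟨fun q => by
    obtain ⟨b, rfl⟩ := Ideal.Quotient.mk_surjective q
    obtain ⟨p, hp0, hp⟩ := Algebra.IsAlgebraic.isAlgebraic (R := A) (Ideal.Quotient.mk P b)
    refine ⟨p ^ k, pow_ne_zero k hp0, ?_⟩
    have h1 : Polynomial.aeval b p ∈ P := by
      rw [← Ideal.Quotient.eq_zero_iff_mem, ← hp, ← Ideal.Quotient.mkₐ_eq_mk A P,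
        Polynomial.aeval_algHom_apply]
    rw [← Ideal.Quotient.mkₐ_eq_mk A (P ^ k), Polynomial.aeval_algHom_apply,
      Ideal.Quotient.mkₐ_eq_mk, Ideal.Quotient.eq_zero_iff_mem, map_pow]
    exact Ideal.pow_mem_pow h1 k⟩
  have : Algebra.FiniteType A (B ⧸ P ^ k) :=
    Algebra.FiniteType.of_surjective (Ideal.Quotient.mkₐ A (P ^ k)) (Ideal.Quotient.mkₐ_surjective A _)
  have : Algebra.IsAlgebraic K (K ⊗[A] (B ⧸ P ^ k)) := inferInstance
  have : Algebra.FiniteType K (K ⊗[A] (B ⧸ P ^ k)) := inferInstance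
  have : Algebra.IsIntegral K (K ⊗[A] (B ⧸ P ^ k)) := inferInstance
  exact Algebra.IsIntegral.finite

open TensorProduct in
/-- Let `G = 𝓜 / t 𝓜` be a finite `B`-module and let `P` be a minimal prime of its annihilator
whose residue ring is algebraic over `A`. Then no `A`-linear operators `x`, `y` on `𝓜` that lift
multiplications by elements of `B` satisfy `[x, y] = t`. -/
theorem not_heisenberg_of_mem_minimalPrimes {A B 𝓜 G : Type*} [CommRing A] [IsDomain A]
    [CharZero A] [CommRing B] [IsNoetherianRing B] [Algebra A B] [Algebra.FiniteType A B]
    [AddCommGroup 𝓜] [Module A 𝓜] [AddCommGroup G] [Module A G] [Module B G]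
    [IsScalarTower A B G] [Module.Finite B G]
    {P : Ideal B} (hP : P ∈ (Module.annihilator B G).minimalPrimes)
    [Algebra.IsAlgebraic A (B ⧸ P)] (hinj : Function.Injective (algebraMap A (B ⧸ P)))
    {t x y : Module.End A 𝓜} {π : 𝓜 →ₗ[A] G} {a b : B}
    (ht : Function.Injective t) (hπ : Function.Surjective π)
    (hex : LinearMap.ker π = LinearMap.range t)
    (hxt : x * t = t * x) (hyt : y * t = t * y) (hxy : x * y = y * x + t)
    (hx : ∀ w, π (x w) = a • π w) (hy : ∀ w, π (y w) = b • π w) : False := by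
  have hPp : P.IsPrime := hP.1.1
  obtain ⟨f, s, k, hs, hfP, hfk, hff⟩ := exists_quasi_idempotent hP hinj
  let K := FractionRing A
  have : CharZero K := charZero_of_injective_algebraMap (IsFractionRing.injective A K)
  have : Module.Flat A K := IsLocalization.flat K (nonZeroDivisors A)
  let m : B → Module.End A G := fun c => Algebra.lsmul A A G c
  have hm : ∀ c g, m c g = c • g := fun _ _ => rfl
  have hmm : ∀ c c', (m c).baseChange K * (m c').baseChange K = (m (c * c')).baseChange K := by
    intro c c'
    rw [← LinearMap.baseChange_mul]; simp [m]
  have hmz : ∀ c ∈ Module.annihilator B G, m c = 0 := fun c hc => by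
    ext g; exact Module.mem_annihilator.1 hc g
  have hms : ∀ c, m (algebraMap A B s * c) = s • m c := fun c => by
    ext g; simp [hm, mul_smul]
  have hsK : algebraMap A K s ≠ 0 := by
    simpa using hs
  -- As `f² = s f` on `G`, dividing by `s` over the fraction field gives a genuine idempotent.
  let e : Module.End K (K ⊗[A] G) := (algebraMap A K s)⁻¹ • (m f).baseChange K
  have hff' : (m f).baseChange K * (m f).baseChange K
      = algebraMap A K s • (m f).baseChange K := by
    have h1 := hmz _ hff
    simp only [m, map_sub, sub_eq_zero] at h1
    rw [hmm]
    change ((Algebra.lsmul A A G) (f * f)).baseChange K = _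
    rw [h1]
    change (m (algebraMap A B s * f)).baseChange K = _
    rw [hms, LinearMap.baseChange_smul, algebraMap_smul]
  have hcomm : ∀ c, (m f).baseChange K * (m c).baseChange K
      = (m c).baseChange K * (m f).baseChange K := fun c => by rw [hmm, hmm, mul_comm]
  have hee : e * e = e := by
    simp only [e, smul_mul_smul, hff', smul_smul]
    rw [mul_assoc, inv_mul_cancel₀ hsK, mul_one]
  have hec : ∀ c, e * (m c).baseChange K = (m c).baseChange K * e := fun c => by
    simp only [e, smul_mul_assoc, mul_smul_comm, hcomm]
  -- Since `f P ^ k` annihilates `G`, the map `c ↦ f c g` factors through `B ⧸ P ^ k`, which is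
  -- finite-dimensional over `K` after base change. Finitely many generators `g` suffice to cover
  -- the range of `e`.
  have hfin : FiniteDimensional K (LinearMap.range e) := by
    have hQ := finite_tensor_quotient_pow (A := A) (K := K) P k
    obtain ⟨S, hS⟩ := (inferInstance : Module.Finite B G).fg_top
    let ψ : G → (B ⧸ P ^ k) →ₗ[A] G := fun g =>
      ((P ^ k).liftQ ((LinearMap.toSpanSingleton B G (f • g))) (fun p hp => by
        rw [LinearMap.mem_ker, LinearMap.toSpanSingleton_apply, smul_smul, mul_comm]
        exact Module.mem_annihilator.1 (hfk p hp) g)).restrictScalars A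
    have hψ : ∀ g c, ψ g (Ideal.Quotient.mk _ c) = f • c • g := fun g c => by
      rw [smul_comm]; rfl
    have hle : LinearMap.range e ≤ ⨆ g : S, LinearMap.range ((ψ g).baseChange K) := by
      rintro _ ⟨w, rfl⟩
      simp only [e, LinearMap.smul_apply]
      refine Submodule.smul_mem _ _ ?_
      induction w with
      | zero => simp
      | add u v hu hv => rw [map_add]; exact add_mem hu hv
      | tmul r g =>
        have hg : g ∈ Submodule.span B (S : Set G) := hS ▸ Submodule.mem_top
        have key : ∀ c : B, (r ⊗ₜ[A] (f • c • g) : K ⊗[A] G) ∈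
            ⨆ g : S, LinearMap.range ((ψ g).baseChange K) := by
          induction hg using Submodule.span_induction with
          | zero => simp
          | add u v _ _ hu hv =>
            intro c
            rw [smul_add, smul_add, tmul_add]
            exact add_mem (hu c) (hv c)
          | mem g hg =>
            refine fun c => Submodule.mem_iSup_of_mem ⟨g, hg⟩ ⟨r ⊗ₜ Ideal.Quotient.mk _ c, ?_⟩
            rw [LinearMap.baseChange_tmul, hψ]
          | smul d g _ hg => exact fun c => by rw [smul_smul c d g]; exact hg _
        rw [LinearMap.baseChange_tmul, hm]
        simpa using key 1
    exact Submodule.finiteDimensional_of_le hle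
  have hkey := idempotent_eq_zero_of_heisenberg (K := K) (t := t.baseChange K)
    (x := x.baseChange K) (y := y.baseChange K) (π := π.baseChange K)
    (x0 := (m a).baseChange K) (y0 := (m b).baseChange K) (e := e)
    (by
      rw [LinearMap.baseChange_eq_ltensor]
      exact Module.Flat.lTensor_preserves_injective_linearMap _ ht)
    (by
      rw [LinearMap.baseChange_eq_ltensor]
      exact LinearMap.lTensor_surjective _ hπ)
    (by
      have h := lTensor_exact K (LinearMap.exact_iff.2 hex) hπ
      ext w
      exact h w)
    (fun w => by rw [← Module.End.mul_apply, ← LinearMap.baseChange_mul, hxt, LinearMap.baseChange_mul]; rfl)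
    (fun w => by rw [← Module.End.mul_apply, ← LinearMap.baseChange_mul, hyt, LinearMap.baseChange_mul]; rfl)
    (fun w => by
      rw [← Module.End.mul_apply, ← LinearMap.baseChange_mul, hxy, LinearMap.baseChange_add,
        LinearMap.baseChange_mul]; rfl)
    (fun w => by
      rw [← LinearMap.comp_apply, ← LinearMap.comp_apply, ← LinearMap.baseChange_comp,
        ← LinearMap.baseChange_comp, show π ∘ₗ x = m a ∘ₗ π from LinearMap.ext hx])
    (fun w => by
      rw [← LinearMap.comp_apply, ← LinearMap.comp_apply, ← LinearMap.baseChange_comp,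
        ← LinearMap.baseChange_comp, show π ∘ₗ y = m b ∘ₗ π from LinearMap.ext hy])
    (LinearMap.congr_fun hee) (LinearMap.congr_fun (hec a)) (LinearMap.congr_fun (hec b))
  have hf0 : (m f).baseChange K = 0 :=
    (smul_eq_zero.1 hkey).resolve_left (inv_ne_zero hsK)
  -- Undoing the localization: the vanishing of `e` means that each element is killed by a nonzero
  -- scalar times `f`. The product of these scalars over a finite set of generators gives an element
  -- of the annihilator, hence of `P`, although neither of its factors lies in `P`.
  have hann : ∀ g : G, ∃ r : A, r ≠ 0 ∧ (algebraMap A B r * f) • g = 0 := fun g => by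
    have h := LinearMap.congr_fun hf0 (1 ⊗ₜ g)
    rw [LinearMap.baseChange_tmul, hm, LinearMap.zero_apply] at h
    obtain ⟨c, hc⟩ := (IsLocalizedModule.eq_zero_iff (nonZeroDivisors A)
      (TensorProduct.mk A K G 1)).1 h
    refine ⟨c, nonZeroDivisors.ne_zero c.2, ?_⟩
    rw [mul_smul, algebraMap_smul]; exact hc
  choose r hr hrg using hann
  obtain ⟨S, hS⟩ := (inferInstance : Module.Finite B G).fg_top
  have hmem : algebraMap A B (∏ g ∈ S, r g) * f ∈ Module.annihilator B G := by
    rw [Module.mem_annihilator]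
    intro g
    have hg : g ∈ Submodule.span B (S : Set G) := hS ▸ Submodule.mem_top
    induction hg using Submodule.span_induction with
    | zero => simp
    | add u v _ _ hu hv => rw [smul_add, hu, hv, add_zero]
    | mem g hg =>
      obtain ⟨c, hc⟩ := Finset.dvd_prod_of_mem r hg
      rw [hc, map_mul, mul_comm (algebraMap A B (r g)), mul_assoc, mul_smul, hrg, smul_zero]
    | smul c g _ hg => rw [smul_comm, hg, smul_zero]
  rcases hPp.mem_or_mem (hP.1.2 hmem) with h | h
  · refine Finset.prod_ne_zero_iff.2 (fun g _ => hr g) (hinj (a₁ := ∏ g ∈ S, r g) (a₂ := 0) ?_)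
    rw [map_zero]
    change Ideal.Quotient.mk P (algebraMap A B _) = 0
    rwa [Ideal.Quotient.eq_zero_iff_mem]
  · exact hfP h

/-! ### Independence of isotropic coordinates at a minimal prime. -/

open scoped IsMulCommutative in
/-- Pairwise commuting elements of an algebra can be substituted into polynomials. -/
theorem MvPolynomial.exists_algHom_of_commute {R ι E : Type*} [CommRing R] [Ring E] [Algebra R E]
    (d : ι → E) (hd : ∀ i j, Commute (d i) (d j)) :
    ∃ φ : MvPolynomial ι R →ₐ[R] E, ∀ i, φ (X i) = d i := by
  have := Algebra.isMulCommutative_adjoin R (s := Set.range d) (by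
    rintro _ ⟨i, rfl⟩ _ ⟨j, rfl⟩
    exact hd i j)
  let d' : ι → Algebra.adjoin R (Set.range d) := fun i => ⟨d i, Algebra.subset_adjoin ⟨i, rfl⟩⟩
  exact ⟨(Algebra.adjoin R (Set.range d)).val.comp (aeval d'), fun i => by simp [d']⟩

theorem MvPolynomial.commute_algHom {R ι E : Type*} [CommRing R] [Ring E] [Algebra R E]
    (φ : MvPolynomial ι R →ₐ[R] E) {e : E} (h : ∀ i, Commute e (φ (X i))) (a : MvPolynomial ι R) :
    Commute e (φ a) := by
  induction a using MvPolynomial.induction_on with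
  | C r =>
    rw [← MvPolynomial.algebraMap_eq, AlgHom.commutes]
    exact (Algebra.commutes r e).symm
  | add p q hp hq => rw [map_add]; exact hp.add_right hq
  | mul_X p i hp => rw [map_mul]; exact hp.mul_right (h i)

/-- A family over which a domain is algebraic contains a transcendence basis. -/
theorem exists_isTranscendenceBasis_subfamily {R Q ι : Type*} [CommRing R] [CommRing Q] [IsDomain Q]
    [Algebra R Q] (hR : Function.Injective (algebraMap R Q)) (x : ι → Q)
    (halg : Algebra.IsAlgebraic (Algebra.adjoin R (Set.range x)) Q) :
    ∃ S : Set ι, IsTranscendenceBasis R (fun j : S => x j) := by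
  have : FaithfulSMul R Q := (faithfulSMul_iff_algebraMap_injective _ _).2 hR
  obtain ⟨u, hu, hub⟩ := exists_isTranscendenceBasis_subset (R := R) (Set.range x)
  obtain ⟨S, _, hS⟩ := (Set.surjOn_image x (x ⁻¹' u)).exists_bijOn_subset
  rw [Set.image_preimage_eq_of_subset hu] at hS
  exact ⟨S, (isTranscendenceBasis_equiv' (f := fun a : u => (a : Q)) (hS.equiv x) rfl).2 hub⟩

/-- A domain that is algebraic over the elements of a transcendence basis is algebraic over the
corresponding polynomial ring. -/
theorem IsTranscendenceBasis.isAlgebraic_mvPolynomial {R Q ι : Type*} [CommRing R] [Nontrivial R]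
    [CommRing Q] [Algebra R Q] {x : ι → Q} (hx : IsTranscendenceBasis R x)
    [Algebra (MvPolynomial ι R) Q] (h : ∀ a : MvPolynomial ι R, algebraMap _ Q a = aeval x a) :
    Algebra.IsAlgebraic (MvPolynomial ι R) Q := by
  have := hx.isAlgebraic
  exact ⟨fun b => (Algebra.IsAlgebraic.isAlgebraic b).of_ringHom_of_comp_eq
    (hx.1.aevalEquiv : MvPolynomial ι R ≃ₐ[R] _) (RingHom.id Q)
    hx.1.aevalEquiv.surjective Function.injective_id (RingHom.ext fun a => (h a).symm)⟩

/-- Let `q` be operators on `𝓜` satisfying the homogenized Weyl relations with central injective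
`t`, and let `G = 𝓜 / t 𝓜` be finite over the polynomial ring. At a minimal prime of the
annihilator of `G`, isotropic coordinates over which the residue ring is algebraic are
algebraically independent. -/
theorem algebraicIndependent_of_mem_minimalPrimes {N : ℕ} {𝓜 G : Type*}
    [AddCommGroup 𝓜] [Module ℂ 𝓜] [AddCommGroup G] [Module ℂ G]
    [Module (MvPolynomial (PhaseIdx N) ℂ) G] [IsScalarTower ℂ (MvPolynomial (PhaseIdx N) ℂ) G]
    [Module.Finite (MvPolynomial (PhaseIdx N) ℂ) G]
    {q : PhaseIdx N → Module.End ℂ 𝓜} {t : Module.End ℂ 𝓜} {π : 𝓜 →ₗ[ℂ] G}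
    (hll : ∀ i j, Commute (q (Sum.inl i)) (q (Sum.inl j)))
    (hrr : ∀ i j, Commute (q (Sum.inr i)) (q (Sum.inr j)))
    (hrl : ∀ i j, i ≠ j → Commute (q (Sum.inr i)) (q (Sum.inl j)))
    (hq : ∀ j, q (Sum.inr j) * q (Sum.inl j) = q (Sum.inl j) * q (Sum.inr j) + t)
    (hqt : ∀ k, Commute (q k) t) (ht : Function.Injective t) (hπ : Function.Surjective π)
    (hex : LinearMap.ker π = LinearMap.range t)
    (hπq : ∀ k w, π (q k w) = (X k : MvPolynomial (PhaseIdx N) ℂ) • π w)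
    {P : Ideal (MvPolynomial (PhaseIdx N) ℂ)}
    (hP : P ∈ (Module.annihilator (MvPolynomial (PhaseIdx N) ℂ) G).minimalPrimes)
    {c : Fin N → PhaseIdx N} (hc : ∀ j, c j = Sum.inl j ∨ c j = Sum.inr j)
    (halg : Algebra.IsAlgebraic
      (Algebra.adjoin ℂ (Set.range fun j => Ideal.Quotient.mk P (X (c j))))
      (MvPolynomial (PhaseIdx N) ℂ ⧸ P)) :
    AlgebraicIndependent ℂ (fun j => Ideal.Quotient.mk P (X (c j))) := by
  have hPp : P.IsPrime := hP.1.1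
  obtain ⟨S, hbasis⟩ := exists_isTranscendenceBasis_subfamily
    (algebraMap ℂ (MvPolynomial (PhaseIdx N) ℂ ⧸ P)).injective _ halg
  by_cases hS : ∀ j, j ∈ S
  · exact (algebraicIndependent_equiv (Equiv.subtypeUnivEquiv hS)
      (f := fun j => Ideal.Quotient.mk P (X (c j)))).1 hbasis.1
  push Not at hS
  -- An index missed by the transcendence basis. Both operators of the pair `j0` commute with the
  -- operators `q (c j)` for `j ∈ S`, so they are linear over the polynomial ring in these and the
  -- Heisenberg obstruction applies with that ring as the ring of scalars.
  obtain ⟨j0, hj0⟩ := hS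
  exfalso
  have hcne : ∀ j : S, (j : Fin N) ≠ j0 := fun j h => hj0 (h ▸ j.2)
  have hcq : ∀ i j : S, Commute (q (c i)) (q (c j)) := fun i j => by
    rcases eq_or_ne i j with rfl | hij
    · exact Commute.refl _
    have hij' : (i : Fin N) ≠ j := fun h => hij (Subtype.ext h)
    rcases hc i with h | h <;> rcases hc j with h' | h' <;> rw [h, h']
    · exact hll _ _
    · exact (hrl _ _ hij'.symm).symm
    · exact hrl _ _ hij'
    · exact hrr _ _
  have hxq : ∀ j : S, Commute (q (Sum.inr j0)) (q (c j)) := fun j => by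
    rcases hc j with h | h <;> rw [h]
    · exact hrl _ _ (hcne j).symm
    · exact hrr _ _
  have hyq : ∀ j : S, Commute (q (Sum.inl j0)) (q (c j)) := fun j => by
    rcases hc j with h | h <;> rw [h]
    · exact hll _ _
    · exact (hrl _ _ (hcne j)).symm
  obtain ⟨φ, hφ⟩ := MvPolynomial.exists_algHom_of_commute (R := ℂ) (fun j : S => q (c j)) hcq
  let _ : Module (MvPolynomial S ℂ) 𝓜 := Module.compHom 𝓜 φ.toRingHom
  let _ : Algebra (MvPolynomial S ℂ) (MvPolynomial (PhaseIdx N) ℂ) :=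
    (rename fun j : S => c j).toRingHom.toAlgebra
  let _ : Module (MvPolynomial S ℂ) G := Module.compHom G
    (algebraMap (MvPolynomial S ℂ) (MvPolynomial (PhaseIdx N) ℂ))
  have : IsScalarTower (MvPolynomial S ℂ) (MvPolynomial (PhaseIdx N) ℂ) G :=
    ⟨fun a b g => by rw [Algebra.smul_def, mul_smul]; rfl⟩
  have : IsScalarTower ℂ (MvPolynomial S ℂ) (MvPolynomial (PhaseIdx N) ℂ) :=
    IsScalarTower.of_algebraMap_eq fun r => ((rename fun j : S => c j).commutes r).symm
  have : Algebra.FiniteType (MvPolynomial S ℂ) (MvPolynomial (PhaseIdx N) ℂ) :=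
    Algebra.FiniteType.of_restrictScalars_finiteType ℂ _ _
  have hsm : ∀ (a : MvPolynomial S ℂ) (w : 𝓜), a • w = φ a w := fun _ _ => rfl
  have hlift : ∀ e : Module.End ℂ 𝓜, (∀ j : S, Commute e (q (c j))) →
      ∀ (a : MvPolynomial S ℂ) (w : 𝓜), e (a • w) = a • e w := fun e he a w =>
    LinearMap.congr_fun (MvPolynomial.commute_algHom φ (e := e)
      (fun j => (hφ j).symm ▸ he j) a) w
  have hπl : ∀ (a : MvPolynomial S ℂ) (w : 𝓜), π (a • w) = a • π w := fun a => by
    induction a using MvPolynomial.induction_on with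
    | C r =>
      intro w
      rw [← MvPolynomial.algebraMap_eq, hsm, AlgHom.commutes]
      change π (r • w) = algebraMap (MvPolynomial S ℂ) (MvPolynomial (PhaseIdx N) ℂ)
        (algebraMap ℂ _ r) • π w
      rw [map_smul, ← IsScalarTower.algebraMap_apply, algebraMap_smul]
    | add a b ha hb => intro w; rw [add_smul, map_add, ha, hb, add_smul]
    | mul_X a j ha =>
      intro w
      rw [mul_smul, ha, mul_smul, hsm (X j), hφ, hπq]
      congr 1
      change _ = (rename (R := ℂ) (fun j : S => c j) (X j)) • π w
      rw [rename_X]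
  have hAP : ∀ a : MvPolynomial S ℂ, algebraMap (MvPolynomial S ℂ) (MvPolynomial (PhaseIdx N) ℂ ⧸ P) a
      = aeval (fun j : S => Ideal.Quotient.mk P (X (c j))) a := fun a => by
    change Ideal.Quotient.mkₐ ℂ P (rename _ a) = _
    rw [← AlgHom.comp_apply]
    congr 1
    ext j; simp
  have hinj : Function.Injective
      (algebraMap (MvPolynomial S ℂ) (MvPolynomial (PhaseIdx N) ℂ ⧸ P)) := by
    have h : Function.Injective (aeval (R := ℂ) (fun j : S => Ideal.Quotient.mk P (X (c j)))) :=
      hbasis.1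
    intro a b hab
    rw [hAP, hAP] at hab
    exact h hab
  have : Algebra.IsAlgebraic (MvPolynomial S ℂ) (MvPolynomial (PhaseIdx N) ℂ ⧸ P) :=
    hbasis.isAlgebraic_mvPolynomial hAP
  exact not_heisenberg_of_mem_minimalPrimes (A := MvPolynomial S ℂ) hP hinj
    (t := { t with map_smul' := hlift t fun j => (hqt _).symm })
    (x := { q (Sum.inr j0) with map_smul' := hlift _ hxq })
    (y := { q (Sum.inl j0) with map_smul' := hlift _ hyq })
    (π := { π with map_smul' := hπl }) (a := X (Sum.inr j0)) (b := X (Sum.inl j0))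
    ht hπ (by
      ext w
      exact SetLike.ext_iff.1 hex w)
    (LinearMap.ext fun w => LinearMap.congr_fun (hqt (Sum.inr j0)) w)
    (LinearMap.ext fun w => LinearMap.congr_fun (hqt (Sum.inl j0)) w)
    (LinearMap.ext fun w => LinearMap.congr_fun (hq j0) w)
    (hπq _) (hπq _)

/-! ### Normally ordered operators -/

/-- The normally ordered substitution of elements `q` of an algebra: the monomial `z^β ξ^α` goes
to `q_z^β q_ξ^α`. -/
def normalOp {N : ℕ} {E : Type*} [Ring E] [Algebra ℂ E] (q : PhaseIdx N → E) :
    MvPolynomial (PhaseIdx N) ℂ →ₗ[ℂ] E :=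
  (MvPolynomial.basisMonomials (PhaseIdx N) ℂ).constr ℂ fun s =>
    (List.ofFn fun j => q (Sum.inl j) ^ s (Sum.inl j)).prod *
      (List.ofFn fun j => q (Sum.inr j) ^ s (Sum.inr j)).prod

namespace Weyl

/-- The generators `z_j`, `∂_j` of the Weyl algebra. -/
def gen {N : ℕ} : PhaseIdx N → Weyl N := Sum.elim z d

end Weyl

section normalOp

variable {N : ℕ} {E E' : Type*} [Ring E] [Algebra ℂ E] [Ring E'] [Algebra ℂ E']

theorem Weyl.op_eq_normalOp : (Weyl.op : _ →ₗ[ℂ] Weyl N) = normalOp Weyl.gen := rfl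

theorem normalOp_monomial (q : PhaseIdx N → E) (s : PhaseIdx N →₀ ℕ) (r : ℂ) :
    normalOp q (monomial s r) = r • ((List.ofFn fun j => q (Sum.inl j) ^ s (Sum.inl j)).prod *
      (List.ofFn fun j => q (Sum.inr j) ^ s (Sum.inr j)).prod) := by
  have h : (monomial s r : MvPolynomial (PhaseIdx N) ℂ)
      = r • MvPolynomial.basisMonomials (PhaseIdx N) ℂ s := by
    rw [coe_basisMonomials, smul_monomial, smul_eq_mul, mul_one]
  rw [h, map_smul, normalOp, Module.Basis.constr_basis]

attribute [irreducible] normalOp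

theorem normalOp_mem (S : Subalgebra ℂ E) {q : PhaseIdx N → E} (hq : ∀ k, q k ∈ S)
    (f : MvPolynomial (PhaseIdx N) ℂ) : normalOp q f ∈ S := by
  induction f using MvPolynomial.induction_on' with
  | monomial s r =>
    rw [normalOp_monomial]
    refine S.smul_mem (mul_mem (list_prod_mem ?_) (list_prod_mem ?_)) r <;>
    · intro x hx
      rw [List.mem_ofFn] at hx
      obtain ⟨j, rfl⟩ := hx
      exact pow_mem (hq _) _
  | add p q hp hq => rw [map_add]; exact add_mem hp hq

theorem map_normalOp (φ : E →ₐ[ℂ] E') (q : PhaseIdx N → E) (f : MvPolynomial (PhaseIdx N) ℂ) :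
    φ (normalOp q f) = normalOp (fun k => φ (q k)) f := by
  induction f using MvPolynomial.induction_on' with
  | monomial s r =>
    simp only [normalOp_monomial, map_smul, map_mul, map_list_prod, List.map_ofFn]
    congr 4 <;> (ext j; simp)
  | add p q hp hq => simp only [map_add, hp, hq]

/-- Normally ordered substitutions satisfy every linear relation that is closed under products. -/
theorem normalOp_rel (R : E → E' → Prop) (halg : ∀ r : ℂ, R (algebraMap ℂ E r) (algebraMap ℂ E' r))
    (hadd : ∀ a a' b b', R a a' → R b b' → R (a + b) (a' + b'))
    (hmul : ∀ a a' b b', R a a' → R b b' → R (a * b) (a' * b'))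
    {q : PhaseIdx N → E} {q' : PhaseIdx N → E'}
    (hq : ∀ k, R (q k) (q' k)) (f : MvPolynomial (PhaseIdx N) ℂ) :
    R (normalOp q f) (normalOp q' f) := by
  -- The relation is a subalgebra of `E × E'`, and normally ordered substitution of pairs works
  -- componentwise.
  let S : Subalgebra ℂ (E × E') :=
    { carrier := {p | R p.1 p.2}
      mul_mem' := fun {a b} ha hb => hmul _ _ _ _ ha hb
      add_mem' := fun {a b} ha hb => hadd _ _ _ _ ha hb
      algebraMap_mem' := halg }
  have h : normalOp (fun k => (q k, q' k)) f ∈ S := normalOp_mem S hq f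
  have h' : R (normalOp (fun k => (q k, q' k)) f).1 (normalOp (fun k => (q k, q' k)) f).2 := h
  rwa [show (normalOp (fun k => (q k, q' k)) f).1 = normalOp q f from
      map_normalOp (AlgHom.fst ℂ E E') _ f,
    show (normalOp (fun k => (q k, q' k)) f).2 = normalOp q' f from
      map_normalOp (AlgHom.snd ℂ E E') _ f] at h'

theorem normalOp_X_self (f : MvPolynomial (PhaseIdx N) ℂ) : normalOp X f = f := by
  induction f using MvPolynomial.induction_on' with
  | monomial s r =>
    rw [normalOp_monomial, List.prod_ofFn, List.prod_ofFn, monomial_eq, Finsupp.prod_fintype _ _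
      (fun _ => pow_zero _), Fintype.prod_sum_type, smul_eq_C_mul]
  | add p q hp hq => rw [map_add, hp, hq]

theorem normalOp_C (q : PhaseIdx N → E) (r : ℂ) : normalOp q (C r) = algebraMap ℂ E r := by
  rw [C_apply, normalOp_monomial, Algebra.algebraMap_eq_smul_one]
  simp [List.ofFn_const]

theorem normalOp_X (q : PhaseIdx N → E) (k : PhaseIdx N) : normalOp q (X k) = q k := by
  have h := normalOp_monomial q (Finsupp.single k 1) 1
  have aux : ∀ (b : Fin N → E) (s : Fin N → ℕ) (i : Fin N), (∀ j, j ≠ i → s j = 0) →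
      (List.ofFn fun j => b j ^ s j).prod = b i ^ s i := by
    intro b s i hs
    -- All exponents except the one at `i` are zero, so every factor may be viewed as a power of `b
    -- i`; the ordered product then comes from a commutative monoid.
    have h1 : (fun j => b j ^ s j) = fun j => powersHom E (b i) (Multiplicative.ofAdd (s j)) := by
      funext j
      rcases eq_or_ne j i with rfl | hj
      · simp
      · simp [hs j hj]
    rw [h1, ← Function.comp_def (powersHom E (b i)), ← List.map_ofFn, ← map_list_prod,
      List.prod_ofFn, Finset.prod_eq_single i (fun j _ hj => by simp [hs j hj]) (by simp)]
    simp
  rw [X, h, one_smul]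
  rcases k with i | i
  · rw [aux _ (fun j => Finsupp.single (Sum.inl i) 1 (Sum.inl j)) i
      (fun j hj => by simp [hj.symm])]
    simp
  · rw [aux _ (fun j => Finsupp.single (Sum.inr i) 1 (Sum.inr j)) i
      (fun j hj => by simp [hj.symm])]
    simp

end normalOp

namespace Weyl

variable {N : ℕ}

theorem op_C (r : ℂ) : op (C r) = algebraMap ℂ (Weyl N) r := by
  rw [op_eq_normalOp, normalOp_C]

theorem op_X (k : PhaseIdx N) : op (X k) = gen k := by
  rw [op_eq_normalOp, normalOp_X]

/-- The action of the Weyl algebra on polynomials. -/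
def toEnd (N : ℕ) : Weyl N →ₐ[ℂ] Module.End ℂ (MvPolynomial (Fin N) ℂ) := (weylSubalgebra N).val

theorem toEnd_injective : Function.Injective (toEnd N) := Subtype.val_injective

theorem toEnd_apply (P : Weyl N) : toEnd N P = Subtype.val P := rfl

theorem toEnd_z (j : Fin N) : toEnd N (z j) = LinearMap.mulLeft ℂ (X j) := by
  rw [toEnd_apply, z]

theorem toEnd_d (j : Fin N) : toEnd N (d j) = (pderiv j : Derivation ℂ (MvPolynomial (Fin N) ℂ)
    (MvPolynomial (Fin N) ℂ)).toLinearMap := by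
  rw [toEnd_apply, d]

theorem commute_z (i j : Fin N) : Commute (z i) (z j) := by
  refine toEnd_injective (LinearMap.ext fun p => ?_)
  simp only [map_mul, Module.End.mul_apply, toEnd_z, LinearMap.mulLeft_apply]
  ring

theorem commute_d (i j : Fin N) : Commute (d i) (d j) := by
  refine toEnd_injective (LinearMap.ext fun p => ?_)
  simp only [map_mul, Module.End.mul_apply, toEnd_d, Derivation.coeFn_coe]
  have h : ⁅pderiv (R := ℂ) i, pderiv j⁆ = (0 : Derivation ℂ (MvPolynomial (Fin N) ℂ)
      (MvPolynomial (Fin N) ℂ)) := by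
    refine MvPolynomial.derivation_ext fun k => ?_
    rw [Derivation.commutator_apply, pderiv_X, pderiv_X, Derivation.zero_apply]
    simp only [Pi.single_apply]
    split_ifs <;> simp
  have h' := DFunLike.congr_fun h p
  rwa [Derivation.commutator_apply, Derivation.zero_apply, sub_eq_zero] at h'

theorem d_mul_z (i j : Fin N) : d i * z j = z j * d i + if i = j then 1 else 0 := by
  refine toEnd_injective (LinearMap.ext fun p => ?_)
  simp only [map_mul, map_add, Module.End.mul_apply, LinearMap.add_apply, toEnd_d, toEnd_z,
    LinearMap.mulLeft_apply, Derivation.coeFn_coe]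
  rw [Derivation.leibniz, pderiv_X, smul_eq_mul, smul_eq_mul]
  rcases eq_or_ne i j with rfl | h
  · simp
  · simp [h, Ne.symm h]

end Weyl

/-! ### The Rees module of a filtration -/

namespace Weyl

section degShift

variable {M : Type*} [AddCommGroup M] [Module ℂ M]

/-- The shift of degrees by `l`. -/
def degShift (M : Type*) [AddCommGroup M] [Module ℂ M] (l : ℤ) : Module.End ℂ (ℤ →₀ M) :=
  Finsupp.lmapDomain M ℂ (· + l)

@[simp] theorem degShift_single (l m : ℤ) (x : M) :
    degShift M l (Finsupp.single m x) = Finsupp.single (m + l) x :=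
  Finsupp.mapDomain_single

theorem degShift_apply (l m : ℤ) (u : ℤ →₀ M) : degShift M l u m = u (m - l) := by
  conv_lhs => rw [show m = (m - l) + l by ring]
  exact Finsupp.mapDomain_apply (add_left_injective l) u (m - l)

end degShift

section shift

variable {N : ℕ} {M : Type*} [AddCommGroup M] [Module ℂ M] [Module (Weyl N) M]
  [IsScalarTower ℂ (Weyl N) M]

/-- The generators of the homogenized Weyl algebra, acting on `M[t, t⁻¹]`. -/
def shiftGen (M : Type*) [AddCommGroup M] [Module ℂ M] [Module (Weyl N) M]
    [IsScalarTower ℂ (Weyl N) M] (k : PhaseIdx N) : Module.End ℂ (ℤ →₀ M) :=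
  degShift M (xiWeight k) ∘ₗ Finsupp.mapRange.linearMap (Algebra.lsmul ℂ ℂ M (gen k))

@[simp] theorem shiftGen_single (k : PhaseIdx N) (m : ℤ) (x : M) :
    shiftGen M k (Finsupp.single m x) = Finsupp.single (m + xiWeight k) (gen k • x) := by
  simp [shiftGen]

theorem shiftGen_apply (k : PhaseIdx N) (m : ℤ) (u : ℤ →₀ M) :
    shiftGen M k u m = gen k • u (m - xiWeight k) := by
  rw [shiftGen, LinearMap.comp_apply, degShift_apply]
  simp

theorem shiftGen_list_prod_single (i : Fin N → PhaseIdx N) (s : Fin N → ℕ) (L : List (Fin N))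
    (m : ℤ) (x : M) :
    (L.map fun j => shiftGen M (i j) ^ s j).prod (Finsupp.single m x) =
      Finsupp.single (m + (L.map fun j => (xiWeight (i j) * s j : ℤ)).sum)
        ((L.map fun j => gen (i j) ^ s j).prod • x) := by
  induction L with
  | nil => simp
  | cons j L ih =>
    have hpow : ∀ (e : ℕ) (m : ℤ) (x : M), (shiftGen M (i j) ^ e) (Finsupp.single m x) =
        Finsupp.single (m + xiWeight (i j) * e) (gen (i j) ^ e • x) := by
      intro e
      induction e with
      | zero => simp
      | succ e ihe =>
        intro m x
        rw [pow_succ, Module.End.mul_apply, shiftGen_single, ihe, smul_smul, ← pow_succ]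
        congr 1
        push_cast; ring
    rw [List.map_cons, List.prod_cons, Module.End.mul_apply, ih, hpow, List.map_cons,
      List.sum_cons, List.map_cons, List.prod_cons, mul_smul]
    congr 1
    ring

theorem normalOp_shiftGen_monomial_single (s : PhaseIdx N →₀ ℕ) (r : ℂ) (m : ℤ) (x : M) :
    normalOp (shiftGen M) (monomial s r) (Finsupp.single m x) =
      Finsupp.single (m + Finsupp.weight xiWeight s) (op (monomial s r) • x) := by
  have h : (Finsupp.weight xiWeight s : ℤ)
      = (List.map (fun j => (xiWeight (Sum.inr j : PhaseIdx N) * s (Sum.inr j) : ℤ))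
          (List.finRange N)).sum +
        (List.map (fun j => (xiWeight (Sum.inl j : PhaseIdx N) * s (Sum.inl j) : ℤ))
          (List.finRange N)).sum := by
    rw [← List.ofFn_eq_map, ← List.ofFn_eq_map, List.sum_ofFn, List.sum_ofFn, add_comm,
      ← Fintype.sum_sum_type (fun k : PhaseIdx N => (xiWeight k * s k : ℤ)), Finsupp.weight_apply,
      Finsupp.sum_fintype _ _ (by simp)]
    push_cast
    exact Finset.sum_congr rfl fun k _ => by simp [mul_comm]
  rw [op_eq_normalOp, normalOp_monomial, normalOp_monomial, LinearMap.smul_apply,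
    Module.End.mul_apply, List.ofFn_eq_map, List.ofFn_eq_map, List.ofFn_eq_map, List.ofFn_eq_map,
    shiftGen_list_prod_single, shiftGen_list_prod_single, h, smul_assoc, mul_smul,
    Finsupp.smul_single, add_assoc]

/-- Each `ξ` raises the degree in `t` by one and each `z` preserves it, so the homogeneous parts of
`f` are separated by the degree of the result. This matches `AnnihilatesGr`, which tests the parts
one by one, with the annihilator of the symbol module. -/
theorem normalOp_shiftGen_single (f : MvPolynomial (PhaseIdx N) ℂ) (m : ℤ) (l : ℕ) (x : M) :
    normalOp (shiftGen M) f (Finsupp.single m x) (m + l) =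
      op (weightedHomogeneousComponent xiWeight l f) • x := by
  classical
  induction f using MvPolynomial.induction_on' with
  | monomial s r =>
    rw [normalOp_shiftGen_monomial_single, Finsupp.single_apply]
    have h := isWeightedHomogeneous_monomial (R := ℂ) xiWeight s r rfl
    split_ifs with hl
    · rw [add_right_inj, Nat.cast_inj] at hl
      rw [← hl, h.weightedHomogeneousComponent_same]
    · rw [h.weightedHomogeneousComponent_ne _ (fun hc => hl (by rw [hc])), map_zero, zero_smul]
  | add p q hp hq => simp only [map_add, LinearMap.add_apply, Finsupp.add_apply, hp, hq, add_smul]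

theorem normalOp_shiftGen_single_of_lt (f : MvPolynomial (PhaseIdx N) ℂ) {m k : ℤ} (h : k < m)
    (x : M) : normalOp (shiftGen M) f (Finsupp.single m x) k = 0 := by
  classical
  induction f using MvPolynomial.induction_on' with
  | monomial s r =>
    rw [normalOp_shiftGen_monomial_single, Finsupp.single_apply, if_neg (by lia)]
  | add p q hp hq => simp only [map_add, LinearMap.add_apply, Finsupp.add_apply, hp, hq, add_zero]

theorem normalOp_shiftGen_homogeneous {f : MvPolynomial (PhaseIdx N) ℂ} {l : ℕ}
    (hf : IsWeightedHomogeneous xiWeight f l) (m : ℤ) (x : M) :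
    normalOp (shiftGen M) f (Finsupp.single m x) = Finsupp.single (m + l) (op f • x) := by
  classical
  ext k
  rcases lt_or_ge k m with h | h
  · rw [normalOp_shiftGen_single_of_lt f h, Finsupp.single_apply, if_neg (by lia)]
  · obtain ⟨e, rfl⟩ := Int.le.dest h
    rw [normalOp_shiftGen_single, Finsupp.single_apply]
    split_ifs with hl
    · rw [add_right_inj, Nat.cast_inj] at hl
      rw [← hl, hf.weightedHomogeneousComponent_same]
    · rw [hf.weightedHomogeneousComponent_ne _ (fun hc => hl (by rw [hc])), map_zero, zero_smul]

theorem normalOp_shiftGen_homogeneous_pow {f : MvPolynomial (PhaseIdx N) ℂ} {l : ℕ}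
    (hf : IsWeightedHomogeneous xiWeight f l) (k : ℕ) (m : ℤ) (x : M) :
    (normalOp (shiftGen M) f ^ k) (Finsupp.single m x)
      = Finsupp.single (m + k * l) (op f ^ k • x) := by
  induction k generalizing m x with
  | zero => simp
  | succ k ih =>
    rw [pow_succ, Module.End.mul_apply, normalOp_shiftGen_homogeneous hf, ih, smul_smul, ← pow_succ]
    congr 1
    push_cast; ring

end shift

end Weyl

namespace Weyl

/-- Increasing filtrations of a module over the Weyl algebra that are compatible with the order
filtration. -/
structure Filtration (N : ℕ) (M : Type*) [AddCommGroup M] [Module ℂ M] [Module (Weyl N) M] where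
  /-- The pieces of the filtration. -/
  piece : ℤ → Submodule ℂ M
  mono : Monotone piece
  gen_mem : ∀ (k : PhaseIdx N) (m : ℤ), ∀ x ∈ piece m, gen k • x ∈ piece (m + xiWeight k)

namespace Filtration

variable {N : ℕ} {M : Type*} [AddCommGroup M] [Module ℂ M] [Module (Weyl N) M]

/-- The Rees module of a filtration, as a submodule of `M[t, t⁻¹]`. -/
def rees (F : Filtration N M) : Submodule ℂ (ℤ →₀ M) where
  carrier := {u | ∀ m, u m ∈ F.piece m}
  add_mem' hu hv m := add_mem (hu m) (hv m)
  zero_mem' _ := zero_mem _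
  smul_mem' c _ hu m := Submodule.smul_mem _ c (hu m)

variable (F : Filtration N M)

theorem single_mem_rees {m : ℤ} {x : M} (hx : x ∈ F.piece m) : Finsupp.single m x ∈ F.rees := by
  classical
  intro k
  rw [Finsupp.single_apply]
  split_ifs with h
  · exact h ▸ hx
  · exact zero_mem _

/-- The class of `x ∈ F_m M` in degree `m`. -/
def homog (m : ℤ) : F.piece m →ₗ[ℂ] F.rees :=
  LinearMap.codRestrict _ (Finsupp.lsingle m ∘ₗ (F.piece m).subtype) fun x => F.single_mem_rees x.2

theorem coe_homog (m : ℤ) (x : F.piece m) : (F.homog m x : ℤ →₀ M) = Finsupp.single m (x : M) := rfl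

theorem eq_sum_homog (w : F.rees) :
    w = ∑ m ∈ (w : ℤ →₀ M).support, F.homog m ⟨(w : ℤ →₀ M) m, w.2 m⟩ := by
  refine Subtype.ext ?_
  rw [AddSubmonoidClass.coe_finsetSum]
  exact (Finsupp.sum_single (w : ℤ →₀ M)).symm

/-- The degree shift `t` on the Rees module. -/
def reesShift : Module.End ℂ F.rees :=
  (degShift M 1).restrict fun u hu m => by
    rw [degShift_apply]
    exact F.mono (by lia) (hu _)

theorem coe_reesShift (w : F.rees) : (F.reesShift w : ℤ →₀ M) = degShift M 1 w := rfl

theorem reesShift_injective : Function.Injective F.reesShift := by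
  intro u v h
  refine Subtype.ext (Finsupp.ext fun m => ?_)
  have h' := DFunLike.congr_fun (congrArg Subtype.val h) (m + 1)
  simpa only [coe_reesShift, degShift_apply, add_sub_cancel_right] using h'

theorem reesShift_pow_apply (k : ℕ) (w : F.rees) (m : ℤ) :
    ((F.reesShift ^ k) w : ℤ →₀ M) m = (w : ℤ →₀ M) (m - k) := by
  induction k generalizing m with
  | zero => simp
  | succ k ih =>
    rw [pow_succ', Module.End.mul_apply, coe_reesShift, degShift_apply, ih]
    congr 1
    push_cast; ring

theorem mem_range_reesShift (w : F.rees) :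
    w ∈ LinearMap.range F.reesShift ↔ ∀ m, (w : ℤ →₀ M) m ∈ F.piece (m - 1) := by
  constructor
  · rintro ⟨u, rfl⟩ m
    rw [coe_reesShift, degShift_apply]
    exact u.2 _
  · intro h
    refine ⟨⟨degShift M (-1) w, fun m => ?_⟩, Subtype.ext (Finsupp.ext fun m => ?_)⟩
    · rw [degShift_apply]
      simpa using h (m - -1)
    · rw [coe_reesShift, degShift_apply]
      simp [degShift_apply]

/-- The symbol module `gr^F M = ⨁ F_m M / F_{m-1} M`, the quotient of the Rees module by `t`. -/
def Gr : Type _ := F.rees ⧸ LinearMap.range F.reesShift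

instance : AddCommGroup F.Gr := inferInstanceAs (AddCommGroup (F.rees ⧸ LinearMap.range F.reesShift))

instance : Module ℂ F.Gr := inferInstanceAs (Module ℂ (F.rees ⧸ LinearMap.range F.reesShift))

/-- The projection of the Rees module onto the symbol module. -/
def toGr : F.rees →ₗ[ℂ] F.Gr := (LinearMap.range F.reesShift).mkQ

theorem toGr_surjective : Function.Surjective F.toGr := Submodule.mkQ_surjective _

theorem ker_toGr : LinearMap.ker F.toGr = LinearMap.range F.reesShift := Submodule.ker_mkQ _

theorem toGr_eq_zero_iff (w : F.rees) :
    F.toGr w = 0 ↔ ∀ m, (w : ℤ →₀ M) m ∈ F.piece (m - 1) := by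
  rw [← mem_range_reesShift, ← ker_toGr, LinearMap.mem_ker]

theorem toGr_homog_eq_zero {m : ℤ} (x : F.piece m) (h : (x : M) ∈ F.piece (m - 1)) :
    F.toGr (F.homog m x) = 0 := by
  classical
  rw [toGr_eq_zero_iff]
  intro k
  rw [coe_homog, Finsupp.single_apply]
  split_ifs with hk
  · exact hk ▸ h
  · exact zero_mem _

theorem exists_sum_toGr_homog (g : F.Gr) : ∃ (s : Finset ℤ) (x : ∀ m, F.piece m),
    g = ∑ m ∈ s, F.toGr (F.homog m (x m)) := by
  obtain ⟨w, rfl⟩ := F.toGr_surjective g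
  exact ⟨_, fun m => ⟨(w : ℤ →₀ M) m, w.2 m⟩, by
    conv_lhs => rw [F.eq_sum_homog w, map_sum]⟩

variable [IsScalarTower ℂ (Weyl N) M]

/-- The homogenized generators on the Rees module. -/
def reesGen (k : PhaseIdx N) : Module.End ℂ F.rees :=
  (shiftGen M k).restrict fun u hu m => by
    rw [shiftGen_apply]
    simpa using F.gen_mem k _ _ (hu (m - xiWeight k))

theorem coe_reesGen (k : PhaseIdx N) (w : F.rees) :
    (F.reesGen k w : ℤ →₀ M) = shiftGen M k w := rfl

theorem reesGen_commute_of {k k' : PhaseIdx N} (h : Commute (gen k : Weyl N) (gen k')) :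
    Commute (F.reesGen k) (F.reesGen k') := by
  refine LinearMap.ext fun w => Subtype.ext (Finsupp.ext fun m => ?_)
  simp only [Module.End.mul_apply, coe_reesGen, shiftGen_apply, smul_smul]
  rw [h.eq, sub_right_comm]

theorem commute_reesGen_reesShift (k : PhaseIdx N) : Commute (F.reesGen k) F.reesShift := by
  refine LinearMap.ext fun w => Subtype.ext (Finsupp.ext fun m => ?_)
  simp only [Module.End.mul_apply, coe_reesGen, coe_reesShift, shiftGen_apply, degShift_apply]
  rw [sub_right_comm]

theorem reesGen_inl_commute (i j : Fin N) :
    Commute (F.reesGen (Sum.inl i)) (F.reesGen (Sum.inl j)) :=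
  F.reesGen_commute_of (commute_z i j)

theorem reesGen_inr_commute (i j : Fin N) :
    Commute (F.reesGen (Sum.inr i)) (F.reesGen (Sum.inr j)) :=
  F.reesGen_commute_of (commute_d i j)

theorem reesGen_inr_inl_commute {i j : Fin N} (h : i ≠ j) :
    Commute (F.reesGen (Sum.inr i)) (F.reesGen (Sum.inl j)) :=
  F.reesGen_commute_of (by
    have := d_mul_z i j
    rwa [if_neg h, add_zero] at this)

theorem reesGen_inr_mul_inl (j : Fin N) :
    F.reesGen (Sum.inr j) * F.reesGen (Sum.inl j)
      = F.reesGen (Sum.inl j) * F.reesGen (Sum.inr j) + F.reesShift := by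
  refine LinearMap.ext fun w => Subtype.ext (Finsupp.ext fun m => ?_)
  have h : gen (Sum.inr j) * gen (Sum.inl j) = gen (Sum.inl j) * gen (Sum.inr j) + (1 : Weyl N) := by
    have := d_mul_z j j
    rwa [if_pos rfl] at this
  simp only [Module.End.mul_apply, LinearMap.add_apply, Submodule.coe_add, Finsupp.add_apply,
    coe_reesGen, coe_reesShift, shiftGen_apply, degShift_apply, smul_smul]
  rw [h, add_smul, one_smul, sub_right_comm]
  simp [xiWeight]

/-- The commutators of the homogenized generators are multiples of `t`. -/
theorem exists_reesGen_commutator (k k' : PhaseIdx N) : ∃ r : ℂ,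
    ∀ w, F.reesGen k (F.reesGen k' w) = F.reesGen k' (F.reesGen k w) + r • F.reesShift w := by
  have aux : ∀ {k k' : PhaseIdx N}, Commute (F.reesGen k) (F.reesGen k') → ∃ r : ℂ,
      ∀ w, F.reesGen k (F.reesGen k' w) = F.reesGen k' (F.reesGen k w) + r • F.reesShift w :=
    fun h => ⟨0, fun w => by rw [zero_smul, add_zero]; exact LinearMap.congr_fun h.eq w⟩
  rcases k with i | i <;> rcases k' with j | j
  · exact aux (F.reesGen_inl_commute i j)
  · rcases eq_or_ne j i with rfl | h
    · refine ⟨-1, fun w => ?_⟩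
      have := LinearMap.congr_fun (F.reesGen_inr_mul_inl j) w
      simp only [Module.End.mul_apply, LinearMap.add_apply] at this
      rw [this]
      module
    · exact aux (F.reesGen_inr_inl_commute h).symm
  · rcases eq_or_ne i j with rfl | h
    · exact ⟨1, fun w => by rw [one_smul]; exact LinearMap.congr_fun (F.reesGen_inr_mul_inl i) w⟩
    · exact aux (F.reesGen_inr_inl_commute h)
  · exact aux (F.reesGen_inr_commute i j)

/-- The multiplication by a variable on the symbol module. -/
def grGen (k : PhaseIdx N) : Module.End ℂ F.Gr :=
  (LinearMap.range F.reesShift).mapQ _ (F.reesGen k) (by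
    rintro _ ⟨w, rfl⟩
    exact ⟨F.reesGen k w, (LinearMap.congr_fun (F.commute_reesGen_reesShift k) w).symm⟩)

theorem grGen_toGr (k : PhaseIdx N) (w : F.rees) : F.grGen k (F.toGr w) = F.toGr (F.reesGen k w) :=
  rfl

theorem grGen_commute (k k' : PhaseIdx N) : Commute (F.grGen k) (F.grGen k') := by
  refine LinearMap.ext fun g => ?_
  obtain ⟨w, rfl⟩ := F.toGr_surjective g
  obtain ⟨r, hr⟩ := F.exists_reesGen_commutator k k'
  simp only [Module.End.mul_apply, grGen_toGr]
  rw [← sub_eq_zero, ← map_sub, ← LinearMap.mem_ker, ker_toGr]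
  exact ⟨r • w, by rw [hr, map_smul, add_sub_cancel_left]⟩

/-- The substitution of the operators `grGen` into polynomials. -/
def grHom : MvPolynomial (PhaseIdx N) ℂ →ₐ[ℂ] Module.End ℂ F.Gr :=
  (MvPolynomial.exists_algHom_of_commute F.grGen F.grGen_commute).choose

theorem grHom_X (k : PhaseIdx N) : F.grHom (X k) = F.grGen k :=
  (MvPolynomial.exists_algHom_of_commute F.grGen F.grGen_commute).choose_spec k

instance : Module (MvPolynomial (PhaseIdx N) ℂ) F.Gr := Module.compHom F.Gr F.grHom.toRingHom

theorem smul_def (f : MvPolynomial (PhaseIdx N) ℂ) (g : F.Gr) : f • g = F.grHom f g := rfl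

instance : IsScalarTower ℂ (MvPolynomial (PhaseIdx N) ℂ) F.Gr :=
  ⟨fun r f g => by rw [smul_def, smul_def, map_smul]; rfl⟩

theorem toGr_reesGen (k : PhaseIdx N) (w : F.rees) :
    F.toGr (F.reesGen k w) = (X k : MvPolynomial (PhaseIdx N) ℂ) • F.toGr w := by
  rw [smul_def, grHom_X, grGen_toGr]

theorem toGr_normalOp (f : MvPolynomial (PhaseIdx N) ℂ) (w : F.rees) :
    F.toGr (normalOp F.reesGen f w) = f • F.toGr w := by
  have h := normalOp_rel (E := Module.End ℂ F.rees) (E' := MvPolynomial (PhaseIdx N) ℂ)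
    (fun e p => ∀ w, F.toGr (e w) = p • F.toGr w)
    (fun r w => by rw [algebraMap_smul, Module.algebraMap_end_apply, map_smul])
    (fun a a' b b' ha hb w => by rw [LinearMap.add_apply, map_add, ha, hb, add_smul])
    (fun a a' b b' ha hb w => by rw [Module.End.mul_apply, ha, hb, smul_smul])
    (q := F.reesGen) (q' := X) F.toGr_reesGen f w
  rwa [normalOp_X_self] at h

theorem coe_normalOp (f : MvPolynomial (PhaseIdx N) ℂ) (w : F.rees) :
    (normalOp F.reesGen f w : ℤ →₀ M) = normalOp (shiftGen M) f w :=
  normalOp_rel (E := Module.End ℂ F.rees) (E' := Module.End ℂ (ℤ →₀ M))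
    (fun e e' => ∀ w : F.rees, (e w : ℤ →₀ M) = e' w)
    (fun r w => by
      rw [Module.algebraMap_end_apply, Module.algebraMap_end_apply, Submodule.coe_smul])
    (fun a a' b b' ha hb w => by
      rw [LinearMap.add_apply, Submodule.coe_add, ha, hb, LinearMap.add_apply])
    (fun a a' b b' ha hb w => by rw [Module.End.mul_apply, ha, hb, Module.End.mul_apply])
    F.coe_reesGen f w

/-- The annihilator of the symbol module in terms of operators on the pieces. -/
theorem mem_annihilator_gr (f : MvPolynomial (PhaseIdx N) ℂ) :
    f ∈ Module.annihilator (MvPolynomial (PhaseIdx N) ℂ) F.Gr ↔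
      ∀ (l : ℕ) (m : ℤ), ∀ x ∈ F.piece m,
        op (weightedHomogeneousComponent xiWeight l f) • x ∈ F.piece (m + l - 1) := by
  rw [Module.mem_annihilator]
  constructor
  · intro h l m x hx
    have h1 := h (F.toGr (F.homog m ⟨x, hx⟩))
    rw [← toGr_normalOp, toGr_eq_zero_iff] at h1
    have h2 := h1 (m + l)
    rwa [coe_normalOp, coe_homog, normalOp_shiftGen_single] at h2
  · intro h g
    obtain ⟨w, rfl⟩ := F.toGr_surjective g
    rw [F.eq_sum_homog w, map_sum, Finset.smul_sum]
    refine Finset.sum_eq_zero fun m _ => ?_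
    rw [← toGr_normalOp, toGr_eq_zero_iff]
    intro k
    rw [coe_normalOp, coe_homog]
    rcases lt_or_ge k m with hk | hk
    · rw [normalOp_shiftGen_single_of_lt f hk]
      exact zero_mem _
    · obtain ⟨e, rfl⟩ := Int.le.dest hk
      rw [normalOp_shiftGen_single]
      exact h e m _ (w.2 m)

end Filtration

end Weyl

/-! ### Good filtrations have finitely generated symbol modules. -/

namespace Weyl

theorem weightedTotalDegree_le_of_homogeneous {N : ℕ} {p : MvPolynomial (PhaseIdx N) ℂ} {l : ℕ}
    (hp : IsWeightedHomogeneous xiWeight p l) : weightedTotalDegree xiWeight p ≤ l :=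
  Finset.sup_le fun _ hs => (hp (mem_support_iff.1 hs)).le

theorem IsGoodFiltration.op_smul_mem {N : ℕ} {M : Type*} [AddCommGroup M] [Module (Weyl N) M]
    {F : ℤ → AddSubgroup M} (hF : IsGoodFiltration (N := N) F)
    {p : MvPolynomial (PhaseIdx N) ℂ} {l : ℕ} (hp : weightedTotalDegree xiWeight p ≤ l) {m : ℤ}
    {x : M} (hx : x ∈ F m) : op p • x ∈ F (m + l) :=
  hF.mul_le l m (AddSubgroup.subset_closure ⟨_, ⟨p, hp, rfl⟩, x, hx, rfl⟩)

variable {N : ℕ} {M : Type*} [AddCommGroup M] [Module ℂ M] [Module (Weyl N) M]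
  [IsScalarTower ℂ (Weyl N) M]

/-- A good filtration consists of complex subspaces and is compatible with the generators. -/
def IsGoodFiltration.toFiltration {F : ℤ → AddSubgroup M} (hF : IsGoodFiltration (N := N) F) :
    Filtration N M where
  piece m :=
    { F m with
      smul_mem' := fun c x hx => by
        have h := hF.op_smul_mem (p := C c) (l := 0)
          (weightedTotalDegree_le_of_homogeneous (isWeightedHomogeneous_C xiWeight c)) hx
        rw [op_C, algebraMap_smul] at h
        simpa using h }
  mono := hF.mono
  gen_mem k m x hx := by
    have h := hF.op_smul_mem (p := X k) (l := xiWeight k)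
      (weightedTotalDegree_le_of_homogeneous (isWeightedHomogeneous_X ℂ xiWeight k)) hx
    rwa [op_X] at h

theorem IsGoodFiltration.mem_annihilator_iff {F : ℤ → AddSubgroup M}
    (hF : IsGoodFiltration (N := N) F) (f : MvPolynomial (PhaseIdx N) ℂ) :
    f ∈ Module.annihilator (MvPolynomial (PhaseIdx N) ℂ) hF.toFiltration.Gr ↔
      AnnihilatesGr F f :=
  hF.toFiltration.mem_annihilator_gr f

namespace Filtration

variable (F : Filtration N M)

theorem toGr_homog_op {p : MvPolynomial (PhaseIdx N) ℂ} {l : ℕ}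
    (hp : IsWeightedHomogeneous xiWeight p l) {m : ℤ} (x : F.piece m)
    (h : op p • (x : M) ∈ F.piece (m + l)) :
    F.toGr (F.homog (m + l) ⟨_, h⟩) = p • F.toGr (F.homog m x) := by
  rw [← toGr_normalOp]
  congr 1
  refine Subtype.ext ?_
  rw [coe_normalOp, coe_homog, coe_homog, normalOp_shiftGen_homogeneous hp]

/-- The elements of `F_m M` whose class in degree `m` lies in a given submodule. -/
def classIn (H : Submodule (MvPolynomial (PhaseIdx N) ℂ) F.Gr) (m : ℤ) : Submodule ℂ M :=
  ((H.restrictScalars ℂ).comap (F.toGr ∘ₗ F.homog m)).map (F.piece m).subtype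

theorem mem_classIn {H : Submodule (MvPolynomial (PhaseIdx N) ℂ) F.Gr} {m : ℤ} {x : M} :
    x ∈ F.classIn H m ↔ ∃ h : x ∈ F.piece m, F.toGr (F.homog m ⟨x, h⟩) ∈ H := by
  simp [classIn]

/-- The terms of `p` of degree `l` act on classes by multiplication, while those of lower degree
land in `F_{m+l-1}` and contribute zero. It allows inclusions of the additive subgroups `orderMul`
to be tested on generators. -/
theorem op_smul_mem_classIn (hop : ∀ (p : MvPolynomial (PhaseIdx N) ℂ) (l : ℕ),
      weightedTotalDegree xiWeight p ≤ l → ∀ m, ∀ x ∈ F.piece m, op p • x ∈ F.piece (m + l))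
    {H : Submodule (MvPolynomial (PhaseIdx N) ℂ) F.Gr} {m : ℤ} {x : M} (hx : x ∈ F.classIn H m)
    {p : MvPolynomial (PhaseIdx N) ℂ} {l : ℕ} (hp : weightedTotalDegree xiWeight p ≤ l) :
    op p • x ∈ F.classIn H (m + l) := by
  obtain ⟨hxm, hxH⟩ := F.mem_classIn.1 hx
  rw [p.as_sum, map_sum, Finset.sum_smul]
  refine Submodule.sum_mem _ fun s hs => ?_
  have hhom := isWeightedHomogeneous_monomial xiWeight s (coeff s p) rfl
  have hsl : Finsupp.weight xiWeight s ≤ l := (le_weightedTotalDegree xiWeight hs).trans hp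
  have hmem := hop _ _ (weightedTotalDegree_le_of_homogeneous hhom) m x hxm
  refine F.mem_classIn.2 ⟨F.mono (by lia) hmem, ?_⟩
  rcases hsl.lt_or_eq with h | rfl
  · rw [toGr_homog_eq_zero]
    · exact zero_mem _
    · exact F.mono (by lia) hmem
  · rw [F.toGr_homog_op hhom ⟨x, hxm⟩]
    exact H.smul_mem _ hxH

end Filtration

/-- Low degrees are zero, degrees above `m0` are generated from degree `m0`, and each of the
finitely many degrees between is finitely generated over `ℂ[z]`. -/
theorem IsGoodFiltration.finite_gr {F : ℤ → AddSubgroup M} (hF : IsGoodFiltration (N := N) F) :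
    Module.Finite (MvPolynomial (PhaseIdx N) ℂ) hF.toFiltration.Gr := by
  obtain ⟨m0, hm0⟩ := hF.good
  -- The bound is lowered below `m0` so that `m0` itself lies in the interval of generating degrees.
  obtain ⟨b, hbm, hb⟩ : ∃ b ≤ m0, ∀ m ≤ b, F m = ⊥ := by
    obtain ⟨b, hb⟩ := hF.eventually_bot
    exact ⟨min b m0, min_le_right _ _, fun m hm => hb m (hm.trans (min_le_left _ _))⟩
  let 𝓕 := hF.toFiltration
  let H : ℤ → Submodule (MvPolynomial (PhaseIdx N) ℂ) 𝓕.Gr := fun m =>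
    Submodule.span _ (Set.range fun x : 𝓕.piece m => 𝓕.toGr (𝓕.homog m x))
  have hHmem : ∀ m (x : 𝓕.piece m), 𝓕.toGr (𝓕.homog m x) ∈ H m := fun m x =>
    Submodule.subset_span ⟨x, rfl⟩
  have hop : ∀ (p : MvPolynomial (PhaseIdx N) ℂ) (l : ℕ), weightedTotalDegree xiWeight p ≤ l →
      ∀ m, ∀ x ∈ 𝓕.piece m, op p • x ∈ 𝓕.piece (m + l) := fun p l hp m x hx =>
    hF.op_smul_mem hp hx
  have hHfg : ∀ m, (H m).FG := by
    intro m
    obtain ⟨S, hS⟩ := hF.fg m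
    have hSF : ∀ x ∈ S, x ∈ F m := fun x hx => by
      rw [hS]
      refine AddSubgroup.subset_closure ⟨1, ⟨1, ?_, ?_⟩, x, hx, (one_smul _ x).symm⟩
      · exact weightedTotalDegree_le_of_homogeneous (isWeightedHomogeneous_one ℂ xiWeight)
      · rw [← C_1, op_C, map_one]
    classical
    let gens : Finset 𝓕.Gr := S.attach.image fun x : {x // x ∈ S} => 𝓕.toGr (𝓕.homog m ⟨x, hSF x x.2⟩)
    refine ⟨gens, le_antisymm (Submodule.span_le.2 ?_) (Submodule.span_le.2 ?_)⟩
    · intro g hg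
      rw [Finset.mem_coe, Finset.mem_image] at hg
      obtain ⟨x, _, rfl⟩ := hg
      exact hHmem _ _
    · have hle : F m ≤ (𝓕.classIn (Submodule.span _ (gens : Set 𝓕.Gr)) m).toAddSubgroup := by
        rw [hS]
        refine (AddSubgroup.closure_le _).2 ?_
        rintro _ ⟨_, ⟨p, hp, rfl⟩, x, hx, rfl⟩
        have hg : 𝓕.toGr (𝓕.homog m ⟨x, hSF x hx⟩) ∈ gens :=
          Finset.mem_image_of_mem (fun x : {x // x ∈ S} => 𝓕.toGr (𝓕.homog m ⟨x, hSF x x.2⟩))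
            (Finset.mem_attach S ⟨x, hx⟩)
        have h := 𝓕.op_smul_mem_classIn hop (x := x) (m := m) (𝓕.mem_classIn.2 ⟨hSF x hx,
          Submodule.subset_span hg⟩) hp
        simpa using h
      rintro _ ⟨⟨x, hx⟩, rfl⟩
      obtain ⟨_, h⟩ := 𝓕.mem_classIn.1 (hle hx)
      exact h
  refine ⟨?_⟩
  suffices h : (⊤ : Submodule (MvPolynomial (PhaseIdx N) ℂ) 𝓕.Gr) =
      ⨆ m ∈ Finset.Icc b m0, H m by
    rw [h]
    exact Submodule.fg_biSup _ _ fun m _ => hHfg m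
  refine (eq_top_iff.2 fun g _ => ?_).symm
  obtain ⟨s, x, rfl⟩ := 𝓕.exists_sum_toGr_homog g
  refine Submodule.sum_mem _ fun m _ => ?_
  rcases le_or_gt m b with hmb | hmb
  · have hx0 : x m = 0 := by
      have h : (x m : M) ∈ F m := (x m).2
      rw [hb m hmb, AddSubgroup.mem_bot] at h
      exact Subtype.ext h
    rw [hx0, map_zero, map_zero]
    exact zero_mem _
  rcases le_or_gt m m0 with hm | hm
  · exact le_biSup H (Finset.mem_Icc.2 ⟨hmb.le, hm⟩) (hHmem m (x m))
  · obtain ⟨l, rfl⟩ := Int.le.dest hm.le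
    have hle : F (m0 + l) ≤
        (𝓕.classIn (⨆ m ∈ Finset.Icc b m0, H m) (m0 + l)).toAddSubgroup := by
      rw [← hm0 m0 le_rfl l]
      refine (AddSubgroup.closure_le _).2 ?_
      rintro _ ⟨_, ⟨p, hp, rfl⟩, y, hy, rfl⟩
      exact 𝓕.op_smul_mem_classIn hop (𝓕.mem_classIn.2 ⟨hy,
        le_biSup H (Finset.mem_Icc.2 ⟨hbm, le_rfl⟩) (hHmem m0 ⟨y, hy⟩)⟩) hp
    obtain ⟨_, h⟩ := 𝓕.mem_classIn.1 (hle (x (m0 + l)).2)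
    exact h

end Weyl

/-! ### The Rees algebra and the symbols of the defining equations. -/

namespace Weyl

theorem induction_gen {N : ℕ} {p : Weyl N → Prop} (hgen : ∀ k, p (gen k))
    (halg : ∀ c : ℂ, p (algebraMap ℂ _ c)) (hadd : ∀ P Q, p P → p Q → p (P + Q))
    (hmul : ∀ P Q, p P → p Q → p (P * Q)) (Q : Weyl N) : p Q := by
  obtain ⟨Q, hQ⟩ := Q
  induction hQ using Algebra.adjoin_induction with
  | mem Q hQ =>
    rcases hQ with ⟨j, rfl⟩ | ⟨j, rfl⟩
    · exact hgen (Sum.inl j)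
    · exact hgen (Sum.inr j)
  | algebraMap c => exact halg c
  | add a b ha hb iha ihb => exact hadd ⟨a, ha⟩ ⟨b, hb⟩ iha ihb
  | mul a b ha hb iha ihb => exact hmul ⟨a, ha⟩ ⟨b, hb⟩ iha ihb

namespace Filtration

variable {N : ℕ} {M : Type*} [AddCommGroup M] [Module ℂ M] [Module (Weyl N) M]
  [IsScalarTower ℂ (Weyl N) M] (F : Filtration N M)

/-- The Rees algebra, as an algebra of operators on the Rees module. -/
def reesAlg : Subalgebra ℂ (Module.End ℂ F.rees) :=
  Algebra.adjoin ℂ (insert F.reesShift (Set.range F.reesGen))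

theorem reesShift_mem_reesAlg : F.reesShift ∈ F.reesAlg :=
  Algebra.subset_adjoin (Set.mem_insert _ _)

theorem reesGen_mem_reesAlg (k : PhaseIdx N) : F.reesGen k ∈ F.reesAlg :=
  Algebra.subset_adjoin (Set.mem_insert_of_mem _ ⟨k, rfl⟩)

theorem add_mem_reesAlg {a b : Module.End ℂ F.rees} (ha : a ∈ F.reesAlg) (hb : b ∈ F.reesAlg) :
    a + b ∈ F.reesAlg := add_mem ha hb

theorem mul_mem_reesAlg {a b : Module.End ℂ F.rees} (ha : a ∈ F.reesAlg) (hb : b ∈ F.reesAlg) :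
    a * b ∈ F.reesAlg := mul_mem ha hb

theorem reesAlg_induction {p : Module.End ℂ F.rees → Prop} (hshift : p F.reesShift)
    (hgen : ∀ k, p (F.reesGen k)) (halg : ∀ r : ℂ, p (algebraMap ℂ _ r))
    (hadd : ∀ a b, a ∈ F.reesAlg → b ∈ F.reesAlg → p a → p b → p (a + b))
    (hmul : ∀ a b, a ∈ F.reesAlg → b ∈ F.reesAlg → p a → p b → p (a * b)) :
    ∀ a ∈ F.reesAlg, p a := fun a ha => by
  induction ha using Algebra.adjoin_induction with
  | mem x hx =>
    rcases hx with rfl | ⟨k, rfl⟩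
    · exact hshift
    · exact hgen k
  | algebraMap r => exact halg r
  | add a b ha hb h h' => exact hadd a b ha hb h h'
  | mul a b ha hb h h' => exact hmul a b ha hb h h'

theorem reesAlg_apply_reesShift {r : Module.End ℂ F.rees} (hr : r ∈ F.reesAlg) (w : F.rees) :
    r (F.reesShift w) = F.reesShift (r w) := by
  revert w
  refine F.reesAlg_induction (p := fun r => ∀ w, r (F.reesShift w) = F.reesShift (r w))
    (fun w => rfl) (fun k w => LinearMap.congr_fun (F.commute_reesGen_reesShift k) w)
    (fun c w => by simp only [Module.algebraMap_end_apply, map_smul])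
    (fun a b _ _ ha hb w => by simp only [LinearMap.add_apply, ha, hb, map_add])
    (fun a b _ _ ha hb w => by simp only [Module.End.mul_apply, ha, hb]) r hr

/-- Modulo `t` the Rees algebra is commutative. -/
theorem exists_reesAlg_commutator {r r' : Module.End ℂ F.rees} (hr : r ∈ F.reesAlg)
    (hr' : r' ∈ F.reesAlg) :
    ∃ c ∈ F.reesAlg, ∀ w, r (r' w) = r' (r w) + F.reesShift (c w) := by
  have hzero : ∀ {a b : Module.End ℂ F.rees}, (∀ w, a (b w) = b (a w)) →
      ∃ c ∈ F.reesAlg, ∀ w, a (b w) = b (a w) + F.reesShift (c w) := fun h =>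
    ⟨0, zero_mem _, fun w => by rw [h, LinearMap.zero_apply, map_zero, add_zero]⟩
  revert r'
  refine F.reesAlg_induction (p := fun r => ∀ {r'}, r' ∈ F.reesAlg →
    ∃ c ∈ F.reesAlg, ∀ w, r (r' w) = r' (r w) + F.reesShift (c w)) ?_ ?_ ?_ ?_ ?_ r hr
  · exact fun hr' => hzero fun w => (F.reesAlg_apply_reesShift hr' w).symm
  · intro k r' hr'
    refine F.reesAlg_induction (p := fun r' =>
      ∃ c ∈ F.reesAlg, ∀ w, F.reesGen k (r' w) = r' (F.reesGen k w) + F.reesShift (c w))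
      ?_ ?_ ?_ ?_ ?_ r' hr'
    · exact hzero fun w => LinearMap.congr_fun (F.commute_reesGen_reesShift k) w
    · intro k'
      obtain ⟨c, hc⟩ := F.exists_reesGen_commutator k k'
      exact ⟨algebraMap ℂ _ c, Subalgebra.algebraMap_mem _ c, fun w => by
        rw [hc, Module.algebraMap_end_apply, map_smul]⟩
    · exact fun c => hzero fun w => by simp only [Module.algebraMap_end_apply, map_smul]
    · rintro a b _ _ ⟨c, hc, h⟩ ⟨c', hc', h'⟩
      refine ⟨c + c', add_mem hc hc', fun w => ?_⟩
      simp only [LinearMap.add_apply, map_add, h, h']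
      abel
    · rintro a b ha _ ⟨c, hc, h⟩ ⟨c', hc', h'⟩
      refine ⟨c * b + a * c', add_mem (mul_mem hc ‹_›) (mul_mem ha hc'), fun w => ?_⟩
      simp only [LinearMap.add_apply, Module.End.mul_apply, map_add, h, h',
        F.reesAlg_apply_reesShift ha]
      abel
  · exact fun c _ _ => hzero fun w => by simp only [Module.algebraMap_end_apply, map_smul]
  · intro a b _ _ ha hb r' hr'
    obtain ⟨c, hc, h⟩ := ha hr'
    obtain ⟨c', hc', h'⟩ := hb hr'
    refine ⟨c + c', add_mem hc hc', fun w => ?_⟩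
    simp only [LinearMap.add_apply, map_add, h, h']
    abel
  · intro a b ham hbm ha hb r' hr'
    obtain ⟨c, hc, h⟩ := ha hr'
    obtain ⟨c', hc', h'⟩ := hb hr'
    refine ⟨c * b + a * c', add_mem (mul_mem hc hbm) (mul_mem ham hc'), fun w => ?_⟩
    simp only [LinearMap.add_apply, Module.End.mul_apply, map_add, h, h',
      F.reesAlg_apply_reesShift ham]
    abel

/-- An operator that raises a cyclic vector into the multiples of `t` raises the whole cyclic
module it generates. -/
theorem exists_pow_apply_eq {P : Module.End ℂ F.rees} (hP : P ∈ F.reesAlg) {v : F.rees}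
    (hv : ∃ r ∈ F.reesAlg, P v = F.reesShift (r v)) (k : ℕ) :
    ∀ r ∈ F.reesAlg, ∃ r' ∈ F.reesAlg, (P ^ k) (r v) = (F.reesShift ^ k) (r' v) := by
  obtain ⟨r0, hr0, hv⟩ := hv
  induction k with
  | zero => exact fun r hr => ⟨r, hr, by simp⟩
  | succ k ih =>
    intro r hr
    -- Commuting `P` past `r` gives `P r v = r P v + t c v = t (r r0 + c) v`: each factor `P`
    -- produces one factor `t` and leaves a vector of the same cyclic module.
    obtain ⟨c, hc, h⟩ := F.exists_reesAlg_commutator hP hr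
    obtain ⟨r', hr', h'⟩ := ih (r * r0 + c) (add_mem (mul_mem hr hr0) hc)
    refine ⟨r', hr', ?_⟩
    have hPk : P ^ k ∈ F.reesAlg := pow_mem hP k
    rw [pow_succ, Module.End.mul_apply, h, hv, F.reesAlg_apply_reesShift hr, ← map_add,
      F.reesAlg_apply_reesShift hPk, pow_succ', Module.End.mul_apply, ← h']
    rfl

/-- The summands of an operator are brought to a common degree by powers of `t`. The degree reached
is not controlled and may exceed the filtration degree of `Q • x`; `mem_radical_annihilator`
compensates for this with a high power of the symbol. -/
theorem exists_reesAlg_apply_eq_single {v : F.rees} (Q : Weyl N) {i : ℤ} {x : M}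
    (hx : ∃ r ∈ F.reesAlg, (r v : ℤ →₀ M) = Finsupp.single i x) :
    ∃ (j : ℤ), ∃ r ∈ F.reesAlg, (r v : ℤ →₀ M) = Finsupp.single j (Q • x) := by
  have hshift : ∀ (k : ℕ) (i : ℤ) (x : M), (∃ r ∈ F.reesAlg, (r v : ℤ →₀ M) = Finsupp.single i x) →
      ∃ r ∈ F.reesAlg, (r v : ℤ →₀ M) = Finsupp.single (i + k) x := by
    intro k i x
    induction k generalizing i with
    | zero => simp
    | succ k ih =>
      rintro ⟨r, hr, h⟩
      obtain ⟨r', hr', h'⟩ := ih (i + 1) ⟨F.reesShift * r, mul_mem F.reesShift_mem_reesAlg hr, by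
        rw [Module.End.mul_apply, coe_reesShift, h, degShift_single]⟩
      exact ⟨r', hr', by rw [h']; congr 1; push_cast; ring⟩
  revert i x
  refine induction_gen (p := fun Q => ∀ {i : ℤ} {x : M},
    (∃ r ∈ F.reesAlg, (r v : ℤ →₀ M) = Finsupp.single i x) →
    ∃ (j : ℤ), ∃ r ∈ F.reesAlg, (r v : ℤ →₀ M) = Finsupp.single j (Q • x)) ?_ ?_ ?_ ?_ Q
  · rintro k i x ⟨r, hr, h⟩
    exact ⟨i + xiWeight k, F.reesGen k * r, mul_mem (F.reesGen_mem_reesAlg k) hr, by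
      rw [Module.End.mul_apply, coe_reesGen, h, shiftGen_single]⟩
  · rintro c i x ⟨r, hr, h⟩
    refine ⟨i, c • r, Subalgebra.smul_mem _ hr c, ?_⟩
    rw [LinearMap.smul_apply, Submodule.coe_smul, h, Finsupp.smul_single, algebraMap_smul]
  · intro a b iha ihb i x hx
    obtain ⟨j, hj⟩ := iha hx
    obtain ⟨j', hj'⟩ := ihb hx
    obtain ⟨r, hr, h⟩ := hshift (j' - j).toNat j _ hj
    obtain ⟨r', hr', h'⟩ := hshift (j - j').toNat j' _ hj'
    refine ⟨max j j', r + r', add_mem hr hr', ?_⟩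
    rw [LinearMap.add_apply, Submodule.coe_add, h, h',
      show j + ((j' - j).toNat : ℤ) = max j j' by lia,
      show j' + ((j - j').toNat : ℤ) = max j j' by lia, ← Finsupp.single_add, add_smul]
  · intro a b iha ihb i x hx
    obtain ⟨j, hj⟩ := ihb hx
    obtain ⟨j', hj'⟩ := iha hj
    exact ⟨j', by rwa [smul_smul] at hj'⟩

/-- If `M` is generated by an eigenvector `u` of an operator of positive order, or by a vector
that it kills, then its symbol lies in the radical of the annihilator of the symbol module. -/
theorem mem_radical_annihilator [Module.Finite (MvPolynomial (PhaseIdx N) ℂ) F.Gr]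
    {u : M} {m1 : ℤ} (hu : u ∈ F.piece m1) (hcyc : ∀ x, ∃ Q : Weyl N, x = Q • u)
    {p : MvPolynomial (PhaseIdx N) ℂ} {l : ℕ} (hp : IsWeightedHomogeneous xiWeight p l)
    {c : ℂ} (hpu : op p • u = c • u) (hcl : c = 0 ∨ 1 ≤ l) :
    p ∈ (Module.annihilator (MvPolynomial (PhaseIdx N) ℂ) F.Gr).radical := by
  have hPmem : normalOp F.reesGen p ∈ F.reesAlg  :=
    normalOp_rel (E := Module.End ℂ F.rees) (E' := ℂ) (fun e _ => e ∈ F.reesAlg)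
      (fun c => Subalgebra.algebraMap_mem _ c) (fun _ _ _ _ h h' => F.add_mem_reesAlg h h')
      (fun _ _ _ _ h h' => F.mul_mem_reesAlg h h') (q' := 0) F.reesGen_mem_reesAlg p
  have hv : ∃ r ∈ F.reesAlg, normalOp F.reesGen p (F.homog m1 ⟨u, hu⟩)
      = F.reesShift (r (F.homog m1 ⟨u, hu⟩)) := by
    -- With `v` the class of `u` in degree `m1`, the vector `op p • u = c u` placed in degree `m1 +
    -- l` is `c t^l v`, which is divisible by `t` as soon as `l ≥ 1`.
    rcases hcl with rfl | hl
    · refine ⟨0, zero_mem _, Subtype.ext ?_⟩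
      rw [coe_normalOp, coe_homog, normalOp_shiftGen_homogeneous hp, hpu]
      simp
    · refine ⟨c • F.reesShift ^ (l - 1), Subalgebra.smul_mem _
        (pow_mem F.reesShift_mem_reesAlg _) c, Subtype.ext (Finsupp.ext fun m => ?_)⟩
      rw [coe_normalOp, coe_homog, normalOp_shiftGen_homogeneous hp, hpu, LinearMap.smul_apply,
        map_smul, ← Module.End.mul_apply, ← pow_succ', Nat.sub_add_cancel hl, Submodule.coe_smul,
        Finsupp.smul_apply, reesShift_pow_apply, coe_homog]
      classical
      rw [Finsupp.single_apply, Finsupp.single_apply]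
      by_cases h : m1 + l = m
      · rw [if_pos h, if_pos (by lia)]
      · rw [if_neg h, if_neg (by lia), smul_zero]
  have hloc : ∀ (m : ℤ) (x : F.piece m), ∃ k : ℕ, p ^ k • F.toGr (F.homog m x) = 0 := by
    rintro m ⟨x, hx⟩
    obtain ⟨Q, rfl⟩ := hcyc x
    obtain ⟨i, r, hr, hri⟩ := F.exists_reesAlg_apply_eq_single (v := F.homog m1 ⟨u, hu⟩) Q
      (i := m1) (x := u) ⟨1, one_mem _, rfl⟩
    -- The vector is obtained from `u` in degree `i`, perhaps larger than `m`. Applying the operator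
    -- `k` times puts it in `F_{i+kl-k}`, and `k ≥ i - m + 1` makes this part of `F_{m+kl-1}`, where
    -- the class in degree `m + kl` is zero.
    refine ⟨(i - m + 1).toNat, ?_⟩
    set k := (i - m + 1).toNat
    have hpow : ∀ (k : ℕ) (w : F.rees),
        F.toGr ((normalOp F.reesGen p ^ k) w) = p ^ k • F.toGr w := by
      intro k
      induction k with
      | zero => simp
      | succ k ih =>
        intro w
        rw [pow_succ, Module.End.mul_apply, ih, toGr_normalOp, smul_smul, pow_succ]
    have hcoe : ∀ (k : ℕ) (w : F.rees),
        ((normalOp F.reesGen p ^ k) w : ℤ →₀ M) = (normalOp (shiftGen M) p ^ k) w := by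
      intro k
      induction k with
      | zero => simp
      | succ k ih =>
        intro w
        rw [pow_succ, Module.End.mul_apply, ih, coe_normalOp, pow_succ, Module.End.mul_apply]
    obtain ⟨r', hr', h'⟩ := F.exists_pow_apply_eq hPmem hv k r hr
    have h1 : op p ^ k • Q • u ∈ F.piece (i + k * l - k) := by
      have h2 := DFunLike.congr_fun (congrArg Subtype.val h') (i + k * l)
      rw [hcoe, hri, normalOp_shiftGen_homogeneous_pow hp, Finsupp.single_eq_same,
        reesShift_pow_apply] at h2
      rw [h2]
      exact (r' _).2 _
    rw [← hpow, toGr_eq_zero_iff]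
    intro j
    rw [hcoe, coe_homog, normalOp_shiftGen_homogeneous_pow hp]
    classical
    rw [Finsupp.single_apply]
    split_ifs with hj
    · exact F.mono (by lia) h1
    · exact zero_mem _
  have hall : ∀ g : F.Gr, ∃ k : ℕ, p ^ k • g = 0 := by
    intro g
    obtain ⟨s, x, rfl⟩ := F.exists_sum_toGr_homog g
    choose k hk using hloc
    refine ⟨∑ m ∈ s, k m (x m), ?_⟩
    rw [Finset.smul_sum]
    refine Finset.sum_eq_zero fun m hm => ?_
    rw [← Finset.sum_erase_add _ _ hm, pow_add, mul_smul, hk, smul_zero]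
  classical
  obtain ⟨S, hS⟩ := (inferInstance : Module.Finite (MvPolynomial (PhaseIdx N) ℂ) F.Gr).fg_top
  choose k hk using hall
  refine ⟨∑ g ∈ S, k g, Module.mem_annihilator.2 fun g => ?_⟩
  have hg : g ∈ Submodule.span (MvPolynomial (PhaseIdx N) ℂ) (S : Set F.Gr) :=
    hS ▸ Submodule.mem_top
  induction hg using Submodule.span_induction with
  | zero => exact smul_zero _
  | add u v _ _ hu hv => rw [smul_add, hu, hv, add_zero]
  | mem g hg => rw [← Finset.sum_erase_add _ _ hg, pow_add, mul_smul, hk, smul_zero]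
  | smul c g _ hg => rw [smul_comm, hg, smul_zero]

end Filtration

end Weyl

/-! ### The Zariski topology and ideals -/

theorem Topology.IsInducing.isIrreducible_of_image {X Y : Type*} [TopologicalSpace X]
    [TopologicalSpace Y] {f : X → Y} (hf : Topology.IsInducing f) {s : Set X}
    (h : IsIrreducible (f '' s)) : IsIrreducible s := by
  refine ⟨h.1.of_image, fun u v hu hv => ?_⟩
  obtain ⟨u', hu', rfl⟩ := hf.isOpen_iff.1 hu
  obtain ⟨v', hv', rfl⟩ := hf.isOpen_iff.1 hv
  rintro ⟨x, hx, hxu⟩ ⟨y, hy, hyv⟩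
  obtain ⟨_, ⟨w, hw, rfl⟩, hw'⟩ :=
    h.2 u' v' hu' hv' ⟨f x, ⟨x, hx, rfl⟩, hxu⟩ ⟨f y, ⟨y, hy, rfl⟩, hyv⟩
  exact ⟨w, hw, hw'⟩

namespace ZarAffine

variable {σ : Type*}

/-- The ideal of the polynomials that vanish on `S`. -/
def vanishing (S : Set (ZarAffine σ)) : Ideal (MvPolynomial σ ℂ) :=
  MvPolynomial.vanishingIdeal (σ := σ) ℂ S

theorem mem_vanishing {S : Set (ZarAffine σ)} {f : MvPolynomial σ ℂ} :
    f ∈ vanishing S ↔ ∀ x ∈ S, eval (σ := σ) x f = 0 := by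
  exact MvPolynomial.mem_vanishingIdeal_iff (k := ℂ) (K := ℂ) (σ := σ)

theorem vanishing_anti {S S' : Set (ZarAffine σ)} (h : S ⊆ S') : vanishing S' ≤ vanishing S :=
  fun _ hf => mem_vanishing.2 fun x hx => mem_vanishing.1 hf x (h hx)

theorem isInducing_toSpec : Topology.IsInducing (toSpec : ZarAffine σ → _) := ⟨rfl⟩

theorem vanishingIdeal_image_toSpec (S : Set (ZarAffine σ)) :
    PrimeSpectrum.vanishingIdeal (toSpec '' S) = vanishing S :=
  MvPolynomial.vanishingIdeal_pointToPoint (k := ℂ) (σ := σ) (K := ℂ) S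

theorem mem_closure_iff {S : Set (ZarAffine σ)} {x : ZarAffine σ} :
    x ∈ closure S ↔ ∀ f ∈ vanishing S, eval (σ := σ) x f = 0 := by
  rw [isInducing_toSpec.closure_eq_preimage_closure_image, Set.mem_preimage,
    ← PrimeSpectrum.zeroLocus_vanishingIdeal_eq_closure, vanishingIdeal_image_toSpec,
    PrimeSpectrum.mem_zeroLocus]
  refine forall₂_congr fun f _ => ?_
  exact MvPolynomial.mem_vanishingIdeal_singleton_iff (k := ℂ) (K := ℂ) (σ := σ) x f

theorem vanishing_closure (S : Set (ZarAffine σ)) : vanishing (closure S) = vanishing S :=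
  le_antisymm (vanishing_anti subset_closure)
    fun f hf => mem_vanishing.2 fun _ hx => mem_closure_iff.1 hx f hf

theorem isClosed_zeros (T : Set (MvPolynomial σ ℂ)) :
    IsClosed {x : ZarAffine σ | ∀ f ∈ T, eval (σ := σ) x f = 0} := by
  refine isClosed_of_closure_subset fun x hx f hf => ?_
  exact mem_closure_iff.1 hx f (mem_vanishing.2 fun y hy => hy f hf)

theorem isIrreducible_iff {S : Set (ZarAffine σ)} :
    IsIrreducible S ↔ (vanishing S).IsPrime := by
  constructor
  · intro h
    rw [← vanishingIdeal_image_toSpec, ← PrimeSpectrum.isIrreducible_iff_vanishingIdeal_isPrime]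
    exact h.image _ isInducing_toSpec.continuous.continuousOn
  · intro h
    refine ⟨?_, ?_⟩
    · rw [Set.nonempty_iff_ne_empty]
      rintro rfl
      exact h.ne_top (Ideal.eq_top_iff_one _ |>.2 (mem_vanishing.2 fun x hx => hx.elim))
    · rw [isPreirreducible_iff_isClosed_union_isClosed]
      intro C₁ C₂ h₁ h₂ hS
      by_contra! hc
      obtain ⟨⟨x₁, hx₁, hx₁'⟩, ⟨x₂, hx₂, hx₂'⟩⟩ :=
        And.imp Set.not_subset.1 Set.not_subset.1 hc
      rw [← h₁.closure_eq, mem_closure_iff] at hx₁'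
      rw [← h₂.closure_eq, mem_closure_iff] at hx₂'
      push Not at hx₁' hx₂'
      obtain ⟨f, hf, hfx⟩ := hx₁'
      obtain ⟨g, hg, hgx⟩ := hx₂'
      have : f * g ∈ vanishing S := mem_vanishing.2 fun x hx => by
        rw [map_mul]
        rcases hS hx with hx | hx
        · rw [mem_vanishing.1 hf x hx, zero_mul]
        · rw [mem_vanishing.1 hg x hx, mul_zero]
      rcases h.mem_or_mem this with hf' | hg'
      · exact hfx (mem_vanishing.1 hf' x₁ hx₁)
      · exact hgx (mem_vanishing.1 hg' x₂ hx₂)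

variable [Finite σ]

theorem vanishing_zeros (J : Ideal (MvPolynomial σ ℂ)) :
    vanishing {x : ZarAffine σ | ∀ f ∈ J, eval (σ := σ) x f = 0} = J.radical :=
  MvPolynomial.vanishingIdeal_zeroLocus_eq_radical (k := ℂ) (K := ℂ) J

/-- The irreducible components of a closed set correspond to minimal primes. -/
theorem mem_minimalPrimes_of_isIrredComponentOf {J : Ideal (MvPolynomial σ ℂ)}
    {Z : Set (ZarAffine σ)}
    (hZ : IsIrredComponentOf Z {x : ZarAffine σ | ∀ f ∈ J, eval (σ := σ) x f = 0}) :
    IsClosed Z ∧ vanishing Z ∈ J.minimalPrimes := by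
  have hJ := isClosed_zeros (J : Set (MvPolynomial σ ℂ))
  have hle : ∀ P : Ideal (MvPolynomial σ ℂ), J ≤ P →
      {x : ZarAffine σ | ∀ f ∈ P, eval (σ := σ) x f = 0} ⊆
      {x : ZarAffine σ | ∀ f ∈ J, eval (σ := σ) x f = 0} := fun P hP x hx f hf => hx f (hP hf)
  refine ⟨?_, ⟨isIrreducible_iff.1 hZ.prop.1, fun f hf => mem_vanishing.2 fun x hx =>
    hZ.prop.2 hx f hf⟩, ?_⟩
  · rw [hZ.eq_of_le (y := closure Z) ⟨hZ.prop.1.closure, closure_minimal hZ.prop.2 hJ⟩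
      subset_closure]
    exact isClosed_closure
  · rintro P ⟨hP, hJP⟩ hPZ
    have hirr : IsIrreducible {x : ZarAffine σ | ∀ f ∈ P, eval (σ := σ) x f = 0} := by
      rw [isIrreducible_iff, vanishing_zeros, hP.radical]
      exact hP
    rw [hZ.eq_of_le (y := {x : ZarAffine σ | ∀ f ∈ P, eval (σ := σ) x f = 0})
      ⟨hirr, hle P hJP⟩ fun x hx f hf => mem_vanishing.1 (hPZ hf) x hx,
      vanishing_zeros, hP.radical]

/-- By the Nullstellensatz, vanishing ideals and zero sets match irreducible closed subsets of `Z`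
with primes over `vanishing Z`, reversing inclusions; hence the order dual on the side of primes. -/
theorem topologicalKrullDim_eq {Z : Set (ZarAffine σ)} (hZ : IsClosed Z) :
    topologicalKrullDim Z = ringKrullDim (MvPolynomial σ ℂ ⧸ vanishing Z) := by
  rw [ringKrullDim_quotient, ← Order.krullDim_orderDual, topologicalKrullDim]
  have hcl : ∀ S : TopologicalSpace.IrreducibleCloseds Z,
      closure (Subtype.val '' (S : Set Z)) = Subtype.val '' (S : Set Z) := fun S =>
    (hZ.isClosedEmbedding_subtypeVal.isClosedMap _ S.isClosed).closure_eq
  apply le_antisymm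
  · let φ : TopologicalSpace.IrreducibleCloseds Z →
        (PrimeSpectrum.zeroLocus (R := MvPolynomial σ ℂ) (vanishing Z : Set _))ᵒᵈ := fun S =>
      OrderDual.toDual ⟨⟨vanishing (Subtype.val '' (S : Set Z)), isIrreducible_iff.1
        (S.isIrreducible.image _ continuous_subtype_val.continuousOn)⟩, by
          rw [PrimeSpectrum.mem_zeroLocus]
          exact vanishing_anti (by rintro _ ⟨x, -, rfl⟩; exact x.2)⟩
    have hφ : Monotone φ := fun S S' h => by
      change vanishing _ ≤ vanishing _
      exact vanishing_anti (Set.image_mono h)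
    refine Order.krullDim_le_of_strictMono φ (hφ.strictMono_of_injective fun S S' h => ?_)
    have h' : vanishing (Subtype.val '' (S : Set Z)) = vanishing (Subtype.val '' (S' : Set Z)) :=
      congrArg (fun p => (OrderDual.ofDual p).1.asIdeal) h
    apply SetLike.coe_injective
    apply Set.image_injective.2 Subtype.val_injective
    rw [← hcl S, ← hcl S']
    ext x
    rw [mem_closure_iff, mem_closure_iff, h']
  · let T : Ideal (MvPolynomial σ ℂ) → Set (ZarAffine σ) := fun P =>
      {x : ZarAffine σ | ∀ f ∈ P, eval (σ := σ) x f = 0}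
    have hT : ∀ P : Ideal (MvPolynomial σ ℂ), P.IsPrime → vanishing (T P) = P := fun P hP => by
      rw [vanishing_zeros, hP.radical]
    have hsub : ∀ P : Ideal (MvPolynomial σ ℂ), vanishing Z ≤ P → T P ⊆ Z := fun P hP x hx => by
      rw [← hZ.closure_eq, mem_closure_iff]
      exact fun f hf => hx f (hP hf)
    have him : ∀ P : Ideal (MvPolynomial σ ℂ), vanishing Z ≤ P →
        Subtype.val '' (Subtype.val ⁻¹' (T P) : Set Z) = T P := fun P hP => by
      rw [Subtype.image_preimage_coe, Set.inter_eq_right.2 (hsub P hP)]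
    let ψ : (PrimeSpectrum.zeroLocus (R := MvPolynomial σ ℂ) (vanishing Z : Set _))ᵒᵈ →
        TopologicalSpace.IrreducibleCloseds Z := fun P =>
      ⟨Subtype.val ⁻¹' (T (OrderDual.ofDual P).1.asIdeal), by
        have h1 : vanishing Z ≤ (OrderDual.ofDual P).1.asIdeal := (OrderDual.ofDual P).2
        have h2 : IsIrreducible (T (OrderDual.ofDual P).1.asIdeal) := by
          rw [isIrreducible_iff, hT _ (OrderDual.ofDual P).1.2]
          exact (OrderDual.ofDual P).1.2
        exact Topology.IsInducing.subtypeVal.isIrreducible_of_image ((him _ h1).symm ▸ h2), (isClosed_zeros _).preimage continuous_subtype_val⟩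
    have hψ : Monotone ψ := fun P P' h x hx f hf => hx f (h hf)
    refine Order.krullDim_le_of_strictMono ψ (hψ.strictMono_of_injective fun P P' h => ?_)
    have h0 : (Subtype.val ⁻¹' (T (OrderDual.ofDual P).1.asIdeal) : Set Z) =
        Subtype.val ⁻¹' (T (OrderDual.ofDual P').1.asIdeal) := congrArg SetLike.coe h
    have h1 : T (OrderDual.ofDual P).1.asIdeal = T (OrderDual.ofDual P').1.asIdeal := by
      rw [← him _ (OrderDual.ofDual P).2, h0, him _ (OrderDual.ofDual P').2]
    apply OrderDual.ofDual.injective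
    apply Subtype.ext
    apply PrimeSpectrum.ext
    rw [← hT _ (OrderDual.ofDual P).1.2, h1, hT _ (OrderDual.ofDual P').1.2]

end ZarAffine

/-! ### Krull dimension and transcendence degree -/

/-- Incomparability shows that contraction of primes is strictly monotone. Conversely, injectivity
gives a prime over the bottom of a chain, and going up lifts the rest. -/
theorem ringKrullDim_eq_of_isIntegral_of_injective {R S : Type*} [CommRing R] [CommRing S]
    [Algebra R S] [Algebra.IsIntegral R S] (h : Function.Injective (algebraMap R S)) :
    ringKrullDim S = ringKrullDim R := by
  apply le_antisymm
  · refine Order.krullDim_le_of_strictMono (PrimeSpectrum.comap (algebraMap R S))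
      fun p q hpq => ?_
    obtain ⟨hle, x, hx, hx'⟩ := SetLike.lt_iff_le_and_exists.1
      (show p.asIdeal < q.asIdeal from hpq)
    exact Ideal.comap_lt_comap_of_integral_mem_sdiff hle ⟨hx, hx'⟩
      (Algebra.IsIntegral.isIntegral x)
  · refine iSup_le fun l => ?_
    have : (RelSeries.head l).asIdeal.IsPrime := (RelSeries.head l).2
    obtain ⟨Q, -, hQ, hQl⟩ := Ideal.exists_ideal_over_prime_of_isIntegral
      (RelSeries.head l).asIdeal (⊥ : Ideal S) (by
        rw [Ideal.comap_bot_of_injective _ h]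
        exact bot_le)
    have : Q.LiesOver (RelSeries.head l).asIdeal := ⟨hQl.symm⟩
    obtain ⟨L, hL, -⟩ := Ideal.exists_ltSeries_of_hasGoingUp l Q
    rw [← hL]
    exact le_iSup (fun p : LTSeries (PrimeSpectrum S) => (p.length : WithBot ℕ∞)) L

/-- Noether normalization makes `Q` integral over a polynomial ring whose variables form another
transcendence basis, so their number is `N`. -/
theorem ringKrullDim_eq_of_isTranscendenceBasis {Q : Type*} [CommRing Q] [IsDomain Q]
    [Algebra ℂ Q] [Algebra.FiniteType ℂ Q] {N : ℕ} {x : Fin N → Q}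
    (hx : IsTranscendenceBasis ℂ x) : ringKrullDim Q = N := by
  obtain ⟨s, g, hg, hint⟩ := exists_integral_inj_algHom_of_fg ℂ Q
  let _ : Algebra (MvPolynomial (Fin s) ℂ) Q := g.toRingHom.toAlgebra
  have hI : Algebra.IsIntegral (MvPolynomial (Fin s) ℂ) Q := ⟨hint⟩
  have _ : IsScalarTower ℂ (MvPolynomial (Fin s) ℂ) Q :=
    IsScalarTower.of_algebraMap_eq fun c => (g.commutes c).symm
  have hy : IsTranscendenceBasis ℂ fun i => g (X i : MvPolynomial (Fin s) ℂ) := by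
    have : FaithfulSMul (MvPolynomial (Fin s) ℂ) Q :=
      (faithfulSMul_iff_algebraMap_injective _ _).2 hg
    exact (IsTranscendenceBasis.mvPolynomial (Fin s) ℂ).algebraMap_comp
  have hs : s = N := by
    have := hy.lift_cardinalMk_eq hx
    simpa using this
  rw [ringKrullDim_eq_of_isIntegral_of_injective (R := MvPolynomial (Fin s) ℂ) hg,
    MvPolynomial.ringKrullDim_of_isNoetherianRing, ringKrullDim_eq_zero_of_field, hs]
  simp

theorem zpow_sum₀ {K ι : Type*} [Field K] {a : K} (ha : a ≠ 0) (s : Finset ι) (v : ι → ℤ) :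
    a ^ ∑ j ∈ s, v j = ∏ j ∈ s, a ^ v j := by
  classical
  induction s using Finset.induction with
  | empty => simp
  | insert i s hi ih => rw [Finset.sum_insert hi, Finset.prod_insert hi, zpow_add₀ ha, ih]

/-! ### Torus orbits in the toric variety -/

/-- The monomial characters of a torus are linearly independent, in the form of an extension of
relations. -/
theorem sum_mul_eq_zero_of_characters {n : ℕ} {ι : Type*} (s : Finset ι) (c : ι → ℂ)
    (deg : ι → Fin n → ℤ)
    (h : ∀ t : Fin n → ℂˣ, ∑ u ∈ s, c u * ∏ i, (t i : ℂ) ^ deg u i = 0)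
    (w : (Fin n → ℤ) → ℂ) : ∑ u ∈ s, c u * w (deg u) = 0 := by
  let ψ : (Fin n → ℤ) → ((Fin n → ℂˣ) →* ℂ) := fun d =>
    { toFun := fun t => ∏ i, (t i : ℂ) ^ d i
      map_one' := by simp
      map_mul' := fun t t' => by simp [mul_zpow, Finset.prod_mul_distrib] }
  -- The torus element with `2` in place `i` and `1` elsewhere reads off the exponent `d i`, since
  -- the norms of the powers of `2` are distinct.
  have hψ : Function.Injective ψ := by
    intro d d' hd
    ext i
    have h1 := DFunLike.congr_fun hd (Function.update (1 : Fin n → ℂˣ) i (Units.mk0 (2 : ℂ) two_ne_zero))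
    have h2 : ∀ d : Fin n → ℤ,
        ψ d (Function.update 1 i (Units.mk0 (2 : ℂ) two_ne_zero)) = (2 : ℂ) ^ d i := fun d => by
      change ∏ k, (Function.update (1 : Fin n → ℂˣ) i (Units.mk0 (2 : ℂ) two_ne_zero) k : ℂ) ^ d k
        = _
      rw [Finset.prod_eq_single i]
      · simp
      · intro k _ hk
        simp [Function.update_of_ne hk]
      · simp
    rw [h2, h2] at h1
    have h3 := congrArg norm h1
    simp only [norm_zpow, Complex.norm_ofNat] at h3
    exact zpow_right_injective₀ (by norm_num) (by norm_num) h3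
  have li := (linearIndependent_monoidHom (Fin n → ℂˣ) ℂ).comp ψ hψ
  -- Several `u` may share a degree, so the coefficients are collected by degree. The collected sum
  -- is zero as a formal sum, and hence so is its image under the linear extension of any function
  -- `w`.
  have h0 := linearIndependent_iff.1 li (∑ u ∈ s, Finsupp.single (deg u) (c u)) (by
    ext t
    rw [map_sum, Finset.sum_apply]
    simp only [Finsupp.linearCombination_single, Pi.smul_apply, Pi.zero_apply, smul_eq_mul]
    exact h t)
  have := congrArg (Finsupp.linearCombination ℂ w) h0
  simpa [map_sum, Finsupp.linearCombination_single] using this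

/-- The map `g` descends to the image of `f`, and injectivity of `Q` extends it to all of `M'`. -/
theorem exists_linearMap_comp_eq {R Q M M' : Type*} [Ring R] [AddCommGroup Q] [Module R Q]
    [AddCommGroup M] [Module R M] [AddCommGroup M'] [Module R M'] (hQ : Module.Baer R Q)
    (f : M →ₗ[R] M') (g : M →ₗ[R] Q) (h : LinearMap.ker f ≤ LinearMap.ker g) :
    ∃ φ : M' →ₗ[R] Q, φ ∘ₗ f = g := by
  obtain ⟨φ, hφ⟩ := hQ.extension_property (f.ker.liftQ f le_rfl)
    (LinearMap.ker_eq_bot.1 (Submodule.ker_liftQ_eq_bot _ _ _ le_rfl)) (f.ker.liftQ g h)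
  refine ⟨φ, LinearMap.ext fun x => ?_⟩
  simpa using LinearMap.congr_fun hφ (f.ker.mkQ x)

/-- Roots of all positive orders exist in `ℂˣ`, and divisible abelian groups are injective. -/
theorem Module.Baer.complex_units : Module.Baer ℤ (Additive ℂˣ) := by
  let _ : RootableBy ℂˣ ℕ := rootableByOfPowLeftSurj _ _ fun {n} hn x => by
    obtain ⟨y, hy⟩ := IsAlgClosed.exists_pow_nat_eq (x : ℂ) (Nat.pos_of_ne_zero hn)
    have hy0 : y ≠ 0 := by
      rintro rfl
      rw [zero_pow hn] at hy
      exact x.ne_zero hy.symm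
    exact ⟨Units.mk0 y hy0, Units.ext hy⟩
  let _ : DivisibleBy (Additive ℂˣ) ℕ :=
    ⟨fun a k => Additive.ofMul (RootableBy.root a.toMul k), fun a => by
      simp [RootableBy.root_zero], fun {k} a hk => by
      exact RootableBy.root_cancel (a.toMul) hk⟩
  let _ : DivisibleBy (Additive ℂˣ) ℤ := AddGroup.divisibleByIntOfDivisibleByNat _
  exact Module.Baer.of_divisible _

theorem ZarAffine.eval_X {σ : Type*} (x : ZarAffine σ) (j : σ) :
    eval (σ := σ) x (X j) = x j := MvPolynomial.eval_X j

theorem ZarAffine.eval_eq {σ : Type*} [Fintype σ] (x : ZarAffine σ) (f : MvPolynomial σ ℂ) :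
    eval (σ := σ) x f = ∑ u ∈ f.support, coeff u f * ∏ j, x j ^ u j :=
  MvPolynomial.eval_eq' (σ := σ) x f

theorem ZarAffine.eval_monomial {σ : Type*} [Fintype σ] (x : ZarAffine σ) (u : σ →₀ ℕ) (c : ℂ) :
    eval (σ := σ) x (monomial u c) = c * ∏ j, x j ^ u j :=
  (MvPolynomial.eval_monomial (σ := σ) (f := x)).trans
    (congrArg (c * ·) (Finsupp.prod_fintype _ _ fun _ => pow_zero _))

theorem ZarAffine.eval_C {σ : Type*} (x : ZarAffine σ) (c : ℂ) :
    eval (σ := σ) x (C c) = c := MvPolynomial.eval_C c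

section Torus

variable {n N : ℕ} (χ : Matrix (Fin n) (Fin N) ℤ)

/-- The value at `t` of the character by which the torus acts on the `j`-th coordinate. -/
def torusChar (t : Fin n → ℂˣ) (j : Fin N) : ℂ := ∏ i, (t i : ℂ) ^ χ i j

/-- The zeros of the binomials of `ker χ`. -/
def toricSet : Set (ZarAffine (Fin N)) :=
  {ξ | ∀ a : Fin N → ℤ, χ.mulVec a = 0 →
    ∏ j, ξ j ^ (a j).toNat = ∏ j, ξ j ^ (-a j).toNat}

variable {χ}

theorem torusChar_ne_zero (t : Fin n → ℂˣ) (j : Fin N) : torusChar χ t j ≠ 0 :=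
  Finset.prod_ne_zero_iff.2 fun i _ => zpow_ne_zero _ (t i).ne_zero

theorem torusChar_one (j : Fin N) : torusChar χ 1 j = 1 := by simp [torusChar]

theorem torusChar_mul (t t' : Fin n → ℂˣ) (j : Fin N) :
    torusChar χ (t * t') j = torusChar χ t j * torusChar χ t' j := by
  simp [torusChar, mul_zpow, Finset.prod_mul_distrib]

theorem torusChar_inv (t : Fin n → ℂˣ) (j : Fin N) :
    torusChar χ t⁻¹ j = (torusChar χ t j)⁻¹ := by
  simp [torusChar]

theorem mem_torusOrbit {p ξ : ZarAffine (Fin N)} :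
    ξ ∈ torusOrbit χ p ↔ ∃ t : Fin n → ℂˣ, ∀ j, ξ j = torusChar χ t j * p j := Iff.rfl

theorem mem_torusOrbit_self (p : ZarAffine (Fin N)) : p ∈ torusOrbit χ p :=
  mem_torusOrbit.2 ⟨1, fun j => by rw [torusChar_one, one_mul]⟩

theorem torusOrbit_subset {p ξ : ZarAffine (Fin N)} (h : ξ ∈ torusOrbit χ p) :
    torusOrbit χ ξ ⊆ torusOrbit χ p := by
  obtain ⟨t, ht⟩ := h
  rintro η ⟨t', ht'⟩
  refine mem_torusOrbit.2 ⟨t' * t, fun j => ?_⟩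
  rw [ht' j, ht j, torusChar_mul, mul_assoc]
  rfl

theorem mem_torusOrbit_symm {p ξ : ZarAffine (Fin N)} (h : ξ ∈ torusOrbit χ p) :
    p ∈ torusOrbit χ ξ := by
  obtain ⟨t, ht⟩ := mem_torusOrbit.1 h
  refine mem_torusOrbit.2 ⟨t⁻¹, fun j => ?_⟩
  rw [ht j, torusChar_inv, inv_mul_cancel_left₀ (torusChar_ne_zero t j)]

theorem torusOrbit_eq_of_mem {p ξ : ZarAffine (Fin N)} (h : ξ ∈ torusOrbit χ p) :
    torusOrbit χ ξ = torusOrbit χ p :=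
  (torusOrbit_subset h).antisymm (torusOrbit_subset (mem_torusOrbit_symm h))

theorem eq_zero_iff_of_mem_torusOrbit {p ξ : ZarAffine (Fin N)} (h : ξ ∈ torusOrbit χ p)
    (j : Fin N) : ξ j = 0 ↔ p j = 0 := by
  obtain ⟨t, ht⟩ := mem_torusOrbit.1 h
  rw [ht j, mul_eq_zero, or_iff_right (torusChar_ne_zero t j)]

theorem prod_torusChar_pow (t : Fin n → ℂˣ) (u : Fin N → ℕ) :
    ∏ j, torusChar χ t j ^ u j = ∏ i, (t i : ℂ) ^ (χ.mulVec (fun j => (u j : ℤ)) i) := by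
  simp only [torusChar, ← Finset.prod_pow]
  rw [Finset.prod_comm]
  refine Finset.prod_congr rfl fun i _ => ?_
  simp only [Matrix.mulVec, dotProduct]
  rw [zpow_sum₀ (t i).ne_zero]
  exact Finset.prod_congr rfl fun j _ => by rw [zpow_mul, zpow_natCast]

theorem mulVec_toNat {a : Fin N → ℤ} (ha : χ.mulVec a = 0) :
    χ.mulVec (fun j => (((a j).toNat : ℕ) : ℤ)) = χ.mulVec (fun j => (((-a j).toNat : ℕ) : ℤ)) := by
  rw [← sub_eq_zero, ← Matrix.mulVec_sub, ← ha]
  congr 1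
  ext j
  simp only [Pi.sub_apply]
  omega

theorem torusOrbit_subset_toricSet {p : ZarAffine (Fin N)} (hp : p ∈ toricSet χ) :
    torusOrbit χ p ⊆ toricSet χ := by
  intro ξ hξ a ha
  obtain ⟨t, ht⟩ := mem_torusOrbit.1 hξ
  simp only [ht, mul_pow, Finset.prod_mul_distrib]
  rw [hp a ha, prod_torusChar_pow, prod_torusChar_pow, mulVec_toNat ha]

/-- Removing the common monomial with exponents `min (u j) (v j)` leaves the two sides of the
binomial of `u - v ∈ ker χ`. -/
theorem prod_pow_eq_of_mem_toricSet {p : ZarAffine (Fin N)} (hp : p ∈ toricSet χ)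
    {u v : Fin N → ℕ} (h : χ.mulVec (fun j => (u j : ℤ)) = χ.mulVec (fun j => (v j : ℤ))) :
    ∏ j, p j ^ u j = ∏ j, p j ^ v j := by
  have h1 := hp (fun j => (u j : ℤ) - v j) (by
    rw [show (fun j => (u j : ℤ) - v j) = (fun j => (u j : ℤ)) - fun j => (v j : ℤ) from rfl,
      Matrix.mulVec_sub, h, sub_self])
  have h2 : ∀ j, p j ^ u j = p j ^ min (u j) (v j) * p j ^ ((u j : ℤ) - v j).toNat := fun j => by
    rw [← pow_add]
    congr 1
    omega
  have h3 : ∀ j, p j ^ v j = p j ^ min (u j) (v j) * p j ^ (-((u j : ℤ) - v j)).toNat :=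
    fun j => by
      rw [← pow_add]
      congr 1
      omega
  rw [Finset.prod_congr rfl fun j _ => h2 j, Finset.prod_congr rfl fun j _ => h3 j,
    Finset.prod_mul_distrib, Finset.prod_mul_distrib, h1]

/-- Along the orbit `f` is a combination of characters whose coefficients are its terms at `p`, so
the characters may be replaced by any function of the weight. The choices used are the values of
monomials at another point, for the closure, and a coordinate of the weight, for tangent vectors. -/
theorem sum_coeff_mul_eq_zero {p : ZarAffine (Fin N)} {f : MvPolynomial (Fin N) ℂ}
    (hf : f ∈ ZarAffine.vanishing (torusOrbit χ p)) (w : (Fin n → ℤ) → ℂ) :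
    ∑ u ∈ f.support, (coeff u f * ∏ j, p j ^ u j) * w (χ.mulVec fun j => (u j : ℤ)) = 0 := by
  refine sum_mul_eq_zero_of_characters f.support _ (fun u => χ.mulVec fun j => (u j : ℤ))
    (fun t => ?_) w
  have := ZarAffine.mem_vanishing.1 hf (fun j => torusChar χ t j * p j) ⟨t, fun j => rfl⟩
  rw [eval_eq'] at this
  rw [← this]
  refine Finset.sum_congr rfl fun u _ => ?_
  rw [← prod_torusChar_pow, mul_assoc]
  simp only [mul_pow, Finset.prod_mul_distrib]
  ring

theorem onePoint_mem_toricSet : onePoint N ∈ toricSet χ := fun a _ => by simp [onePoint]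

theorem isClosed_toricSet : IsClosed (toricSet χ) := by
  convert ZarAffine.isClosed_zeros
    {f : MvPolynomial (Fin N) ℂ | ∃ a : Fin N → ℤ, χ.mulVec a = 0 ∧
      f = ∏ j, X j ^ (a j).toNat - ∏ j, X j ^ (-a j).toNat} using 1
  ext ξ
  constructor
  · rintro h _ ⟨a, ha, rfl⟩
    simp only [map_sub, map_prod, map_pow, ZarAffine.eval_X]
    exact sub_eq_zero.2 (h a ha)
  · intro h a ha
    have := h _ ⟨a, ha, rfl⟩
    simp only [map_sub, map_prod, map_pow, ZarAffine.eval_X] at this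
    exact sub_eq_zero.1 this

/-- For a point `p` of the toric set, the value of a monomial at `p` is a well-defined function `w`
of its weight. Inserting it into the relations of a polynomial that vanishes on the orbit evaluates
this polynomial at `p`. -/
theorem closure_torusOrbit_onePoint : closure (torusOrbit χ (onePoint N)) = toricSet χ := by
  refine (closure_minimal (torusOrbit_subset_toricSet onePoint_mem_toricSet)
    isClosed_toricSet).antisymm fun p hp => ?_
  rw [ZarAffine.mem_closure_iff]
  intro f hf
  classical
  let w : (Fin n → ℤ) → ℂ := fun d =>
    if h : ∃ u : Fin N → ℕ, χ.mulVec (fun j => (u j : ℤ)) = d then ∏ j, p j ^ h.choose j else 0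
  have hw : ∀ u : Fin N → ℕ, w (χ.mulVec fun j => (u j : ℤ)) = ∏ j, p j ^ u j := fun u => by
    have h : ∃ v : Fin N → ℕ, χ.mulVec (fun j => (v j : ℤ)) = χ.mulVec (fun j => (u j : ℤ)) :=
      ⟨u, rfl⟩
    simp only [w, dif_pos h]
    exact prod_pow_eq_of_mem_toricSet hp h.choose_spec
  rw [ZarAffine.eval_eq, ← sum_coeff_mul_eq_zero hf w]
  refine Finset.sum_congr rfl fun u _ => ?_
  rw [hw]
  simp [onePoint]

theorem prod_zpow_eq_one_of_mem_toricSet {p : ZarAffine (Fin N)} (hp : p ∈ toricSet χ)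
    {a : Fin N → ℤ} (ha : χ.mulVec a = 0) (hpa : ∀ j, p j = 0 → a j = 0) :
    ∏ j, p j ^ a j = 1 := by
  have h1 : ∀ j, p j ^ (a j).toNat = p j ^ a j * p j ^ (-a j).toNat := fun j => by
    by_cases hj : p j = 0
    · simp [hpa j hj]
    · rw [← zpow_natCast, ← zpow_natCast, ← zpow_add₀ hj]
      congr 1
      omega
  have h2 := hp a ha
  rw [Finset.prod_congr rfl fun j _ => h1 j, Finset.prod_mul_distrib] at h2
  refine mul_eq_right₀ (Finset.prod_ne_zero_iff.2 fun j _ => ?_) |>.1 h2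
  by_cases hj : p j = 0
  · simp [hpa j hj]
  · exact pow_ne_zero _ hj

/-- Points of the toric variety with the same support lie in one orbit. -/
theorem mem_torusOrbit_of_mem_toricSet {p q : ZarAffine (Fin N)} (hp : p ∈ toricSet χ)
    (hq : q ∈ toricSet χ) (h : ∀ j, p j = 0 ↔ q j = 0) : q ∈ torusOrbit χ p := by
  classical
  let r : Fin N → ℂˣ := fun j =>
    if hj : p j = 0 then 1
    else Units.mk0 (q j) (fun h' => hj ((h j).2 h')) / Units.mk0 (p j) hj
  have hr : ∀ j, p j ≠ 0 → (r j : ℂ) = q j / p j := fun j hj => by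
    simp only [r, dif_neg hj, Units.val_div_eq_div_val, Units.val_mk0]
  -- The second component records the entries at vanishing coordinates, so the kernel consists of
  -- the `a ∈ ker χ` supported where `p` is nonzero. There the Laurent monomials of `p` and `q` are
  -- both `1`, so `a ↦ ∏ r j ^ a j` factors through `f`; the extension at the basis vectors of the
  -- first component is the torus element.
  let f : (Fin N → ℤ) →ₗ[ℤ] (Fin n → ℤ) × (Fin N → ℤ) :=
    χ.mulVecLin.prod (LinearMap.pi fun j => if p j = 0 then LinearMap.proj j else 0)
  let g : (Fin N → ℤ) →ₗ[ℤ] Additive ℂˣ :=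
    Fintype.linearCombination ℤ fun j => Additive.ofMul (r j)
  obtain ⟨φ, hφ⟩ := exists_linearMap_comp_eq Module.Baer.complex_units f g (by
    intro a ha
    rw [LinearMap.mem_ker] at ha ⊢
    have ha1 : χ.mulVec a = 0 := congrArg Prod.fst ha
    have ha2 : ∀ j, p j = 0 → a j = 0 := fun j hj => by
      have := congrFun (congrArg Prod.snd ha) j
      simpa [f, hj] using this
    change ∑ j, a j • Additive.ofMul (r j) = 0
    have h1 : ∏ j, r j ^ a j = 1 := by
      apply Units.ext
      push_cast
      have : ∀ j, (r j : ℂ) ^ a j = q j ^ a j / p j ^ a j := fun j => by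
        by_cases hj : p j = 0
        · simp [ha2 j hj]
        · rw [hr j hj, div_zpow]
      rw [Finset.prod_congr rfl fun j _ => this j, Finset.prod_div_distrib,
        prod_zpow_eq_one_of_mem_toricSet hp ha1 ha2,
        prod_zpow_eq_one_of_mem_toricSet hq ha1 fun j hj => ha2 j ((h j).2 hj), div_one]
    have h2 := congrArg Additive.ofMul h1
    rw [ofMul_prod] at h2
    simpa using h2)
  refine mem_torusOrbit.2 ⟨fun i => (φ (Pi.single i 1, 0)).toMul, fun j => ?_⟩
  by_cases hj : p j = 0
  · rw [(h j).1 hj, hj, mul_zero]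
  have h1 : φ (f (Pi.single j 1)) = Additive.ofMul (r j) := by
    have := LinearMap.congr_fun hφ (Pi.single j 1)
    simpa [g, Fintype.linearCombination_apply_single] using this
  have h2 : f (Pi.single j 1) = ∑ i, χ i j • ((Pi.single i 1 : Fin n → ℤ), (0 : Fin N → ℤ)) := by
    refine Prod.ext ?_ ?_
    · rw [Prod.fst_sum]
      ext i
      simp [f, Pi.single_apply, Finset.sum_apply]
    · rw [Prod.snd_sum]
      ext k
      by_cases hk : p k = 0
      · have : k ≠ j := fun h => hj (h ▸ hk)
        simp [f, hk, this]
      · simp [f, hk]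
  rw [h2, map_sum] at h1
  simp only [map_smul] at h1
  have h3 := congrArg (fun x : Additive ℂˣ => ((x.toMul : ℂˣ) : ℂ)) h1
  simp only [toMul_sum, toMul_zsmul, toMul_ofMul, Units.coe_prod, Units.val_zpow_eq_zpow_val] at h3
  rw [torusChar, h3, hr j hj, div_mul_cancel₀ _ hj]

/-- An orbit in the toric set is determined by which coordinates vanish on it. -/
theorem finite_orbitsInClosure : (orbitsInClosure χ).Finite := by
  classical
  rw [orbitsInClosure, closure_torusOrbit_onePoint]
  let Φ : Set (Fin N) → Set (ZarAffine (Fin N)) := fun J =>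
    if h : ∃ p ∈ toricSet χ, {j | p j = 0} = J then torusOrbit χ h.choose else ∅
  refine (Set.finite_range Φ).subset ?_
  rintro _ ⟨p, hp, rfl⟩
  have h : ∃ q ∈ toricSet χ, {j | q j = 0} = {j | p j = 0} := ⟨p, hp, rfl⟩
  refine ⟨{j | p j = 0}, ?_⟩
  simp only [Φ, dif_pos h]
  exact torusOrbit_eq_of_mem (mem_torusOrbit_of_mem_toricSet hp h.choose_spec.1 fun j =>
    (Set.ext_iff.1 h.choose_spec.2 j).symm)

theorem pairwiseDisjoint_orbitsInClosure : (orbitsInClosure χ).PairwiseDisjoint id := by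
  rintro _ ⟨p, -, rfl⟩ _ ⟨q, -, rfl⟩ hne
  refine Set.disjoint_left.2 fun ξ hp hq => hne ?_
  rw [← torusOrbit_eq_of_mem hp, ← torusOrbit_eq_of_mem hq]

theorem mem_biUnion_orbitsInClosure {ξ : ZarAffine (Fin N)} :
    (∃ O ∈ orbitsInClosure χ, ξ ∈ O) ↔ ξ ∈ toricSet χ := by
  rw [orbitsInClosure, closure_torusOrbit_onePoint]
  constructor
  · rintro ⟨_, ⟨p, hp, rfl⟩, hξ⟩
    exact torusOrbit_subset_toricSet hp hξ
  · exact fun h => ⟨_, ⟨ξ, h, rfl⟩, mem_torusOrbit_self ξ⟩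

theorem closure_eq_biUnion_orbitsInClosure :
    closure (torusOrbit χ (onePoint N)) = ⋃ O ∈ orbitsInClosure χ, O := by
  ext ξ
  rw [closure_torusOrbit_onePoint, ← mem_biUnion_orbitsInClosure]
  simp

end Torus

/-! ### Conormal bundles of torus orbits -/

/-- Tangent vectors of the form `w j * x j` involve only the Euler operators `x_j ∂_j`, for which
monomials are eigenvectors. -/
theorem sum_pderiv_monomial {N : ℕ} (x : ZarAffine (Fin N)) (w : Fin N → ℂ) (u : Fin N →₀ ℕ)
    (c : ℂ) :
    ∑ j, eval (σ := Fin N) x (pderiv j (monomial u c)) * (w j * x j) =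
      (c * ∏ j, x j ^ u j) * ∑ j, (u j : ℂ) * w j := by
  have h : ∀ j, eval (σ := Fin N) x (pderiv j (monomial u c)) * x j =
      (u j : ℂ) * (c * ∏ j, x j ^ u j) := fun j => by
    rw [← ZarAffine.eval_X x j, ← map_mul, mul_comm, X_mul_pderiv_monomial, nsmul_eq_mul, map_mul,
      map_natCast, ZarAffine.eval_monomial]
  rw [Finset.mul_sum]
  refine Finset.sum_congr rfl fun j _ => ?_
  linear_combination w j * h j

theorem sum_pderiv {N : ℕ} (x : ZarAffine (Fin N)) (w : Fin N → ℂ) (f : MvPolynomial (Fin N) ℂ) :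
    ∑ j, eval (σ := Fin N) x (pderiv j f) * (w j * x j) =
      ∑ u ∈ f.support, (coeff u f * ∏ j, x j ^ u j) * ∑ j, (u j : ℂ) * w j := by
  conv_lhs => rw [f.as_sum]
  simp only [map_sum, Finset.sum_mul]
  rw [Finset.sum_comm]
  exact Finset.sum_congr rfl fun u _ => sum_pderiv_monomial x w u _

/-- A linear form that vanishes on the integral solutions of an integral linear system vanishes on
the complex solutions. -/
theorem sum_mul_eq_zero_of_integral_kernel {n N : ℕ} {χ : Matrix (Fin n) (Fin N) ℤ}
    {ζ w : Fin N → ℂ} (hζ : ∀ i, ∑ j, (χ i j : ℂ) * ζ j = 0)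
    (hw : ∀ a : Fin N → ℤ, χ.mulVec a = 0 → (∀ j, ζ j = 0 → a j = 0) → ∑ j, (a j : ℂ) * w j = 0) :
    ∑ j, ζ j * w j = 0 := by
  -- In a `ℚ`-basis of the span of its entries, `ζ` becomes a combination of rational solutions of
  -- the same system, each vanishing wherever `ζ` does. Clearing denominators makes them integral.
  let W : Submodule ℚ ℂ := Submodule.span ℚ (Set.range ζ)
  have : FiniteDimensional ℚ W := FiniteDimensional.span_of_finite ℚ (Set.finite_range ζ)
  let b := Module.finBasis ℚ W
  let y : Fin N → W := fun j => ⟨ζ j, Submodule.subset_span ⟨j, rfl⟩⟩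
  have hy : ∀ j, ζ j = ∑ k, (b.repr (y j) k : ℂ) * (b k : ℂ) := fun j => by
    have := congrArg (Submodule.subtype W) (b.sum_repr (y j))
    rw [map_sum] at this
    simp only [map_smul, Submodule.subtype_apply, Rat.smul_def] at this
    exact this.symm
  have hk : ∀ k, ∑ j, (b.repr (y j) k : ℂ) * w j = 0 := fun k => by
    obtain ⟨D, hD⟩ := IsLocalization.exist_integer_multiples_of_finite (nonZeroDivisors ℤ)
      (fun j => b.repr (y j) k)
    choose a ha using hD
    have ha' : ∀ j, (a j : ℚ) = (D : ℤ) * b.repr (y j) k := fun j => by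
      simpa [Algebra.smul_def] using ha j
    have hD0 : ((D : ℤ) : ℂ) ≠ 0 := by
      exact_mod_cast nonZeroDivisors.ne_zero D.2
    have h1 : χ.mulVec a = 0 := by
      ext i
      have h2 : ∑ j, (χ i j : ℚ) • y j = 0 := by
        apply Subtype.ext
        rw [← Submodule.subtype_apply, map_sum]
        simp only [map_smul, Submodule.subtype_apply, Rat.smul_def, ZeroMemClass.coe_zero,
          Rat.cast_intCast]
        exact hζ i
      have h3 := congrArg (fun v => b.repr v k) h2
      simp only [map_sum, map_smul, Finsupp.coe_finsetSum, Finset.sum_apply, Finsupp.smul_apply,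
        smul_eq_mul, map_zero, Finsupp.zero_apply] at h3
      have h4 : ((χ.mulVec a i : ℤ) : ℚ) = 0 := by
        simp only [Matrix.mulVec, dotProduct, Int.cast_sum, Int.cast_mul, ha']
        calc ∑ j, (χ i j : ℚ) * ((D : ℤ) * b.repr (y j) k)
            = (D : ℤ) * ∑ j, (χ i j : ℚ) * b.repr (y j) k := by
              rw [Finset.mul_sum]
              exact Finset.sum_congr rfl fun j _ => by ring
          _ = 0 := by rw [h3, mul_zero]
      exact_mod_cast h4
    have h5 := hw a h1 fun j hj => by
      have : y j = 0 := Subtype.ext hj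
      have h6 := ha' j
      rw [this, map_zero, Finsupp.zero_apply, mul_zero] at h6
      exact_mod_cast h6
    have h7 : ∀ j, (a j : ℂ) = (D : ℤ) * (b.repr (y j) k : ℂ) := fun j => by
      have := congrArg (Rat.cast : ℚ → ℂ) (ha' j)
      push_cast at this
      exact this
    simp only [h7, mul_assoc] at h5
    rw [← Finset.mul_sum] at h5
    exact (mul_eq_zero.1 h5).resolve_left hD0
  calc ∑ j, ζ j * w j = ∑ j, ∑ k, (b k : ℂ) * ((b.repr (y j) k : ℂ) * w j) :=
        Finset.sum_congr rfl fun j _ => by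
          conv_lhs => rw [hy j]
          rw [Finset.sum_mul]
          exact Finset.sum_congr rfl fun k _ => by ring
    _ = ∑ k, (b k : ℂ) * ∑ j, (b.repr (y j) k : ℂ) * w j := by
        rw [Finset.sum_comm]
        exact Finset.sum_congr rfl fun k _ => by rw [Finset.mul_sum]
    _ = 0 := Finset.sum_eq_zero fun k _ => by rw [hk k, mul_zero]

section Torus

variable {n N : ℕ} {χ : Matrix (Fin n) (Fin N) ℤ}

/-- The infinitesimal torus action is tangent to the orbit: differentiating `f` along it multiplies
the terms of weight `d` by `d i`, a function of the weight. -/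
theorem mem_zarTangent_torusOrbit (p : ZarAffine (Fin N)) (i : Fin n) :
    (fun j => (χ i j : ℂ) * p j) ∈ zarTangent (torusOrbit χ p) p := by
  intro f hf
  rw [sum_pderiv p (fun j => (χ i j : ℂ)),
    ← sum_coeff_mul_eq_zero (ZarAffine.mem_vanishing.2 hf) fun d => (d i : ℂ)]
  refine Finset.sum_congr rfl fun u _ => ?_
  simp only [Matrix.mulVec, dotProduct]
  push_cast
  congr 1
  exact Finset.sum_congr rfl fun j _ => mul_comm _ _

theorem eq_zero_of_mem_zarTangent {p : ZarAffine (Fin N)} {v : Fin N → ℂ}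
    (hv : v ∈ zarTangent (torusOrbit χ p) p) {j : Fin N} (hj : p j = 0) : v j = 0 := by
  have := hv (X j) fun y hy => by
    rw [ZarAffine.eval_X]
    exact (eq_zero_iff_of_mem_torusOrbit hy j).2 hj
  rw [Finset.sum_eq_single j] at this
  · simpa using this
  · intro k _ hk
    rw [pderiv_X_of_ne hk.symm, map_zero, zero_mul]
  · simp

/-- This is the logarithmic derivative at `p` of the relation `∏ ξ_j ^ a_j = 1`, obtained by
differentiating the binomial and cancelling the common nonzero value of its two monomials. -/
theorem sum_div_eq_zero_of_mem_zarTangent {p : ZarAffine (Fin N)} (hp : p ∈ toricSet χ)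
    {v : Fin N → ℂ} (hv : v ∈ zarTangent (torusOrbit χ p) p) {a : Fin N → ℤ}
    (ha : χ.mulVec a = 0) (hpa : ∀ j, p j = 0 → a j = 0) :
    ∑ j, (a j : ℂ) * (v j / p j) = 0 := by
  have hv' : ∀ j, v j = v j / p j * p j := fun j => by
    by_cases hj : p j = 0
    · rw [eq_zero_of_mem_zarTangent hv hj, zero_div, zero_mul]
    · rw [div_mul_cancel₀ _ hj]
  let u : Fin N →₀ ℕ := Finsupp.equivFunOnFinite.symm fun j => (a j).toNat
  let u' : Fin N →₀ ℕ := Finsupp.equivFunOnFinite.symm fun j => (-a j).toNat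
  have hu : ∏ j, p j ^ u j = ∏ j, p j ^ u' j := hp a ha
  have h := hv (monomial u 1 - monomial u' 1) fun y hy => by
    have := torusOrbit_subset_toricSet hp hy a ha
    rw [map_sub, ZarAffine.eval_monomial, ZarAffine.eval_monomial, one_mul, one_mul]
    exact sub_eq_zero.2 this
  simp only [map_sub, sub_mul, Finset.sum_sub_distrib] at h
  rw [Finset.sum_congr rfl fun j _ => congrArg (eval p (pderiv j (monomial u (1 : ℂ))) * ·) (hv' j),
    Finset.sum_congr rfl fun j _ => congrArg (eval p (pderiv j (monomial u' (1 : ℂ))) * ·) (hv' j),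
    sum_pderiv_monomial, sum_pderiv_monomial, ← hu, ← mul_sub, ← Finset.sum_sub_distrib] at h
  have h0 : (1 : ℂ) * ∏ j, p j ^ u j ≠ 0 := by
    rw [one_mul]
    refine Finset.prod_ne_zero_iff.2 fun j _ => ?_
    by_cases hj : p j = 0
    · simp [u, hpa j hj]
    · exact pow_ne_zero _ hj
  rw [← (mul_eq_zero.1 h).resolve_left h0]
  refine Finset.sum_congr rfl fun j _ => ?_
  rw [← sub_mul]
  congr 1
  have : a j = (u j : ℤ) - u' j := by
    simp only [u, u', Finsupp.equivFunOnFinite_symm_apply_apply]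
    omega
  rw [this]
  push_cast
  rfl

/-- The equations are necessary because the infinitesimal torus action is tangent. Conversely, `ζ_j
= z_j ξ_j` solves the integral system `χ ζ = 0`, while `v_j / ξ_j` is orthogonal to the integral
solutions supported where `ζ` is nonzero; so it is orthogonal to `ζ`, which says that the covector
kills `v`. -/
theorem mem_conormalBundle_iff {p : ZarAffine (Fin N)} (hp : p ∈ toricSet χ)
    {x : ZarAffine (PhaseIdx N)} :
    x ∈ conormalBundle (torusOrbit χ p) ↔ (fun j => x (Sum.inr j)) ∈ torusOrbit χ p ∧
      ∀ i, ∑ j, (χ i j : ℂ) * (x (Sum.inl j) * x (Sum.inr j)) = 0 := by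
  refine and_congr_right fun hx => ?_
  have hq := torusOrbit_subset_toricSet hp hx
  rw [← torusOrbit_eq_of_mem hx]
  set q : ZarAffine (Fin N) := fun j => x (Sum.inr j) with hqdef
  constructor
  · intro h i
    rw [← h _ (mem_zarTangent_torusOrbit q i)]
    exact Finset.sum_congr rfl fun j _ => by ring
  · intro h v hv
    rw [← sum_mul_eq_zero_of_integral_kernel (ζ := fun j => x (Sum.inl j) * x (Sum.inr j))
      (w := fun j => v j / q j) h fun a ha haz =>
        sum_div_eq_zero_of_mem_zarTangent hq hv ha fun j hj => haz j (by
          rw [show x (Sum.inr j) = 0 from hj, mul_zero])]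
    refine Finset.sum_congr rfl fun j _ => ?_
    by_cases hj : q j = 0
    · rw [eq_zero_of_mem_zarTangent hv hj, zero_div, mul_zero, mul_zero]
    · rw [mul_assoc, show x (Sum.inr j) = q j from rfl, mul_div_cancel₀ _ hj]

/-! ### Disjointness of the conormal bundles and the support of the symbol ring. -/

theorem pairwiseDisjoint_conormalBundle :
    (orbitsInClosure χ).PairwiseDisjoint conormalBundle := by
  intro O hO O' hO' hne
  exact Set.disjoint_left.2 fun x hx hx' =>
    Set.disjoint_left.1 (pairwiseDisjoint_orbitsInClosure hO hO' hne) hx.1 hx'.1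

theorem eval_thetaBar (x : ZarAffine (PhaseIdx N)) (i : Fin n) :
    eval (σ := PhaseIdx N) x (thetaBar χ i) =
      ∑ j, (χ i j : ℂ) * (x (Sum.inl j) * x (Sum.inr j)) := by
  simp only [thetaBar, map_sum, map_mul, ZarAffine.eval_C, ZarAffine.eval_X, mul_assoc]

theorem eval_xiBox (x : ZarAffine (PhaseIdx N)) (a : Fin N → ℤ) :
    eval (σ := PhaseIdx N) x (xiBox a) =
      ∏ j, x (Sum.inr j) ^ (a j).toNat - ∏ j, x (Sum.inr j) ^ (-a j).toNat := by
  simp only [xiBox, map_sub, map_prod, map_pow, ZarAffine.eval_X]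

theorem mem_zeros_symbolIdeal {x : ZarAffine (PhaseIdx N)} :
    (∀ f ∈ symbolIdeal χ, eval (σ := PhaseIdx N) x f = 0) ↔
      ∃ O ∈ orbitsInClosure χ, x ∈ conormalBundle O := by
  have h1 : (∀ f ∈ symbolIdeal χ, eval (σ := PhaseIdx N) x f = 0) ↔
      (fun j => x (Sum.inr j)) ∈ toricSet χ ∧
        ∀ i, ∑ j, (χ i j : ℂ) * (x (Sum.inl j) * x (Sum.inr j)) = 0 := by
    constructor
    · intro h
      refine ⟨fun a ha => ?_, fun i => ?_⟩
      · have := h (xiBox a) (Ideal.subset_span (Or.inr ⟨a, ha, rfl⟩))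
        rwa [eval_xiBox, sub_eq_zero] at this
      · rw [← eval_thetaBar]
        exact h _ (Ideal.subset_span (Or.inl ⟨i, rfl⟩))
    · rintro ⟨h, h'⟩ f hf
      refine (Ideal.span_le (I := RingHom.ker (eval (σ := PhaseIdx N) x))).2 ?_ hf
      rintro _ (⟨i, rfl⟩ | ⟨a, ha, rfl⟩)
      · exact (eval_thetaBar x i).trans (h' i)
      · exact (eval_xiBox x a).trans (sub_eq_zero.2 (h a ha))
  rw [h1]
  constructor
  · rintro ⟨h, h'⟩
    obtain ⟨_, ⟨p, hp, rfl⟩, hx⟩ := mem_biUnion_orbitsInClosure.2 h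
    refine ⟨_, ⟨p, hp, rfl⟩, ?_⟩
    rw [closure_torusOrbit_onePoint] at hp
    exact (mem_conormalBundle_iff hp).2 ⟨hx, h'⟩
  · rintro ⟨_, ⟨p, hp, rfl⟩, hx⟩
    rw [closure_torusOrbit_onePoint] at hp
    obtain ⟨h, h'⟩ := (mem_conormalBundle_iff hp).1 hx
    exact ⟨torusOrbit_subset_toricSet hp h, h'⟩

theorem affineSupport_symbolRing :
    affineSupport (SymbolRing χ) = ⋃ O ∈ orbitsInClosure χ, conormalBundle O := by
  ext x
  simp only [Set.mem_iUnion, exists_prop]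
  rw [← mem_zeros_symbolIdeal]
  change x.toSpec ∈ Module.support _ (SymbolRing χ) ↔ _
  rw [Module.support_eq_zeroLocus, Ideal.annihilator_quotient, PrimeSpectrum.mem_zeroLocus]
  exact forall₂_congr fun f _ =>
    MvPolynomial.mem_vanishingIdeal_singleton_iff (k := ℂ) (K := ℂ) (σ := PhaseIdx N) x f

/-! ### Irreducibility of the conormal bundles by means of entire curves. -/

theorem exists_curve_conormalBundle {p : ZarAffine (Fin N)} (hp : p ∈ toricSet χ)
    {x y : ZarAffine (PhaseIdx N)} (hx : x ∈ conormalBundle (torusOrbit χ p))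
    (hy : y ∈ conormalBundle (torusOrbit χ p)) :
    ∃ γ : PhaseIdx N → ℂ → ℂ, (∀ k, Differentiable ℂ (γ k)) ∧ (∀ k, γ k 0 = x k) ∧
      (∀ k, γ k 1 = y k) ∧ ∀ s, (fun k => γ k s) ∈ conormalBundle (torusOrbit χ p) := by
  rw [mem_conormalBundle_iff hp] at hx hy
  obtain ⟨t, ht⟩ := mem_torusOrbit.1 ((torusOrbit_eq_of_mem hx.1).symm ▸ hy.1)
  have hu : ∀ i, ∃ u, Complex.exp u = t i := fun i => ⟨_, Complex.exp_log (t i).ne_zero⟩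
  choose u hu using hu
  let e : Fin N → ℂ := fun j => ∑ i, (χ i j : ℂ) * u i
  have he : ∀ (s : ℂ) j, torusChar χ (fun i => Units.mk0 _ (Complex.exp_ne_zero (s * u i))) j =
      Complex.exp (s * e j) := fun s j => by
    simp only [torusChar, Units.val_mk0, e, Finset.mul_sum, Complex.exp_sum]
    refine Finset.prod_congr rfl fun i _ => ?_
    rw [← Complex.exp_int_mul]
    congr 1
    ring
  have he1 : ∀ j, y (Sum.inr j) = Complex.exp (e j) * x (Sum.inr j) := fun j => by
    have h1 := ht j
    have h2 := he 1 j
    simp only [one_mul] at h2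
    rw [← h2]
    rw [h1]
    congr 2
    ext i
    simp [hu]
  -- The `ξ`-part moves along a complex one-parameter subgroup of the torus, and the `z`-part is
  -- chosen so that each product `z_j ξ_j` interpolates its end values affinely in `s`. The
  -- equations `θ̄_i = 0` are linear in these products, so they persist.
  let γ : PhaseIdx N → ℂ → ℂ := Sum.elim
    (fun j s => Complex.exp (-(s * e j)) *
      ((1 - s) * x (Sum.inl j) + s * (y (Sum.inl j) * Complex.exp (e j))))
    (fun j s => Complex.exp (s * e j) * x (Sum.inr j))
  refine ⟨γ, ?_, ?_, ?_, ?_⟩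
  · rintro (j | j)
    · exact (by fun_prop : Differentiable ℂ fun s => Complex.exp (-(s * e j)) *
        ((1 - s) * x (Sum.inl j) + s * (y (Sum.inl j) * Complex.exp (e j))))
    · exact (by fun_prop : Differentiable ℂ fun s => Complex.exp (s * e j) * x (Sum.inr j))
  · rintro (j | j) <;> simp [γ]
  · rintro (j | j)
    · simp only [γ, Sum.elim_inl, one_mul, sub_self, zero_mul, zero_add]
      rw [mul_left_comm, ← Complex.exp_add, neg_add_cancel, Complex.exp_zero, mul_one]
    · simp [γ, he1]
  · intro s
    refine (mem_conormalBundle_iff (x := fun k => γ k s) hp).2 ⟨?_, fun i => ?_⟩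
    · rw [← torusOrbit_eq_of_mem hx.1]
      exact mem_torusOrbit.2 ⟨_, fun j => by rw [he s j]; rfl⟩
    · have h : ∀ j, γ (Sum.inl j) s * γ (Sum.inr j) s =
          (1 - s) * (x (Sum.inl j) * x (Sum.inr j)) + s * (y (Sum.inl j) * y (Sum.inr j)) :=
        fun j => by
          have h0 : Complex.exp (-(s * e j)) * Complex.exp (s * e j) = 1 := by
            rw [← Complex.exp_add, neg_add_cancel, Complex.exp_zero]
          simp only [γ, Sum.elim_inl, Sum.elim_inr]
          rw [he1 j]
          linear_combination ((1 - s) * x (Sum.inl j) +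
            s * (y (Sum.inl j) * Complex.exp (e j))) * x (Sum.inr j) * h0
      calc ∑ j, (χ i j : ℂ) * (γ (Sum.inl j) s * γ (Sum.inr j) s)
          = (1 - s) * ∑ j, (χ i j : ℂ) * (x (Sum.inl j) * x (Sum.inr j)) +
            s * ∑ j, (χ i j : ℂ) * (y (Sum.inl j) * y (Sum.inr j)) := by
            rw [Finset.mul_sum, Finset.mul_sum, ← Finset.sum_add_distrib]
            exact Finset.sum_congr rfl fun j _ => by rw [h j]; ring
        _ = 0 := by rw [hx.2 i, hy.2 i, mul_zero, mul_zero, add_zero]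

/-- Polynomials restrict to entire functions of one variable along such a curve, and these have no
zero divisors by the identity theorem. A curve joining a point where `f` is nonzero to one where `g`
is nonzero shows that `f g` does not vanish on `S`. -/
theorem ZarAffine.isPrime_vanishing_of_curves {σ : Type*} [Fintype σ] {S : Set (ZarAffine σ)}
    (hne : S.Nonempty)
    (h : ∀ x ∈ S, ∀ y ∈ S, ∃ γ : σ → ℂ → ℂ, (∀ k, Differentiable ℂ (γ k)) ∧ (∀ k, γ k 0 = x k) ∧
      (∀ k, γ k 1 = y k) ∧ ∀ s, (fun k => γ k s) ∈ S) : (ZarAffine.vanishing S).IsPrime := by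
  refine ⟨fun htop => ?_, fun {f g} hfg => ?_⟩
  · obtain ⟨x, hx⟩ := hne
    have : (1 : MvPolynomial σ ℂ) ∈ ZarAffine.vanishing S := htop ▸ Submodule.mem_top
    simpa using ZarAffine.mem_vanishing.1 this x hx
  · by_contra! hc
    rw [ZarAffine.mem_vanishing, ZarAffine.mem_vanishing] at hc
    push Not at hc
    obtain ⟨⟨x, hx, hfx⟩, ⟨y, hy, hgy⟩⟩ := hc
    obtain ⟨γ, hγ, h0, h1, hS⟩ := h x hx y hy
    have hd : ∀ f : MvPolynomial σ ℂ, AnalyticOnNhd ℂ (fun s => eval (fun k => γ k s) f)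
        Set.univ := fun f => by
      refine (DifferentiableOn.analyticOnNhd (Differentiable.differentiableOn ?_) isOpen_univ)
      simp only [eval_eq']
      fun_prop
    rcases (hd f).eq_zero_or_eq_zero_of_mul_eq_zero (hd g) (fun s _ => by
      rw [← map_mul]
      exact ZarAffine.mem_vanishing.1 hfg _ (hS s)) isPreconnected_univ with h2 | h2
    · exact hfx (by simpa [h0] using h2 0 (Set.mem_univ _))
    · exact hgy (by simpa [h1] using h2 1 (Set.mem_univ _))

theorem isPrime_vanishing_conormalBundle {p : ZarAffine (Fin N)} (hp : p ∈ toricSet χ) :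
    (ZarAffine.vanishing (conormalBundle (torusOrbit χ p))).IsPrime :=
  ZarAffine.isPrime_vanishing_of_curves
    ⟨(Sum.elim 0 p : PhaseIdx N → ℂ), (mem_conormalBundle_iff hp).2
      ⟨mem_torusOrbit_self p, fun i => Finset.sum_eq_zero fun j _ =>
        (congrArg ((χ i j : ℂ) * ·) (zero_mul (p j))).trans (mul_zero _)⟩⟩
    fun _ hx _ hy => exists_curve_conormalBundle hp hx hy

end Torus

/-! ### Isotropic coordinates on a conormal bundle -/

/-- `J₀` indexes a basis of the rational span of the columns in `J`. Spanning, with denominators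
cleared, gives the relations that determine the other `ξ_k`; independence gives functionals that
isolate one column and so solve for one `z_j`. -/
theorem exists_independent_columns {n N : ℕ} (χ : Matrix (Fin n) (Fin N) ℤ) (J : Set (Fin N)) :
    ∃ J₀ ⊆ J,
      (∀ k ∈ J, ∃ m : ℕ, 0 < m ∧ ∃ b : Fin N → ℤ, (∀ j, j ∉ J₀ → b j = 0) ∧
        χ.mulVec b = fun i => (m : ℤ) * χ i k) ∧
      ∀ j ∈ J₀, ∃ φ : Fin n → ℚ, ∑ i, φ i * χ i j ≠ 0 ∧
        ∀ k ∈ J₀, k ≠ j → ∑ i, φ i * χ i k = 0 := by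
  let v : Fin N → Fin n → ℚ := fun j i => χ i j
  obtain ⟨J₀, hJ₀, -, hspan, hli⟩ := exists_linearIndepOn_extension (K := ℚ) (v := v)
    (linearIndepOn_empty ℚ v) (Set.empty_subset J)
  refine ⟨J₀, hJ₀, fun k hk => ?_, fun j hj => ?_⟩
  · obtain ⟨l, hl, hlk⟩ := (Finsupp.mem_span_image_iff_linearCombination ℚ).1
      (hspan ⟨k, hk, rfl⟩)
    obtain ⟨D, hD⟩ := IsLocalization.exist_integer_multiples_of_finite (nonZeroDivisors ℤ)
      (fun j => l j)
    choose a ha using hD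
    have ha' : ∀ j, (a j : ℚ) = (D : ℤ) * l j := fun j => by
      simpa [Algebra.smul_def] using ha j
    have hD0 : (D : ℤ) ≠ 0 := nonZeroDivisors.ne_zero D.2
    -- The common denominator `D` may be negative; its sign is moved into the coefficients.
    refine ⟨(D : ℤ).natAbs, Int.natAbs_pos.2 hD0, fun j => (D : ℤ).sign * a j, fun j hj => ?_, ?_⟩
    · have h1 : l j = 0 := Finsupp.notMem_support_iff.1 fun h => hj (hl h)
      have h2 := ha' j
      rw [h1, mul_zero] at h2
      simp only [show a j = 0 by exact_mod_cast h2, mul_zero]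
    · ext i
      have h1 : ∑ j, l j * (χ i j : ℚ) = χ i k := by
        rw [Finsupp.linearCombination_apply, 
          Finsupp.sum_fintype _ (fun j (r : ℚ) => r • v j) fun _ => zero_smul _ _] at hlk
        simpa [Finset.sum_apply, v] using congrFun hlk i
      have h2 : ∑ j, a j * χ i j = (D : ℤ) * χ i k := by
        have : ∑ j, (a j : ℚ) * χ i j = (D : ℤ) * χ i k := by
          rw [← h1, Finset.mul_sum]
          exact Finset.sum_congr rfl fun j _ => by rw [ha', mul_assoc]
        exact_mod_cast this
      simp only [Matrix.mulVec, dotProduct]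
      calc ∑ j, χ i j * ((D : ℤ).sign * a j) = (D : ℤ).sign * ∑ j, a j * χ i j := by
            rw [Finset.mul_sum]
            exact Finset.sum_congr rfl fun j _ => by ring
        _ = _ := by rw [h2, ← mul_assoc, Int.sign_mul_self_eq_natAbs]
  · obtain ⟨f, hf, hle⟩ := Submodule.exists_le_ker_of_notMem
      (linearIndepOn_iff_notMem_span.1 hli j hj)
    have hf' : ∀ k, f (v k) = ∑ i, f (Pi.single i 1) * χ i k := fun k => by
      rw [LinearMap.pi_apply_eq_sum_univ f (v k)]
      refine Finset.sum_congr rfl fun i _ => ?_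
      rw [smul_eq_mul, mul_comm]
      congr 2
      ext k
      rw [Pi.single_apply]
      exact if_congr eq_comm rfl rfl
    refine ⟨fun i => f (Pi.single i 1), by rwa [← hf'], fun k hk hkj => ?_⟩
    rw [← hf']
    exact hle (Submodule.subset_span ⟨k, ⟨hk, hkj⟩, rfl⟩)

/-- Binomials make every `ξ_k` algebraic over the `ξ_j` with `j ∈ J₀`; then the equations `θ̄_i = 0`
make the remaining `z_j` algebraic. Both steps divide by coordinates `ξ_j` with `j ∈ J`, which are
nonzero in the domain `Q`. -/
theorem isAlgebraic_of_conormal_relations {n N : ℕ} {χ : Matrix (Fin n) (Fin N) ℤ}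
    {Q : Type*} [CommRing Q] [IsDomain Q] [Algebra ℂ Q] {J J₀ : Set (Fin N)} (hJ₀ : J₀ ⊆ J)
    (hspan : ∀ k ∈ J, ∃ m : ℕ, 0 < m ∧ ∃ b : Fin N → ℤ, (∀ j, j ∉ J₀ → b j = 0) ∧
        χ.mulVec b = fun i => (m : ℤ) * χ i k)
    (hdual : ∀ j ∈ J₀, ∃ φ : Fin n → ℚ, ∑ i, φ i * χ i j ≠ 0 ∧
        ∀ k ∈ J₀, k ≠ j → ∑ i, φ i * χ i k = 0)
    {x : PhaseIdx N → Q} (hgen : Algebra.adjoin ℂ (Set.range x) = ⊤)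
    (hzero : ∀ j, j ∉ J → x (Sum.inr j) = 0) (hne : ∀ j ∈ J, x (Sum.inr j) ≠ 0)
    (hbox : ∀ a : Fin N → ℤ, χ.mulVec a = 0 →
      ∏ j, x (Sum.inr j) ^ (a j).toNat = ∏ j, x (Sum.inr j) ^ (-a j).toNat)
    (htheta : ∀ i, ∑ j, algebraMap ℂ Q (χ i j) * (x (Sum.inl j) * x (Sum.inr j)) = 0)
    {c : Fin N → PhaseIdx N} (hc : ∀ j ∈ J₀, c j = Sum.inr j)
    (hc' : ∀ j, j ∉ J₀ → c j = Sum.inl j) :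
    Algebra.IsAlgebraic (Algebra.adjoin ℂ (Set.range fun j => x (c j))) Q := by
  classical
  set A := Algebra.adjoin ℂ (Set.range fun j => x (c j)) with hA
  have hcA : ∀ j, x (c j) ∈ A := fun j => Algebra.subset_adjoin ⟨j, rfl⟩
  have halgA : ∀ y ∈ A, IsAlgebraic A y := fun y hy => isAlgebraic_algebraMap (⟨y, hy⟩ : A)
  have hrA : ∀ j ∈ J₀, x (Sum.inr j) ∈ A := fun j hj => hc j hj ▸ hcA j
  have hlA : ∀ j, j ∉ J₀ → x (Sum.inl j) ∈ A := fun j hj => hc' j hj ▸ hcA j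
  have hr : ∀ j, IsAlgebraic A (x (Sum.inr j)) := by
    intro k
    by_cases hkJ : k ∈ J
    swap
    · rw [hzero k hkJ]
      exact isAlgebraic_zero
    by_cases hk : k ∈ J₀
    · exact halgA _ (hrA k hk)
    obtain ⟨m, hm, b, hb, hbk⟩ := hspan k hkJ
    -- The binomial of `m e_k - b`, with `b` supported on `J₀`, expresses `ξ_k ^ m` times a monomial
    -- in the `J₀`-coordinates as another such monomial.
    have h1 := hbox (m • Pi.single k 1 - b) (by
      rw [Matrix.mulVec_sub, hbk, Matrix.mulVec_smul]
      ext i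
      simp)
    have hbk0 : b k = 0 := hb k hk
    have h2 : ∀ a : Fin N → ℕ, (∀ j, j ≠ k → j ∉ J₀ → a j = 0) →
        ∏ j ∈ Finset.univ.erase k, x (Sum.inr j) ^ a j ∈ A := fun a ha => by
      refine Subalgebra.prod_mem _ fun j hj => ?_
      by_cases hj0 : j ∈ J₀
      · exact Subalgebra.pow_mem _ (hrA j hj0) _
      · rw [ha j (Finset.ne_of_mem_erase hj) hj0, pow_zero]
        exact Subalgebra.one_mem _
    have h3 : ∀ j, j ≠ k → (m • Pi.single k 1 - b : Fin N → ℤ) j = - b j := fun j hj => by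
      simp [hj]
    have h4 : (m • Pi.single k 1 - b : Fin N → ℤ) k = m := by simp [hbk0]
    rw [← Finset.mul_prod_erase _ _ (Finset.mem_univ k),
      ← Finset.mul_prod_erase _ (fun j => _ ^ (-_ : ℤ).toNat) (Finset.mem_univ k)] at h1
    rw [h4] at h1
    simp only [Int.toNat_natCast, Int.toNat_neg_natCast, pow_zero, one_mul] at h1
    refine IsAlgebraic.of_pow hm (IsAlgebraic.of_mul
      (y := ∏ j ∈ Finset.univ.erase k, x (Sum.inr j) ^
        ((m • Pi.single k 1 - b : Fin N → ℤ) j).toNat) (mem_nonZeroDivisors_of_ne_zero ?_)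
      (halgA _ (h2 _ fun j hjk hj => by rw [h3 j hjk, hb j hj]; rfl)) ?_)
    · refine Finset.prod_ne_zero_iff.2 fun j hj => ?_
      by_cases hj0 : j ∈ J₀
      · exact pow_ne_zero _ (hne j (hJ₀ hj0))
      · rw [h3 j (Finset.ne_of_mem_erase hj), hb j hj0, neg_zero, Int.toNat_zero, pow_zero]
        exact one_ne_zero
    · rw [mul_comm, h1]
      exact halgA _ (h2 _ fun j hjk hj => by rw [h3 j hjk, hb j hj]; rfl)
  have hl : ∀ j, IsAlgebraic A (x (Sum.inl j)) := by
    intro j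
    by_cases hj : j ∈ J₀
    swap
    · exact halgA _ (hlA j hj)
    -- The combination of the `θ̄_i` with coefficients `φ` contains `z_j ξ_j` and otherwise only
    -- terms with index outside `J₀`, whose `z`-coordinates belong to `A`.
    obtain ⟨φ, hφj, hφ⟩ := hdual j hj
    let e : Fin N → ℚ := fun k => ∑ i, φ i * χ i k
    have h1 : ∑ k, algebraMap ℂ Q (e k) * (x (Sum.inl k) * x (Sum.inr k)) = 0 := by
      calc ∑ k, algebraMap ℂ Q (e k) * (x (Sum.inl k) * x (Sum.inr k))
          = ∑ i, algebraMap ℂ Q (φ i) *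
              ∑ k, algebraMap ℂ Q (χ i k) * (x (Sum.inl k) * x (Sum.inr k)) := by
            simp only [e, Finset.mul_sum]
            rw [Finset.sum_comm]
            refine Finset.sum_congr rfl fun k _ => ?_
            rw [Rat.cast_sum, map_sum, Finset.sum_mul]
            exact Finset.sum_congr rfl fun i _ => by
              rw [Rat.cast_mul, Rat.cast_intCast, map_mul, mul_assoc]
        _ = 0 := Finset.sum_eq_zero fun i _ => by rw [htheta i, mul_zero]
    rw [← Finset.add_sum_erase _ _ (Finset.mem_univ j)] at h1
    have h2 : IsAlgebraic A (∑ k ∈ Finset.univ.erase j,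
        algebraMap ℂ Q (e k) * (x (Sum.inl k) * x (Sum.inr k))) := by
      refine Finset.sum_induction _ (IsAlgebraic A) (fun _ _ => IsAlgebraic.add) isAlgebraic_zero
        fun k hk => ?_
      by_cases hk0 : k ∈ J₀
      · rw [show e k = 0 from hφ k hk0 (Finset.ne_of_mem_erase hk), Rat.cast_zero, map_zero,
          zero_mul]
        exact isAlgebraic_zero
      · exact (halgA _ (Subalgebra.algebraMap_mem _ _)).mul ((halgA _ (hlA k hk0)).mul (hr k))
    have hej : (e j : ℂ) ≠ 0 := by exact_mod_cast hφj
    refine IsAlgebraic.of_mul (y := algebraMap ℂ Q (e j) * x (Sum.inr j))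
      (mem_nonZeroDivisors_of_ne_zero (mul_ne_zero ?_ (hne j (hJ₀ hj))))
      ((halgA _ (Subalgebra.algebraMap_mem _ _)).mul (hr j)) ?_
    · rwa [Ne, map_eq_zero_iff _ (algebraMap ℂ Q).injective]
    · rw [show algebraMap ℂ Q (e j) * x (Sum.inr j) * x (Sum.inl j) =
        -(∑ k ∈ Finset.univ.erase j, algebraMap ℂ Q (e k) * (x (Sum.inl k) * x (Sum.inr k))) by
          linear_combination h1]
      exact h2.neg
  refine ⟨fun y => ?_⟩
  have hy : y ∈ Algebra.adjoin ℂ (Set.range x) := hgen ▸ Algebra.mem_top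
  induction hy using Algebra.adjoin_induction with
  | mem y hy =>
    obtain ⟨k | k, rfl⟩ := hy
    exacts [hl k, hr k]
  | algebraMap r => exact halgA _ (Subalgebra.algebraMap_mem _ _)
  | add y z _ _ hy hz => exact hy.add hz
  | mul y z _ _ hy hz => exact hy.mul hz

/-- Comparison of nested primes by means of a common transcendence basis. -/
theorem eq_of_le_of_algebraicIndependent {σ ι : Type*} {P₀ P : Ideal (MvPolynomial σ ℂ)}
    [P₀.IsPrime] (hle : P₀ ≤ P) {c : ι → σ}
    (halg : Algebra.IsAlgebraic
      (Algebra.adjoin ℂ (Set.range fun j => Ideal.Quotient.mk P₀ (X (c j))))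
      (MvPolynomial σ ℂ ⧸ P₀))
    (hind : AlgebraicIndependent ℂ fun j => Ideal.Quotient.mk P (X (c j))) : P₀ = P := by
  refine le_antisymm hle fun f hf => ?_
  by_contra hf0
  -- In a domain, an ideal with a nonzero algebraic element meets the base ring nontrivially. This
  -- yields a nonzero polynomial in the chosen coordinates that lies in `P`, against their
  -- independence modulo `P`.
  have hne := Ideal.comap_ne_bot_of_algebraic_mem (I := P.map (Ideal.Quotient.mk P₀))
    (x := Ideal.Quotient.mk P₀ f) (fun h => hf0 (Ideal.Quotient.eq_zero_iff_mem.1 h))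
    (Ideal.mem_map_of_mem _ hf) (halg.isAlgebraic _)
  obtain ⟨⟨a, ha⟩, haP, ha0⟩ := Submodule.exists_mem_ne_zero_of_ne_bot hne
  have ha' := ha
  rw [Algebra.adjoin_range_eq_range_aeval] at ha'
  obtain ⟨g, rfl⟩ := ha'
  have h1 : ∀ P' : Ideal (MvPolynomial σ ℂ), aeval (fun j => Ideal.Quotient.mk P' (X (c j))) g =
      Ideal.Quotient.mk P' (rename c g) := fun P' => by
    refine (MvPolynomial.algHom_ext (f := aeval fun j => Ideal.Quotient.mk P' (X (c j)))
      (g := (Ideal.Quotient.mkₐ ℂ P').comp (rename c)) fun j => ?_) ▸ rfl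
    simp
  have h2 : Ideal.Quotient.mk P (rename c g) = 0 := by
    have h3 : Ideal.Quotient.mk P₀ (rename c g) ∈ P.map (Ideal.Quotient.mk P₀) := by
      rw [← h1]
      exact haP
    rw [Ideal.mem_quotient_iff_mem hle] at h3
    exact Ideal.Quotient.eq_zero_iff_mem.2 h3
  rw [← h1] at h2
  have h3 : g = 0 := hind.eq_zero_of_aeval_eq_zero _ h2
  apply ha0
  apply Subtype.ext
  change aeval _ g = 0
  rw [h3, map_zero]

/-! ### The characteristic variety of the hypergeometric module -/

section Hypergeometric

variable {n N : ℕ} {χ : Matrix (Fin n) (Fin N) ℤ}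

/-- Stated for a subset `S` because it serves twice with the same coordinates: for the whole
conormal bundle and for the part of a component inside it. -/
theorem isAlgebraic_quotient_of_vanishing {p : ZarAffine (Fin N)} (hp : p ∈ toricSet χ)
    {J₀ : Set (Fin N)} (hJ₀ : J₀ ⊆ {j | p j ≠ 0})
    (hspan : ∀ k ∈ {j | p j ≠ 0}, ∃ m : ℕ, 0 < m ∧ ∃ b : Fin N → ℤ, (∀ j, j ∉ J₀ → b j = 0) ∧
        χ.mulVec b = fun i => (m : ℤ) * χ i k)
    (hdual : ∀ j ∈ J₀, ∃ φ : Fin n → ℚ, ∑ i, φ i * χ i j ≠ 0 ∧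
        ∀ k ∈ J₀, k ≠ j → ∑ i, φ i * χ i k = 0)
    {c : Fin N → PhaseIdx N} (hc : ∀ j ∈ J₀, c j = Sum.inr j)
    (hc' : ∀ j, j ∉ J₀ → c j = Sum.inl j)
    {S : Set (ZarAffine (PhaseIdx N))} (hS : S ⊆ conormalBundle (torusOrbit χ p))
    (hSne : S.Nonempty) [hP : (ZarAffine.vanishing S).IsPrime] :
    Algebra.IsAlgebraic
      (Algebra.adjoin ℂ (Set.range fun j => Ideal.Quotient.mk (ZarAffine.vanishing S) (X (c j))))
      (MvPolynomial (PhaseIdx N) ℂ ⧸ ZarAffine.vanishing S) := by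
  set P := ZarAffine.vanishing S
  have hmk : ∀ f : MvPolynomial (PhaseIdx N) ℂ, (∀ x ∈ S, eval (σ := PhaseIdx N) x f = 0) →
      Ideal.Quotient.mk P f = 0 := fun f hf =>
    Ideal.Quotient.eq_zero_iff_mem.2 (ZarAffine.mem_vanishing.2 hf)
  have hsymb : ∀ f ∈ symbolIdeal χ, Ideal.Quotient.mk P f = 0 := fun f hf =>
    hmk f fun x hx => mem_zeros_symbolIdeal.2
      ⟨_, ⟨p, closure_torusOrbit_onePoint (χ := χ) ▸ hp, rfl⟩, hS hx⟩ f hf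
  refine isAlgebraic_of_conormal_relations (χ := χ)
    (x := fun k => Ideal.Quotient.mk P (X k)) hJ₀ hspan hdual ?_ ?_ ?_ ?_ ?_ hc hc'
  · rw [Algebra.adjoin_range_eq_range_aeval, AlgHom.range_eq_top]
    intro y
    obtain ⟨f, rfl⟩ := Ideal.Quotient.mk_surjective y
    refine ⟨f, ?_⟩
    refine (MvPolynomial.algHom_ext (f := aeval fun k => Ideal.Quotient.mk P (X k))
      (g := Ideal.Quotient.mkₐ ℂ P) fun j => ?_) ▸ rfl
    simp
  · intro j hj
    refine hmk _ fun x hx => ?_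
    rw [ZarAffine.eval_X]
    exact (eq_zero_iff_of_mem_torusOrbit (hS hx).1 j).2 (not_not.1 hj)
  · intro j hj h
    obtain ⟨x, hx⟩ := hSne
    have := ZarAffine.mem_vanishing.1 (Ideal.Quotient.eq_zero_iff_mem.1 h) x hx
    rw [ZarAffine.eval_X] at this
    exact hj ((eq_zero_iff_of_mem_torusOrbit (hS hx).1 j).1 this)
  · intro a ha
    have := hsymb (xiBox a) (Ideal.subset_span (Or.inr ⟨a, ha, rfl⟩))
    rw [xiBox, map_sub, sub_eq_zero] at this
    simpa only [map_prod, map_pow] using this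
  · intro i
    have := hsymb (thetaBar χ i) (Ideal.subset_span (Or.inl ⟨i, rfl⟩))
    rw [thetaBar, map_sum] at this
    rw [← this]
    refine Finset.sum_congr rfl fun j _ => ?_
    rw [map_mul, map_mul, mul_assoc]
    rfl

theorem isWeightedHomogeneous_thetaBar (i : Fin n) :
    IsWeightedHomogeneous Weyl.xiWeight (thetaBar χ i) 1 :=
  IsWeightedHomogeneous.sum _ _ _ fun j _ => by
    have := ((isWeightedHomogeneous_C Weyl.xiWeight (χ i j : ℂ)).mul
      (isWeightedHomogeneous_X ℂ Weyl.xiWeight (Sum.inl j : PhaseIdx N))).mul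
      (isWeightedHomogeneous_X ℂ Weyl.xiWeight (Sum.inr j : PhaseIdx N))
    simpa [Weyl.xiWeight] using this

theorem isWeightedHomogeneous_prod_xi (u : Fin N → ℕ) :
    IsWeightedHomogeneous Weyl.xiWeight
      (∏ j, X (Sum.inr j) ^ u j : MvPolynomial (PhaseIdx N) ℂ) (∑ j, u j) :=
  IsWeightedHomogeneous.prod _ _ _ fun j _ => by
    simpa [Weyl.xiWeight] using
      (isWeightedHomogeneous_X ℂ Weyl.xiWeight (Sum.inr j : PhaseIdx N)).pow (u j)

/-- Pairing `cχ = (1, …, 1)` with `a ∈ ker χ` gives `∑ a_j = 0`, so the two monomials have equal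
degree. -/
theorem isWeightedHomogeneous_xiBox (hhom : ∃ c : Fin n → ℤ, ∀ j, ∑ i, c i * χ i j = 1)
    {a : Fin N → ℤ} (ha : χ.mulVec a = 0) :
    IsWeightedHomogeneous Weyl.xiWeight (xiBox a) (∑ j, (a j).toNat) := by
  obtain ⟨c, hc⟩ := hhom
  have h1 : ∑ j, a j = 0 := by
    calc ∑ j, a j = ∑ j, (∑ i, c i * χ i j) * a j := by simp [hc]
      _ = ∑ i, c i * χ.mulVec a i := by
        simp only [Matrix.mulVec, dotProduct, Finset.mul_sum, Finset.sum_mul]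
        rw [Finset.sum_comm]
        simp only [mul_assoc]
      _ = 0 := by simp [ha]
  have h2 : ∑ j, (-a j).toNat = ∑ j, (a j).toNat := by
    have h3 : ∑ j, (((a j).toNat : ℤ) - ((-a j).toNat : ℤ)) = 0 := by
      rw [← h1]
      exact Finset.sum_congr rfl fun j _ => by omega
    rw [Finset.sum_sub_distrib, sub_eq_zero] at h3
    exact_mod_cast h3.symm
  refine (weightedHomogeneousSubmodule ℂ Weyl.xiWeight _).sub_mem
    (isWeightedHomogeneous_prod_xi _) ?_
  rw [← h2]
  exact isWeightedHomogeneous_prod_xi _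

/-- The class of `1` generates the module, is an eigenvector of the first-order operators with
symbols `θ̄_i`, and is killed by the binomial operators; `mem_radical_annihilator` covers both
cases. -/
theorem symbolIdeal_le_radical (hhom : ∃ c : Fin n → ℤ, ∀ j, ∑ i, c i * χ i j = 1)
    {lam : Fin n → ℂ} {F : ℤ → AddSubgroup (HyperModule χ lam)}
    (hF : Weyl.IsGoodFiltration (N := N) F) :
    symbolIdeal χ ≤
      (Module.annihilator (MvPolynomial (PhaseIdx N) ℂ) hF.toFiltration.Gr).radical := by
  have _ := hF.finite_gr
  let u : HyperModule χ lam := Submodule.Quotient.mk 1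
  obtain ⟨m, hm⟩ := hF.exhaustive u
  have hcyc : ∀ x : HyperModule χ lam, ∃ Q : Weyl N, x = Q • u := fun x => by
    obtain ⟨Q, rfl⟩ := Submodule.Quotient.mk_surjective _ x
    exact ⟨Q, by rw [← Submodule.Quotient.mk_smul, smul_eq_mul, mul_one]⟩
  rw [symbolIdeal, Ideal.span_le]
  rintro _ (⟨i, rfl⟩ | ⟨a, ha, rfl⟩)
  · refine hF.toFiltration.mem_radical_annihilator (u := u) (m1 := m) hm hcyc
      (isWeightedHomogeneous_thetaBar i) (c := lam i) ?_ (Or.inr le_rfl)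
    rw [← Submodule.Quotient.mk_smul, ← Submodule.Quotient.mk_smul, smul_eq_mul, mul_one,
      Submodule.Quotient.eq, ← Algebra.algebraMap_eq_smul_one]
    exact Ideal.subset_span (Or.inl ⟨i, rfl⟩)
  · refine hF.toFiltration.mem_radical_annihilator (u := u) (m1 := m) hm hcyc
      (isWeightedHomogeneous_xiBox hhom ha) (c := 0) ?_ (Or.inl rfl)
    rw [zero_smul, ← Submodule.Quotient.mk_smul, smul_eq_mul, mul_one,
      Submodule.Quotient.mk_eq_zero]
    exact Ideal.subset_span (Or.inr ⟨a, ha, rfl⟩)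

theorem charVariety_eq_zeros {lam : Fin n → ℂ} {F : ℤ → AddSubgroup (HyperModule χ lam)}
    (hF : Weyl.IsGoodFiltration (N := N) F) :
    Weyl.charVariety F = {x : ZarAffine (PhaseIdx N) |
      ∀ f ∈ Module.annihilator (MvPolynomial (PhaseIdx N) ℂ) hF.toFiltration.Gr,
        eval (σ := PhaseIdx N) x f = 0} := by
  ext x
  exact forall_congr' fun f => by rw [hF.mem_annihilator_iff]

theorem charVariety_subset (hhom : ∃ c : Fin n → ℤ, ∀ j, ∑ i, c i * χ i j = 1)
    {lam : Fin n → ℂ} {F : ℤ → AddSubgroup (HyperModule χ lam)}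
    (hF : Weyl.IsGoodFiltration (N := N) F) :
    Weyl.charVariety F ⊆ ⋃ O ∈ orbitsInClosure χ, conormalBundle O := by
  intro x hx
  rw [charVariety_eq_zeros hF] at hx
  simp only [Set.mem_iUnion, exists_prop]
  refine mem_zeros_symbolIdeal.1 fun f hf => ?_
  obtain ⟨k, hk⟩ := symbolIdeal_le_radical hhom hF hf
  have := hx _ hk
  rw [map_pow] at this
  exact eq_zero_of_pow_eq_zero this

/-- The closures of the sets `Z ∩ C i` form a finite closed cover of the irreducible set `Z`. -/
theorem IsIrreducible.exists_subset_closure_inter {X : Type*} [TopologicalSpace X] {Z : Set X}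
    (hZ : IsIrreducible Z) {ι : Type*} {I : Set ι} (hI : I.Finite) {C : ι → Set X}
    (h : Z ⊆ ⋃ i ∈ I, C i) : ∃ i ∈ I, Z ⊆ closure (Z ∩ C i) := by
  classical
  obtain ⟨_, hz, hZz⟩ := isIrreducible_iff_sUnion_isClosed.1 hZ
    (hI.toFinset.image fun i => closure (Z ∩ C i)) (by
      intro z hz
      obtain ⟨i, -, rfl⟩ := Finset.mem_image.1 hz
      exact isClosed_closure) (by
      intro x hx
      obtain ⟨i, hi, hxi⟩ := Set.mem_iUnion₂.1 (h hx)
      exact ⟨_, Finset.mem_coe.2 (Finset.mem_image.2 ⟨i, hI.mem_toFinset.2 hi, rfl⟩),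
        subset_closure ⟨hx, hxi⟩⟩)
  obtain ⟨i, hi, rfl⟩ := Finset.mem_image.1 hz
  exact ⟨i, hI.mem_toFinset.1 hi, hZz⟩

theorem irredComponent_charVariety (hhom : ∃ c : Fin n → ℤ, ∀ j, ∑ i, c i * χ i j = 1)
    {lam : Fin n → ℂ} {F : ℤ → AddSubgroup (HyperModule χ lam)}
    (hF : Weyl.IsGoodFiltration (N := N) F) {Z : Set (ZarAffine (PhaseIdx N))}
    (hZ : IsIrredComponentOf Z (Weyl.charVariety F)) :
    (∃ O ∈ orbitsInClosure χ, Z = closure (conormalBundle O)) ∧ topologicalKrullDim Z = N := by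
  classical
  have _ := hF.finite_gr
  obtain ⟨O, hO, hZO⟩ := hZ.prop.1.exists_subset_closure_inter finite_orbitsInClosure
    (hZ.prop.2.trans (charVariety_subset hhom hF))
  rw [charVariety_eq_zeros hF] at hZ
  obtain ⟨hZc, hZmin⟩ := ZarAffine.mem_minimalPrimes_of_isIrredComponentOf hZ
  obtain ⟨p, hp, rfl⟩ := id hO
  rw [closure_torusOrbit_onePoint] at hp
  obtain ⟨J₀, hJ₀, hspan, hdual⟩ := exists_independent_columns χ {j | p j ≠ 0}
  -- One coordinate from each conjugate pair, so operators belonging to different indices commute.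
  let c : Fin N → PhaseIdx N := fun j => if j ∈ J₀ then Sum.inr j else Sum.inl j
  have hc : ∀ j ∈ J₀, c j = Sum.inr j := fun j hj => if_pos hj
  have hc' : ∀ j, j ∉ J₀ → c j = Sum.inl j := fun j hj => if_neg hj
  set S := Z ∩ conormalBundle (torusOrbit χ p) with hSdef
  have hSZ : closure S = Z :=
    (closure_minimal Set.inter_subset_left hZc).antisymm hZO
  have hvan : ZarAffine.vanishing S = ZarAffine.vanishing Z := by
    rw [← ZarAffine.vanishing_closure S, hSZ]
  have hSne : S.Nonempty := by
    rw [← closure_nonempty_iff, hSZ]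
    exact hZ.prop.1.nonempty
  rw [← hvan] at hZmin
  have hSp : (ZarAffine.vanishing S).IsPrime := hZmin.1.1
  have hCp := isPrime_vanishing_conormalBundle hp
  have halg := isAlgebraic_quotient_of_vanishing hp hJ₀ hspan hdual hc hc'
    (S := S) Set.inter_subset_right hSne
  -- Here it matters that `Z` is a whole component: the trace obstruction needs its prime to be
  -- minimal over the annihilator.
  have hind := algebraicIndependent_of_mem_minimalPrimes
    hF.toFiltration.reesGen_inl_commute hF.toFiltration.reesGen_inr_commute
    (fun _ _ h => hF.toFiltration.reesGen_inr_inl_commute h)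
    hF.toFiltration.reesGen_inr_mul_inl hF.toFiltration.commute_reesGen_reesShift
    hF.toFiltration.reesShift_injective hF.toFiltration.toGr_surjective
    hF.toFiltration.ker_toGr hF.toFiltration.toGr_reesGen hZmin
    (fun j => by by_cases hj : j ∈ J₀ <;> simp [c, hj]) halg
  -- The prime of the conormal bundle is contained in that of `Z`. The same `N` coordinates are
  -- algebraically spanning for the former and independent for the latter, so the primes agree.
  have heq := eq_of_le_of_algebraicIndependent
    (ZarAffine.vanishing_anti (Set.inter_subset_right : S ⊆ _))
    (isAlgebraic_quotient_of_vanishing hp hJ₀ hspan hdual hc hc' (S := conormalBundle _)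
      subset_rfl (hSne.mono Set.inter_subset_right)) hind
  refine ⟨⟨_, hO, ?_⟩, ?_⟩
  · rw [← hSZ]
    ext x
    rw [ZarAffine.mem_closure_iff, ZarAffine.mem_closure_iff, heq]
  · rw [ZarAffine.topologicalKrullDim_eq hZc, ← hvan]
    exact ringKrullDim_eq_of_isTranscendenceBasis
      (hind.isTranscendenceBasis_iff_isAlgebraic.2 halg)

end Hypergeometric

end

theorem mainTheorem6 {n N : ℕ} (χ : Matrix (Fin n) (Fin N) ℤ)
    (hrank : (χ.map (fun k : ℤ => (k : ℚ))).rank = n)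
    (hhom : ∃ c : Fin n → ℤ, ∀ j, ∑ i, c i * χ i j = 1) :
    (orbitsInClosure χ).Finite ∧
    (orbitsInClosure χ).PairwiseDisjoint id ∧
    closure (torusOrbit χ (onePoint N)) = ⋃ O ∈ orbitsInClosure χ, O ∧
    (orbitsInClosure χ).PairwiseDisjoint conormalBundle ∧
    affineSupport (SymbolRing χ) = ⋃ O ∈ orbitsInClosure χ, conormalBundle O ∧
    ∀ (lam : Fin n → ℂ) (F : ℤ → AddSubgroup (HyperModule χ lam)),
      Weyl.IsGoodFiltration (N := N) F →
      ∀ Z : Set (ZarAffine (PhaseIdx N)), IsIrredComponentOf Z (Weyl.charVariety F) →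
        (∃ O ∈ orbitsInClosure χ, Z = closure (conormalBundle O)) ∧
        topologicalKrullDim Z = N :=
  ⟨finite_orbitsInClosure, pairwiseDisjoint_orbitsInClosure, closure_eq_biUnion_orbitsInClosure,
    pairwiseDisjoint_conormalBundle, affineSupport_symbolRing,
    fun _ _ hF _ hZ => irredComponent_charVariety hhom hF hZ⟩
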